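/- **Gauge covariance of higher parallel transport.** Let $(G,H,t,m)$ be a Lie crossed module: $G,H$ are (finite-dimensional) Lie groups with Lie algebras $\mathfrak g,\mathfrak h$, $t:H\to G$ is a Lie group homomorphism, and $m:G\to\mathrm{Aut}(H)$ is a smooth action with $t(m(a)(A))=a\,t(A)\,a^{-1}$ and $m(t(A))(B)=ABA^{-1}$. Let $\dot t:\mathfrak h\to\mathfrak g$ be the differential of $t$ at $1_H$, $\dot m(a):\mathfrak h\to\mathfrak h$ the differential of $m(a)$ at $1_H$, and $\widehat m:\mathfrak g\times\mathfrak h\to\mathfrak h$ the differential of $a\mapsto\dot m(a)$ at $1_G$. Let $M$ be a smooth manifold. A *curve* $\gamma:p_0\to p_1$ is a smooth map $\mathbb R\to M$ such that, for some $0<\epsilon<1/2$, $\gamma(x)=p_0$ for $x<\epsilon$ and $\gamma(x)=p_1$ for $x>1-\epsilon$. A *surface* $\Sigma:\gamma_0\Rightarrow\gamma_1$ between curves $\gamma_0,\gamma_1:p_0\to p_1$ is a smooth map $\mathbb R^2\to M$ such that, for some $0<\epsilon<1/2$, $\Sigma(x,y)$ equals $p_0$ for $x<\epsilon$, $p_1$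 for $x>1-\epsilon$, $\gamma_0(x)$ for $y<\epsilon$, and $\gamma_1(x)$ for $y>1-\epsilon$. A *$(G,H)$-connection doublet* on $M$ is a pair of smooth forms $\theta\in\Omega^1(M,\mathfrak g)$, $\Upsilon\in\Omega^2(M,\mathfrak h)$ with $d\theta+\tfrac12[\theta,\theta]-\dot t(\Upsilon)=0$. A *$1$-gauge transformation* is a pair of a smooth map $g:M\to G$ and a smooth form $J\in\Omega^1(M,\mathfrak h)$; it transforms $(\theta,\Upsilon)$ into $${}^{g,J}\theta=\mathrm{Ad}\,g(\theta)-dg\,g^{-1}-\dot t(J),\qquad {}^{g,J}\Upsilon=\dot m(g)(\Upsilon)-dJ-\tfrac12[J,J]-\widehat m({}^{g,J}\theta,J).$$ For a pair of forms $(a,B)\in\Omega^1(\mathbb R^2,\mathfrak g)\times\Omega^2(\mathbb R^2,\mathfrak h)$ let $f_{a,B}(x,x_0;y)$, $g_{a,B}(x;y,y_0)$ and $W_{a,B}(x,x_0;y,y_0)$ be the solutions $u_{|y,x_0}(x)$, $v_{|x,y_0}(y)$ and $E_{|x_0,y_0}(x,y)$ of $$\partial_xu\,u^{-1}=-a_x(x,y),\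 u_{|y,x_0}(x_0)=1_G;\qquad \partial_yv\,v^{-1}=-a_y(x,y),\ v_{|x,y_0}(y_0)=1_G;$$ $$\partial_x(\partial_yE\,E^{-1})=-\dot m\big(v_{|x_0,y_0}(y)^{-1}u_{|y,x_0}(x)^{-1}\big)(B_{xy}(x,y)),\quad E_{|x_0,y_0}(x_0,y)=E_{|x_0,y_0}(x,y_0)=1_H.$$ For $\varkappa:\mathbb R^2\to G$ and $\Gamma\in\Omega^1(\mathbb R^2,\mathfrak h)$ let $\Psi_{\varkappa,\Gamma;a,B}(x,x_0;y)$ be the solution $\Lambda_{|y,x_0}(x)$ of $$\Lambda^{-1}\partial_x\Lambda=-\dot m\big(f_{a,B}(x,x_0;y)^{-1}\varkappa(x,y)^{-1}\big)(\Gamma_x(x,y)),\qquad \Lambda_{|y,x_0}(x_0)=1_H.$$ Write $I_\gamma(x,y)=\gamma(x)$. The parallel transports of $(\theta,\Upsilon)$ are $$F_{\theta,\Upsilon}(\gamma)=f_{I_\gamma^*\theta,I_\gamma^*\Upsilon}(1,0;y)\in G\ \text{(for any } y\text{)},\qquad F_{\theta,\Upsilon}(\Sigma)=W_{\Sigma^*\theta,\Sigma^*\Upsilon}(0,1;1,0)\in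 H.$$ **Proposition.** Let $(\theta,\Upsilon)$ be a $(G,H)$-connection doublet on $M$ and $(g,J)$ a $1$-gauge transformation. Let $p_0,p_1\in M$, let $\gamma_0,\gamma_1:p_0\to p_1$ be curves and $\Sigma:\gamma_0\Rightarrow\gamma_1$ a surface. Then $$F_{{}^{g,J}\theta,{}^{g,J}\Upsilon}(\gamma_0)=g(p_1)\,t(G_{g,J;\theta,\Upsilon}(\gamma_0))\,F_{\theta,\Upsilon}(\gamma_0)\,g(p_0)^{-1},$$ $$F_{{}^{g,J}\theta,{}^{g,J}\Upsilon}(\gamma_1)=g(p_1)\,t(G_{g,J;\theta,\Upsilon}(\gamma_1))\,F_{\theta,\Upsilon}(\gamma_1)\,g(p_0)^{-1},$$ $$F_{{}^{g,J}\theta,{}^{g,J}\Upsilon}(\Sigma)=m(g(p_1))\big(G_{g,J;\theta,\Upsilon}(\gamma_1)\,F_{\theta,\Upsilon}(\Sigma)\,G_{g,J;\theta,\Upsilon}(\gamma_0)^{-1}\big),$$ where $G_{g,J;\theta,\Upsilon}(\gamma_i)=\Psi_{\Sigma^*g,\Sigma^*J;\Sigma^*\theta,\Sigma^*\Upsilon}(0,1;i)\in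 H$ for $i=0,1$. -/

import Mathlib

open Set
open scoped Manifold ContDiff Topology

noncomputable section

namespace HigherGauge

/-! Conventions.  A manifold is a finite-dimensional smooth manifold without boundary, modelled on a
normed space `E` through `𝓘(ℝ, E)`.  In Mathlib `TangentSpace 𝓘(ℝ, E) p` is by definition a copy of
`E`.  In particular, the Lie algebra `T₁G` of a Lie group `G` modelled on `EG` is the space `EG`, with
the bracket of `GroupLieAlgebra 𝓘(ℝ, EG) G`; we write `EG` for it where a norm is needed. -/

section Forms

/-- Vector-valued differential `k`-forms on a manifold (not assumed smooth). -/
abbrev DForm (E : Type*) [NormedAddCommGroup E] [NormedSpace ℝ E]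
    (M : Type*) [TopologicalSpace M] [ChartedSpace E M]
    (F : Type*) [NormedAddCommGroup F] [NormedSpace ℝ F] (k : ℕ) : Type _ :=
  (p : M) → TangentSpace 𝓘(ℝ, E) p [⋀^Fin k]→L[ℝ] F

variable {E : Type*} [NormedAddCommGroup E] [NormedSpace ℝ E]
  {M : Type*} [TopologicalSpace M] [ChartedSpace E M]
  {E' : Type*} [NormedAddCommGroup E'] [NormedSpace ℝ E']
  {N : Type*} [TopologicalSpace N] [ChartedSpace E' N]
  {F : Type*} [NormedAddCommGroup F] [NormedSpace ℝ F] {k : ℕ}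

/-- The pull-back `f^* η` of a form along a map of manifolds. -/
def pullback (f : N → M) (η : DForm E M F k) : DForm E' N F k := fun q =>
  (η (f q)).compContinuousLinearMap (mfderiv 𝓘(ℝ, E') 𝓘(ℝ, E) f q)

/-- The coordinate expression of a form in the preferred chart at `p₀`, i.e. its pull-back by the
inverse chart, a form on (the target of the chart in) the model space. -/
def chartRep (η : DForm E M F k) (p₀ : M) : E → E [⋀^Fin k]→L[ℝ] F :=
  (pullback (chartAt E p₀).symm η : DForm E E F k)

/-- A form is smooth if all its coordinate expressions are. -/
def IsSmoothForm (η : DForm E M F k) : Prop :=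
  ∀ p₀ : M, ContDiffOn ℝ ∞ (chartRep η p₀) (chartAt E p₀).target

/-- The exterior derivative on a manifold, computed at `p` in the preferred chart at `p`; the tangent
space at `p` is identified with the model space through this very chart. -/
def dForm (η : DForm E M F k) : DForm E M F (k + 1) := fun p =>
  (extDeriv (chartRep η p) (chartAt E p p) : E [⋀^Fin (k + 1)]→L[ℝ] F)

/-- The wedge product of two vector-valued covectors with respect to a bilinear pairing `b`:
`(v, w) ↦ b (α v) (β w) - b (α w) (β v)`. -/
def wedge {V : Type*} [AddCommGroup V] [Module ℝ V] [TopologicalSpace V]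
    {F₁ F₂ F₃ : Type*} [NormedAddCommGroup F₁] [NormedSpace ℝ F₁]
    [NormedAddCommGroup F₂] [NormedSpace ℝ F₂] [NormedAddCommGroup F₃] [NormedSpace ℝ F₃]
    (b : F₁ →L[ℝ] F₂ →L[ℝ] F₃) (α : V [⋀^Fin 1]→L[ℝ] F₁) (β : V [⋀^Fin 1]→L[ℝ] F₂) :
    V [⋀^Fin 2]→L[ℝ] F₃ where
  toFun v := b (α ![v 0]) (β ![v 1]) - b (α ![v 1]) (β ![v 0])
  map_update_add' := by
    intro inst v i x y
    have e : ∀ x : V, Function.update ![(0 : V)] 0 x = ![x] := fun x => by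
      ext j; fin_cases j; simp
    have ha : ∀ x y : V, α ![x + y] = α ![x] + α ![y] := fun x y => by
      have h := α.map_update_add ![0] 0 x y
      rwa [e, e, e] at h
    have hb : ∀ x y : V, β ![x + y] = β ![x] + β ![y] := fun x y => by
      have h := β.map_update_add ![0] 0 x y
      rwa [e, e, e] at h
    fin_cases i <;> simp [Function.update, ha, hb] <;> abel
  map_update_smul' := by
    intro inst v i c x
    have e : ∀ x : V, Function.update ![(0 : V)] 0 x = ![x] := fun x => by
      ext j; fin_cases j; simp
    have ha : ∀ (c : ℝ) (x : V), α ![c • x] = c • α ![x] := fun c x => by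
      have h := α.map_update_smul ![0] 0 c x
      rwa [e, e] at h
    have hb : ∀ (c : ℝ) (x : V), β ![c • x] = c • β ![x] := fun c x => by
      have h := β.map_update_smul ![0] 0 c x
      rwa [e, e] at h
    fin_cases i <;> simp [Function.update, ha, hb, smul_sub]
  cont := by
    have h : ∀ i : Fin 2, Continuous (fun v : Fin 2 → V => ![v i]) := fun i =>
      continuous_pi fun j => by
        fin_cases j
        simpa using continuous_apply i
    have h₁ : ∀ i, Continuous (fun v : Fin 2 → V => b (α ![v i])) := fun i =>
      b.continuous.comp (α.cont.comp (h i))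
    have h₂ : ∀ i, Continuous (fun v : Fin 2 → V => β ![v i]) := fun i => β.cont.comp (h i)
    exact ((h₁ 0).clm_apply (h₂ 1)).sub ((h₁ 1).clm_apply (h₂ 0))
  map_eq_zero_of_eq' := by
    intro v i j hv hij
    have h : v 0 = v 1 := by
      fin_cases i <;> fin_cases j <;> simp_all
    simp [h]

end Forms

section LieGroups

variable {EG : Type*} [NormedAddCommGroup EG] [NormedSpace ℝ EG]
  {G : Type*} [TopologicalSpace G] [ChartedSpace EG G] [Group G]

variable (G) in
/-- The bracket of the Lie algebra of a Lie group, as a continuous bilinear map. -/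
def lieBracketCLM [FiniteDimensional ℝ EG] [LieGroup 𝓘(ℝ, EG) ∞ G] : EG →L[ℝ] EG →L[ℝ] EG :=
  haveI : CompleteSpace EG := FiniteDimensional.complete ℝ EG
  haveI : LieGroup 𝓘(ℝ, EG) (minSmoothness ℝ 3) G := by
    rw [minSmoothness_of_isRCLikeNormedField]
    exact inferInstance
  let L : GroupLieAlgebra 𝓘(ℝ, EG) G →ₗ[ℝ] GroupLieAlgebra 𝓘(ℝ, EG) G →ₗ[ℝ]
      GroupLieAlgebra 𝓘(ℝ, EG) G :=
    LinearMap.mk₂ ℝ (fun X Y => ⁅X, Y⁆) add_lie smul_lie lie_add lie_smul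
  LinearMap.toContinuousBilinearMap (E := EG) (F := EG) (G := EG) L

theorem lieBracketCLM_apply [FiniteDimensional ℝ EG] [LieGroup 𝓘(ℝ, EG) ∞ G]
    (X Y : EG) :
    lieBracketCLM G X Y =
      @Bracket.bracket (GroupLieAlgebra 𝓘(ℝ, EG) G) (GroupLieAlgebra 𝓘(ℝ, EG) G) _ X Y := rfl

/-- The adjoint action `Ad a` of a Lie group on its Lie algebra. -/
def Ad (a : G) : EG →L[ℝ] EG :=
  mfderiv 𝓘(ℝ, EG) 𝓘(ℝ, EG) (fun x : G => a * x * a⁻¹) 1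

/-- The Lie-algebra valued 1-form `dg g⁻¹` of a map `g : M → G`. -/
def rightMaurerCartan {E : Type*} [NormedAddCommGroup E] [NormedSpace ℝ E]
    {M : Type*} [TopologicalSpace M] [ChartedSpace E M] (g : M → G) : DForm E M EG 1 := fun p =>
  ContinuousAlternatingMap.ofSubsingleton ℝ _ EG (0 : Fin 1)
    (mfderiv 𝓘(ℝ, E) 𝓘(ℝ, EG) (fun q => g q * (g p)⁻¹) p : TangentSpace 𝓘(ℝ, E) p →L[ℝ] EG)

/-- `u` is differentiable at `s` and `(du/ds) u⁻¹ = X` there. -/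
def HasRightLogDerivAt (u : ℝ → G) (X : EG) (s : ℝ) : Prop :=
  HasMFDerivAt 𝓘(ℝ, ℝ) 𝓘(ℝ, EG) (fun r => u r * (u s)⁻¹) s
    (ContinuousLinearMap.toSpanSingleton ℝ X : ℝ →L[ℝ] EG)

/-- `u` is differentiable at `s` and `u⁻¹ (du/ds) = X` there. -/
def HasLeftLogDerivAt (u : ℝ → G) (X : EG) (s : ℝ) : Prop :=
  HasMFDerivAt 𝓘(ℝ, ℝ) 𝓘(ℝ, EG) (fun r => (u s)⁻¹ * u r) s
    (ContinuousLinearMap.toSpanSingleton ℝ X : ℝ →L[ℝ] EG)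

/-- The solution `u` of the differential problem `(du/ds) u⁻¹ = A`, `u(s₀) = 1`.  (For smooth `A` the
solution exists and is unique already among differentiable maps.) -/
def rightSolution (A : ℝ → EG) (s₀ : ℝ) : ℝ → G :=
  Classical.epsilon fun u : ℝ → G => u s₀ = 1 ∧ ∀ s, HasRightLogDerivAt u (A s) s

/-- The solution `u` of the differential problem `u⁻¹ (du/ds) = A`, `u(s₀) = 1`.  (For smooth `A` the
solution exists and is unique already among differentiable maps.) -/
def leftSolution (A : ℝ → EG) (s₀ : ℝ) : ℝ → G :=
  Classical.epsilon fun u : ℝ → G => u s₀ = 1 ∧ ∀ s, HasLeftLogDerivAt u (A s) s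

end LieGroups

/-- A Lie crossed module `(G, H, t, m)`: Lie groups `G`, `H`, a Lie group homomorphism `t : H → G` and
a smooth action `m` of `G` on `H` by automorphisms, such that `t` is equivariant and the Peiffer
identity holds. -/
structure LieCrossedModule (EG EH G H : Type*)
    [NormedAddCommGroup EG] [NormedSpace ℝ EG] [NormedAddCommGroup EH] [NormedSpace ℝ EH]
    [TopologicalSpace G] [ChartedSpace EG G] [Group G]
    [TopologicalSpace H] [ChartedSpace EH H] [Group H] where
  t : H →* G
  m : G →* MulAut H
  contMDiff_t : ContMDiff 𝓘(ℝ, EH) 𝓘(ℝ, EG) ∞ t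
  contMDiff_m : ContMDiff (𝓘(ℝ, EG).prod 𝓘(ℝ, EH)) 𝓘(ℝ, EH) ∞ (fun q : G × H => m q.1 q.2)
  t_m : ∀ (a : G) (A : H), t (m a A) = a * t A * a⁻¹
  m_t : ∀ A B : H, m (t A) B = A * B * A⁻¹

variable {EG EH G H : Type*}
  [NormedAddCommGroup EG] [NormedSpace ℝ EG] [NormedAddCommGroup EH] [NormedSpace ℝ EH]
  [TopologicalSpace G] [ChartedSpace EG G] [Group G]
  [TopologicalSpace H] [ChartedSpace EH H] [Group H]
  {E : Type*} [NormedAddCommGroup E] [NormedSpace ℝ E]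
  {M : Type*} [TopologicalSpace M] [ChartedSpace E M]

namespace LieCrossedModule

variable (X : LieCrossedModule EG EH G H)

/-- `ṫ : 𝔥 → 𝔤`, the differential of `t` at the identity. -/
def tDot : EH →L[ℝ] EG := mfderiv 𝓘(ℝ, EH) 𝓘(ℝ, EG) X.t 1

/-- `ṁ(a) : 𝔥 → 𝔥`, the differential of the automorphism `m(a)` at the identity. -/
def mDot (a : G) : EH →L[ℝ] EH := mfderiv 𝓘(ℝ, EH) 𝓘(ℝ, EH) (X.m a) 1

/-- `m̂ : 𝔤 × 𝔥 → 𝔥`, the differential at the identity of `a ↦ ṁ(a)`. -/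
def mHat : EG →L[ℝ] EH →L[ℝ] EH :=
  mfderiv 𝓘(ℝ, EG) 𝓘(ℝ, EH →L[ℝ] EH) (fun a : G => X.mDot a) 1

/-- A `(G, H)`-connection doublet on `M`: smooth forms `θ ∈ Ω¹(M, 𝔤)`, `Υ ∈ Ω²(M, 𝔥)` with
`dθ + ½ [θ, θ] - ṫ(Υ) = 0`. -/
structure IsConnectionDoublet [FiniteDimensional ℝ EG] [LieGroup 𝓘(ℝ, EG) ∞ G]
    (θ : DForm E M EG 1) (Υ : DForm E M EH 2) : Prop where
  smooth_one : IsSmoothForm θ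
  smooth_two : IsSmoothForm Υ
  fakeCurvature : ∀ p : M, dForm θ p + (1 / 2 : ℝ) • wedge (lieBracketCLM G) (θ p) (θ p)
    - X.tDot.compContinuousAlternatingMap (Υ p) = 0

/-- The gauge transformed 1-form `Ad g (θ) - dg g⁻¹ - ṫ(J)`. -/
def gaugeOne (g : M → G) (J : DForm E M EH 1) (θ : DForm E M EG 1) : DForm E M EG 1 := fun p =>
  (Ad (g p)).compContinuousAlternatingMap (θ p) - rightMaurerCartan g p
    - X.tDot.compContinuousAlternatingMap (J p)

/-- The gauge transformed 2-form
`ṁ(g)(Υ) - dJ - ½ [J, J] - m̂(Ad g (θ) - dg g⁻¹ - ṫ(J), J)`. -/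
def gaugeTwo [FiniteDimensional ℝ EH] [LieGroup 𝓘(ℝ, EH) ∞ H]
    (g : M → G) (J : DForm E M EH 1) (θ : DForm E M EG 1) (Υ : DForm E M EH 2) :
    DForm E M EH 2 := fun p =>
  (X.mDot (g p)).compContinuousAlternatingMap (Υ p) - dForm J p
    - (1 / 2 : ℝ) • wedge (lieBracketCLM H) (J p) (J p)
    - wedge X.mHat (X.gaugeOne g J θ p) (J p)

end LieCrossedModule

/-! ### Integration of differential data on the plane -/

/-- The component `α_x(x, y)` of a 1-form on the plane. -/
def compX {F : Type*} [NormedAddCommGroup F] [NormedSpace ℝ F]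
    (α : DForm (ℝ × ℝ) (ℝ × ℝ) F 1) (x y : ℝ) : F :=
  α (x, y) ![((1, 0) : ℝ × ℝ)]

/-- The component `α_y(x, y)` of a 1-form on the plane. -/
def compY {F : Type*} [NormedAddCommGroup F] [NormedSpace ℝ F]
    (α : DForm (ℝ × ℝ) (ℝ × ℝ) F 1) (x y : ℝ) : F :=
  α (x, y) ![((0, 1) : ℝ × ℝ)]

/-- The component `B_{xy}(x, y)` of a 2-form `B = B_{xy} dx ∧ dy` on the plane. -/
def compXY {F : Type*} [NormedAddCommGroup F] [NormedSpace ℝ F]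
    (B : DForm (ℝ × ℝ) (ℝ × ℝ) F 2) (x y : ℝ) : F :=
  B (x, y) ![((1, 0) : ℝ × ℝ), ((0, 1) : ℝ × ℝ)]

/-- The three maps `f(x', x; y)`, `g(x; y', y)`, `W(x', x; y', y)` of a `(G, H)`-cocycle. -/
structure CocycleData (G H : Type*) where
  f : ℝ → ℝ → ℝ → G
  g : ℝ → ℝ → ℝ → G
  W : ℝ → ℝ → ℝ → ℝ → H

/-- The three maps `κ(x; y)`, `Ψ(x', x; y)`, `Φ(x; y', y)` of an integral 1-gauge transformation. -/
structure IntegralGaugeData (G H : Type*) where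
  κ : ℝ → ℝ → G
  Ψ : ℝ → ℝ → ℝ → H
  Φ : ℝ → ℝ → ℝ → H

namespace LieCrossedModule

variable (X : LieCrossedModule EG EH G H)

/-- `S` solves the differential problem for the unknown `E = E_{|x₀,y₀}`
`∂_x (∂_y E E⁻¹) = - ṁ(v_{|x₀,y₀}(y)⁻¹ u_{|y,x₀}(x)⁻¹)(B_{xy}(x, y))`, `E(x₀, y) = E(x, y₀) = 1`,
where `K` is `∂_y E E⁻¹`.  Here `u y x` and `v y` stand for `u_{|y,x₀}(x)` and `v_{|x₀,y₀}(y)`,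
and `b` for `B_{xy}`. -/
def IsSurfaceSolution (u : ℝ → ℝ → G) (v : ℝ → G) (b : ℝ → ℝ → EH) (x₀ y₀ : ℝ)
    (S : ℝ → ℝ → H) : Prop :=
  (∀ y, S x₀ y = 1) ∧ (∀ x, S x y₀ = 1) ∧
  ∃ K : ℝ → ℝ → EH, (∀ x y, HasRightLogDerivAt (fun r => S x r) (K x y) y) ∧
    ∀ x y, HasDerivAt (fun r => K r y) (-(X.mDot ((v y)⁻¹ * (u y x)⁻¹) (b x y))) x

/-- The `(G, H)`-cocycle associated with a `(G, H)`-connection doublet `(a, B)` on the plane: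
`f(x, x₀; y) = u_{|y,x₀}(x)`, `g(x; y, y₀) = v_{|x,y₀}(y)`, `W(x, x₀; y, y₀) = E_{|x₀,y₀}(x, y)`, where
`u`, `v`, `E` are the solutions of `∂_x u u⁻¹ = - a_x`, `∂_y v v⁻¹ = - a_y` and of the differential
problem above, equal to the identity at `x = x₀`, at `y = y₀` and at both, respectively.
(For a connection doublet the solutions exist and are unique already in the stated sense, and they are
smooth.) -/
def cocycle (a : DForm (ℝ × ℝ) (ℝ × ℝ) EG 1) (B : DForm (ℝ × ℝ) (ℝ × ℝ) EH 2) :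
    CocycleData G H where
  f x x₀ y := rightSolution (fun r => -compX a r y) x₀ x
  g x y y₀ := rightSolution (fun r => -compY a x r) y₀ y
  W x x₀ y y₀ := Classical.epsilon
    (X.IsSurfaceSolution (fun s r => rightSolution (fun r' => -compX a r' s) x₀ r)
      (rightSolution (fun r => -compY a x₀ r) y₀) (compXY B) x₀ y₀) x y

/-- The integral 1-gauge transformation associated with a differential 1-gauge transformation
`(ϰ, Γ)` on the plane, relative to the cocycle of the doublet `(a, B)`:
`κ = ϰ`, `Ψ(x, x₀; y) = Λ_{|y,x₀}(x)`, `Φ(x; y, y₀) = Ξ_{|x,y₀}(y)`, with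
`Λ⁻¹ ∂_x Λ = - ṁ(f(x, x₀; y)⁻¹ ϰ(x, y)⁻¹)(Γ_x(x, y))`, `Λ(x₀) = 1`,
`Ξ⁻¹ ∂_y Ξ = - ṁ(g(x; y, y₀)⁻¹ ϰ(x, y)⁻¹)(Γ_y(x, y))`, `Ξ(y₀) = 1`. -/
def integralGauge (ϰ : ℝ × ℝ → G) (Γ : DForm (ℝ × ℝ) (ℝ × ℝ) EH 1)
    (a : DForm (ℝ × ℝ) (ℝ × ℝ) EG 1) (B : DForm (ℝ × ℝ) (ℝ × ℝ) EH 2) :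
    IntegralGaugeData G H where
  κ x y := ϰ (x, y)
  Ψ x x₀ y := leftSolution
    (fun r => -(X.mDot (((X.cocycle a B).f r x₀ y)⁻¹ * (ϰ (r, y))⁻¹) (compX Γ r y))) x₀ x
  Φ x y y₀ := leftSolution
    (fun r => -(X.mDot (((X.cocycle a B).g x r y₀)⁻¹ * (ϰ (x, r))⁻¹) (compY Γ x r))) y₀ y

end LieCrossedModule

/-! ### Curves, surfaces and parallel transport -/

/-- A curve `γ : p₀ → p₁` with sitting instants. -/
structure Curve (E : Type*) [NormedAddCommGroup E] [NormedSpace ℝ E]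
    {M : Type*} [TopologicalSpace M] [ChartedSpace E M] (p₀ p₁ : M) where
  toFun : ℝ → M
  smooth : ContMDiff 𝓘(ℝ, ℝ) 𝓘(ℝ, E) ∞ toFun
  sitting : ∃ ε : ℝ, 0 < ε ∧ ε < 1 / 2 ∧
    (∀ x < ε, toFun x = p₀) ∧ (∀ x > 1 - ε, toFun x = p₁)

/-- A surface `Σ : γ₀ ⇒ γ₁` with sitting instants. -/
structure Surface {p₀ p₁ : M} (γ₀ γ₁ : Curve E p₀ p₁) where
  toFun : ℝ × ℝ → M
  smooth : ContMDiff 𝓘(ℝ, ℝ × ℝ) 𝓘(ℝ, E) ∞ toFun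
  sitting : ∃ ε : ℝ, 0 < ε ∧ ε < 1 / 2 ∧
    (∀ x y, x < ε → toFun (x, y) = p₀) ∧ (∀ x y, x > 1 - ε → toFun (x, y) = p₁) ∧
    (∀ x y, y < ε → toFun (x, y) = γ₀.toFun x) ∧ (∀ x y, y > 1 - ε → toFun (x, y) = γ₁.toFun x)

/-- The unit surface `I_γ : γ ⇒ γ`, `I_γ(x, y) = γ(x)`. -/
def unitSurface {p₀ p₁ : M} (γ : Curve E p₀ p₁) : Surface γ γ where
  toFun q := γ.toFun q.1
  smooth := γ.smooth.comp (contDiff_fst.contMDiff)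
  sitting := by
    obtain ⟨ε, h0, h1, h2, h3⟩ := γ.sitting
    exact ⟨ε, h0, h1, fun x _ hx => h2 x hx, fun x _ hx => h3 x hx, fun _ _ _ => rfl,
      fun _ _ _ => rfl⟩

namespace LieCrossedModule

variable (X : LieCrossedModule EG EH G H) {p₀ p₁ : M} {γ₀ γ₁ : Curve E p₀ p₁}

/-- The cocycle of the pulled-back doublet `(Σ^*θ, Σ^*Υ)`. -/
def surfaceCocycle (θ : DForm E M EG 1) (Υ : DForm E M EH 2) (S : Surface γ₀ γ₁) :
    CocycleData G H :=
  X.cocycle (pullback S.toFun θ) (pullback S.toFun Υ)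

/-- The 1-parallel transport `F_{θ,Υ}(γ) = f_{I_γ^*θ, I_γ^*Υ | y}(1, 0)`.  The right-hand side does not
depend on `y`; we take `y = 0`. -/
def transportCurve (θ : DForm E M EG 1) (Υ : DForm E M EH 2) (γ : Curve E p₀ p₁) : G :=
  (X.surfaceCocycle θ Υ (unitSurface γ)).f 1 0 0

/-- The 2-parallel transport `F_{θ,Υ}(Σ) = W_{Σ^*θ, Σ^*Υ}(0, 1; 1, 0)`. -/
def transportSurface (θ : DForm E M EG 1) (Υ : DForm E M EH 2) (S : Surface γ₀ γ₁) : H :=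
  (X.surfaceCocycle θ Υ S).W 0 1 1 0

/-- `Ψ_{Σ^*g, Σ^*J; Σ^*θ, Σ^*Υ | y}(0, 1)`.  For `y = 0` and `y = 1` these are the elements
`G_{g,J;θ,Υ}(γ₀)` and `G_{g,J;θ,Υ}(γ₁)` of `H`. -/
def gaugeHolonomy (g : M → G) (J : DForm E M EH 1) (θ : DForm E M EG 1) (Υ : DForm E M EH 2)
    (S : Surface γ₀ γ₁) (y : ℝ) : H :=
  (X.integralGauge (g ∘ S.toFun) (pullback S.toFun J)
    (pullback S.toFun θ) (pullback S.toFun Υ)).Ψ 0 1 y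

end LieCrossedModule

end HigherGauge

end

/-! Pull everything back to the plane and base the transports at the point `(1, 0)`. Let `u(x, y)`
solve `∂ₓu u⁻¹ = -aₓ` with `u(1, y) = 1`, let `κ = g ∘ Σ`, let `Λ` be the solution defining the
gauge holonomy, and put `μ = Λ⁻¹`. By the product rule, `u' = κ u t(μ) κ(1, 0)⁻¹` solves the same
problem for the transformed form: the `t(μ)` factor produces exactly the term `ṫ(Γₓ)`. Uniqueness
and an inversion at `x = 0` give both curve formulas.

For the surface, the edge `x = 1` is mapped to a point, so `a_y` vanishes there and the vertical
solution `v` is `1`. The surface problem thus splits into two steps: integrate `-ṁ(u⁻¹)(b)` in `x`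
from `1` to get the density `K = ∂_yE E⁻¹`, then solve an ordinary problem in `y`. The transformed
density is guessed to be `K' = ṁ(κ(1, 0))(∂_yΛ Λ⁻¹ + Ad Λ (K)) + ṁ(u'⁻¹)(Γ_y)`. It vanishes at `x =
1` and its `x`-derivative is `-ṁ(u'⁻¹)(b')` (`PlaneGauge.hasDerivAt_K'`), so it is the right
density. At `x = 0` the `Γ_y` term drops out, and `K'` is the logarithmic derivative of `m(κ(1,
0))(Λ(0, y) E(0, y) Λ(0, 0)⁻¹)`; uniqueness in `y` finishes (`PlaneGauge.rightSolution_K'`).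

Computing `∂ₓK'` requires `∂_y` of `u` and of `Λ`. Differentiating a solution in a parameter gives
an integral formula (`hasLeftLogDerivAt_solution`); for `u`, fake flatness turns that integral into
`-ṫ(K) - Ad u⁻¹ (a_y)` (`PlaneGauge.hasLeftLogDerivAt_u_y`). The algebraic input is that `m̂ ∘ ṫ` is
the bracket of `𝔥`, which follows from the Peiffer identity once the bracket of left-invariant
fields is known to be the differential of `Ad` (`lieBracketCLM_eq_mHat`). -/

namespace HigherGauge

/-! ### Velocities and logarithmic derivatives of curves -/

section LogDeriv

variable {EG : Type*} [NormedAddCommGroup EG] [NormedSpace ℝ EG]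
  {G : Type*} [TopologicalSpace G] [ChartedSpace EG G]
  {EH : Type*} [NormedAddCommGroup EH] [NormedSpace ℝ EH]
  {H : Type*} [TopologicalSpace H] [ChartedSpace EH H]
  {EK : Type*} [NormedAddCommGroup EK] [NormedSpace ℝ EK]
  {K : Type*} [TopologicalSpace K] [ChartedSpace EK K]

/-- The curve `u` in a manifold has velocity `X` at time `s`. -/
def HasVelocityAt (u : ℝ → G) (X : EG) (s : ℝ) : Prop :=
  HasMFDerivAt 𝓘(ℝ, ℝ) 𝓘(ℝ, EG) u s (ContinuousLinearMap.toSpanSingleton ℝ X : ℝ →L[ℝ] EG)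

theorem HasVelocityAt.continuousAt {u : ℝ → G} {X : EG} {s : ℝ} (h : HasVelocityAt u X s) :
    ContinuousAt u s :=
  HasMFDerivAt.continuousAt h

theorem HasVelocityAt.congr_of_eventuallyEq {u v : ℝ → G} {X : EG} {s : ℝ}
    (h : HasVelocityAt u X s) (huv : v =ᶠ[𝓝 s] u) : HasVelocityAt v X s :=
  HasMFDerivAt.congr_of_eventuallyEq h huv

theorem HasVelocityAt.unique {u : ℝ → G} {X Y : EG} {s : ℝ}
    (h : HasVelocityAt u X s) (h' : HasVelocityAt u Y s) : X = Y := by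
  have := hasMFDerivAt_unique h h'
  have := DFunLike.congr_fun (show (ContinuousLinearMap.toSpanSingleton ℝ X : ℝ →L[ℝ] EG)
    = ContinuousLinearMap.toSpanSingleton ℝ Y from this) 1
  simpa using this

theorem hasVelocityAt_const (a : G) (s : ℝ) : HasVelocityAt (fun _ => a) (0 : EG) s :=
  HasMFDerivAt.congr_mfderiv (hasMFDerivAt_const (I := 𝓘(ℝ, ℝ)) (I' := 𝓘(ℝ, EG)) a s)
    (show (0 : ℝ →L[ℝ] EG) = _ by ext; simp)

/-- The differential of a map of manifolds at a point, as a map of the model spaces. -/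
noncomputable def tangentDeriv (F : G → K) (a : G) : EG →L[ℝ] EK :=
  mfderiv 𝓘(ℝ, EG) 𝓘(ℝ, EK) F a

/-- The base point is a separate variable because the lemma is mostly applied to curves such as `u r
* (u s)⁻¹`, whose value at `s` is `1` only after simplification. -/
theorem HasVelocityAt.comp {u : ℝ → G} {X : EG} {s : ℝ} (h : HasVelocityAt u X s) {a : G}
    (hs : u s = a) {F : G → K} (hF : MDifferentiableAt 𝓘(ℝ, EG) 𝓘(ℝ, EK) F a) :
    HasVelocityAt (fun r => F (u r)) (tangentDeriv F a X : EK) s := by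
  subst hs
  have key : (tangentDeriv F (u s)).comp (ContinuousLinearMap.toSpanSingleton ℝ X : ℝ →L[ℝ] EG)
      = (ContinuousLinearMap.toSpanSingleton ℝ (tangentDeriv F (u s) X) : ℝ →L[ℝ] EK) := by
    ext; simp
  exact HasMFDerivAt.congr_mfderiv (HasMFDerivAt.comp s hF.hasMFDerivAt h) key

theorem HasVelocityAt.comp₂ {u : ℝ → G} {X : EG} {v : ℝ → H} {Y : EH} {s : ℝ}
    (hu : HasVelocityAt u X s) (hv : HasVelocityAt v Y s) {a : G} {b : H}
    (hus : u s = a) (hvs : v s = b) {F : G → H → K}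
    (hF : MDifferentiableAt (𝓘(ℝ, EG).prod 𝓘(ℝ, EH)) 𝓘(ℝ, EK) (fun p : G × H => F p.1 p.2) (a, b)) :
    HasVelocityAt (fun r => F (u r) (v r))
      ((tangentDeriv (fun x => F x b) a X : EK) + (tangentDeriv (fun y => F a y) b Y : EK)) s := by
  subst hus hvs
  let D : EG × EH →L[ℝ] EK :=
    mfderiv (𝓘(ℝ, EG).prod 𝓘(ℝ, EH)) 𝓘(ℝ, EK) (fun p : G × H => F p.1 p.2) (u s, v s)
  have hD : D (X, Y) = tangentDeriv (fun x => F x (v s)) (u s) X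
      + tangentDeriv (fun y => F (u s) y) (v s) Y :=
    mfderiv_prod_eq_add_apply hF (v := ((X, Y) : EG × EH))
  have key : D.comp ((ContinuousLinearMap.toSpanSingleton ℝ X : ℝ →L[ℝ] EG).prod
        (ContinuousLinearMap.toSpanSingleton ℝ Y : ℝ →L[ℝ] EH))
      = (ContinuousLinearMap.toSpanSingleton ℝ (tangentDeriv (fun x => F x (v s)) (u s) X
      + tangentDeriv (fun y => F (u s) y) (v s) Y) : ℝ →L[ℝ] EK) := by
    ext; simp [hD]
  exact HasMFDerivAt.congr_mfderiv
    (HasMFDerivAt.comp s hF.hasMFDerivAt (HasMFDerivAt.prodMk hu hv)) key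

theorem tangentDeriv_id (a : G) : (tangentDeriv (fun x : G => x) a : EG →L[ℝ] EG) = ContinuousLinearMap.id ℝ EG :=
  mfderiv_id (I := 𝓘(ℝ, EG)) (x := a)

theorem tangentDeriv_comp {F : G → K} {f : H → G} {a : H}
    (hF : MDifferentiableAt 𝓘(ℝ, EG) 𝓘(ℝ, EK) F (f a))
    (hf : MDifferentiableAt 𝓘(ℝ, EH) 𝓘(ℝ, EG) f a) :
    (tangentDeriv (fun x => F (f x)) a : EH →L[ℝ] EK)
      = (tangentDeriv F (f a) : EG →L[ℝ] EK).comp (tangentDeriv f a : EH →L[ℝ] EG) :=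
  mfderiv_comp a hF hf

theorem hasVelocityAt_iff_hasDerivAt {u : ℝ → EG} {X : EG} {s : ℝ} :
    HasVelocityAt u X s ↔ HasDerivAt u X s :=
  hasMFDerivAt_iff_hasFDerivAt

variable [Group G] [Group H]

theorem mdifferentiable_mul_mul [LieGroup 𝓘(ℝ, EG) ∞ G] (a b : G) :
    MDifferentiable 𝓘(ℝ, EG) 𝓘(ℝ, EG) (fun y : G => a * y * b) :=
  ((contMDiff_const.mul contMDiff_id).mul contMDiff_const : ContMDiff 𝓘(ℝ, EG) 𝓘(ℝ, EG) ∞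
    (fun y : G => a * y * b)).mdifferentiable (by simp)

theorem hasRightLogDerivAt_iff {u : ℝ → G} {X : EG} {s : ℝ} :
    HasRightLogDerivAt u X s ↔ HasVelocityAt (fun r => u r * (u s)⁻¹) X s := Iff.rfl

theorem hasLeftLogDerivAt_iff {u : ℝ → G} {X : EG} {s : ℝ} :
    HasLeftLogDerivAt u X s ↔ HasVelocityAt (fun r => (u s)⁻¹ * u r) X s := Iff.rfl

theorem HasRightLogDerivAt.congr_of_eventuallyEq {u v : ℝ → G} {X : EG} {s : ℝ}
    (h : HasRightLogDerivAt u X s) (huv : v =ᶠ[𝓝 s] u) : HasRightLogDerivAt v X s := by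
  rw [hasRightLogDerivAt_iff] at h ⊢
  refine h.congr_of_eventuallyEq ?_
  filter_upwards [huv] with r hr
  rw [hr, huv.eq_of_nhds]

theorem HasRightLogDerivAt.unique {u : ℝ → G} {X Y : EG} {s : ℝ}
    (h : HasRightLogDerivAt u X s) (h' : HasRightLogDerivAt u Y s) : X = Y :=
  HasVelocityAt.unique h h'

theorem HasRightLogDerivAt.mul_const {u : ℝ → G} {X : EG} {s : ℝ}
    (h : HasRightLogDerivAt u X s) (a : G) : HasRightLogDerivAt (fun r => u r * a) X s := by
  rw [hasRightLogDerivAt_iff] at h ⊢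
  simpa [mul_assoc] using h

theorem hasRightLogDerivAt_const (a : G) (s : ℝ) :
    HasRightLogDerivAt (fun _ => a) (0 : EG) s :=
  hasVelocityAt_const _ s

theorem tangentDeriv_mul_inv_conj [LieGroup 𝓘(ℝ, EG) ∞ G] (a : G) :
    (tangentDeriv (fun x : G => a * x * a⁻¹) 1 : EG →L[ℝ] EG) = Ad a := rfl

theorem mdifferentiable_mul [LieGroup 𝓘(ℝ, EG) ∞ G] :
    MDifferentiable (𝓘(ℝ, EG).prod 𝓘(ℝ, EG)) 𝓘(ℝ, EG) (fun p : G × G => p.1 * p.2) :=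
  (contMDiff_mul 𝓘(ℝ, EG) ∞).mdifferentiable (by simp)

theorem mdifferentiable_inv [LieGroup 𝓘(ℝ, EG) ∞ G] :
    MDifferentiable 𝓘(ℝ, EG) 𝓘(ℝ, EG) (fun p : G => p⁻¹) :=
  (contMDiff_inv 𝓘(ℝ, EG) ∞).mdifferentiable (by simp)

theorem HasVelocityAt.mul [LieGroup 𝓘(ℝ, EG) ∞ G] {u v : ℝ → G} {X Y : EG} {s : ℝ}
    (hu : HasVelocityAt u X s) (hv : HasVelocityAt v Y s) (hus : u s = 1) (hvs : v s = 1) :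
    HasVelocityAt (fun r => u r * v r) (X + Y) s := by
  have h := hu.comp₂ hv hus hvs (F := fun x y => x * y) (mdifferentiable_mul _)
  simpa [tangentDeriv_id] using h

theorem HasVelocityAt.inv [LieGroup 𝓘(ℝ, EG) ∞ G] {u : ℝ → G} {X : EG} {s : ℝ}
    (hu : HasVelocityAt u X s) (hus : u s = 1) :
    HasVelocityAt (fun r => (u r)⁻¹) (-X) s := by
  have h := hu.comp hus (F := fun x => x⁻¹) (mdifferentiable_inv _)
  -- The velocity of the inverse need not be computed: it is forced by `u u⁻¹ = 1` and additivity of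
  -- velocities at the identity.
  have h' := hu.mul h hus (by simp [hus])
  simp only [mul_inv_cancel] at h'
  rwa [← eq_neg_of_add_eq_zero_right (h'.unique (hasVelocityAt_const 1 s))]

/-- Write `u_r v_r (u_s v_s)⁻¹` as `(u_r u_s⁻¹) · u_s (v_r v_s⁻¹) u_s⁻¹`, a product of two curves
through the identity, where velocities add. -/
theorem HasRightLogDerivAt.mul [LieGroup 𝓘(ℝ, EG) ∞ G] {u v : ℝ → G} {X Y : EG} {s : ℝ}
    (hu : HasRightLogDerivAt u X s) (hv : HasRightLogDerivAt v Y s) :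
    HasRightLogDerivAt (fun r => u r * v r) (X + Ad (u s) Y) s := by
  rw [hasRightLogDerivAt_iff] at *
  have h := hu.mul (hv.comp (by simp) (mdifferentiable_mul_mul (u s) (u s)⁻¹ 1)) (by simp) (by simp)
  rw [tangentDeriv_mul_inv_conj] at h
  refine h.congr_of_eventuallyEq (.of_forall fun r => ?_)
  simp [mul_assoc]

theorem hasRightLogDerivAt_inv_iff [LieGroup 𝓘(ℝ, EG) ∞ G] {u : ℝ → G} {X : EG} {s : ℝ} :
    HasRightLogDerivAt (fun r => (u r)⁻¹) X s ↔ HasLeftLogDerivAt u (-X) s := by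
  rw [hasRightLogDerivAt_iff, hasLeftLogDerivAt_iff]
  constructor <;> intro h <;> simpa using h.inv (by simp)

theorem HasLeftLogDerivAt.hasRightLogDerivAt [LieGroup 𝓘(ℝ, EG) ∞ G] {u : ℝ → G} {X : EG} {s : ℝ}
    (h : HasLeftLogDerivAt u X s) : HasRightLogDerivAt u (Ad (u s) X) s := by
  rw [hasRightLogDerivAt_iff]
  rw [hasLeftLogDerivAt_iff] at h
  have h := h.comp (by simp) (mdifferentiable_mul_mul (u s) (u s)⁻¹ 1)
  simpa [tangentDeriv_mul_inv_conj] using h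

theorem HasRightLogDerivAt.hasLeftLogDerivAt [LieGroup 𝓘(ℝ, EG) ∞ G] {u : ℝ → G} {X : EG} {s : ℝ}
    (h : HasRightLogDerivAt u X s) : HasLeftLogDerivAt u (Ad (u s)⁻¹ X) s := by
  rw [hasLeftLogDerivAt_iff]
  rw [hasRightLogDerivAt_iff] at h
  have h := h.comp (by simp) (mdifferentiable_mul_mul (u s)⁻¹ (u s) 1)
  have e := tangentDeriv_mul_inv_conj (u s)⁻¹ (EG := EG)
  rw [inv_inv] at e
  rw [e] at h
  simpa [mul_assoc] using h

theorem HasRightLogDerivAt.inv [LieGroup 𝓘(ℝ, EG) ∞ G] {u : ℝ → G} {X : EG} {s : ℝ}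
    (h : HasRightLogDerivAt u X s) :
    HasRightLogDerivAt (fun r => (u r)⁻¹) (-(Ad (u s)⁻¹ X)) s := by
  rw [hasRightLogDerivAt_inv_iff, neg_neg]
  exact h.hasLeftLogDerivAt

theorem HasRightLogDerivAt.continuousAt [LieGroup 𝓘(ℝ, EG) ∞ G] {u : ℝ → G} {X : EG} {s : ℝ}
    (h : HasRightLogDerivAt u X s) : ContinuousAt u s := by
  have := topologicalGroup_of_lieGroup 𝓘(ℝ, EG) ∞ (G := G)
  have h1 := HasVelocityAt.continuousAt h
  simpa [Pi.mul_def] using h1.mul (continuousAt_const (y := u s) (x := s))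

theorem HasRightLogDerivAt.map [LieGroup 𝓘(ℝ, EG) ∞ G] {u : ℝ → G} {X : EG} {s : ℝ}
    (h : HasRightLogDerivAt u X s) (f : G →* H) (hf : MDifferentiableAt 𝓘(ℝ, EG) 𝓘(ℝ, EH) f 1) :
    HasRightLogDerivAt (fun r => f (u r)) (tangentDeriv f 1 X : EH) s := by
  rw [hasRightLogDerivAt_iff] at *
  simpa using h.comp (by simp) hf

end LogDeriv

end HigherGauge

/-! ### Differential calculus of a crossed module -/

namespace HigherGauge

section

variable {EG : Type*} [NormedAddCommGroup EG] [NormedSpace ℝ EG]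
  {G : Type*} [TopologicalSpace G] [ChartedSpace EG G]
  {EH : Type*} [NormedAddCommGroup EH] [NormedSpace ℝ EH]
  {H : Type*} [TopologicalSpace H] [ChartedSpace EH H]
  {EK : Type*} [NormedAddCommGroup EK] [NormedSpace ℝ EK]
  {K : Type*} [TopologicalSpace K] [ChartedSpace EK K]

/-- When the base points do not move, the coordinate changes go from a chart to itself. Smoothness
of a differential in tangent coordinates is then smoothness as a map into a fixed space of linear
maps. -/
theorem inTangentCoordinates_of_eq [IsManifold 𝓘(ℝ, EH) 1 H] [IsManifold 𝓘(ℝ, EK) 1 K] {N : Type*}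
    {p : N → H} {q : N → K} {x₀ x : N} (hp : p x = p x₀) (hq : q x = q x₀) (D : N → EH →L[ℝ] EK) :
    inTangentCoordinates 𝓘(ℝ, EH) 𝓘(ℝ, EK) p q D x₀ x = D x := by
  rw [inTangentCoordinates_eq p q D (by rw [hp]; exact mem_chart_source _ _)
    (by rw [hq]; exact mem_chart_source _ _), hp, hq]
  ext v
  simp only [ContinuousLinearMap.comp_apply]
  rw [(tangentBundleCore 𝓘(ℝ, EH) H).coordChange_self _ _ (mem_chart_source _ _),
    (tangentBundleCore 𝓘(ℝ, EK) K).coordChange_self _ _ (mem_chart_source _ _)]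

theorem inTangentCoordinates_of_eq_right {V : Type*} [NormedAddCommGroup V] [NormedSpace ℝ V]
    [IsManifold 𝓘(ℝ, EK) 1 K] {N : Type*}
    {p : N → V} {q : N → K} {x₀ x : N} (hq : q x = q x₀) (D : N → V →L[ℝ] EK) :
    inTangentCoordinates 𝓘(ℝ, V) 𝓘(ℝ, EK) p q D x₀ x = D x := by
  rw [inTangentCoordinates_eq p q D (by rw [chartAt_self_eq]; trivial)
    (by rw [hq]; exact mem_chart_source _ _), hq]
  ext v
  simp only [ContinuousLinearMap.comp_apply]
  rw [tangentBundleCore_coordChange_model_space,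
    (tangentBundleCore 𝓘(ℝ, EK) K).coordChange_self _ _ (mem_chart_source _ _)]
  rfl

/-- Applied to `m(a)(1) = 1`, this makes `a ↦ ṁ(a)` smooth. -/
theorem contMDiff_tangentDeriv_of_const [IsManifold 𝓘(ℝ, EG) ∞ G] [IsManifold 𝓘(ℝ, EH) ∞ H]
    [IsManifold 𝓘(ℝ, EK) ∞ K]
    {F : G → H → K} (hF : ContMDiff (𝓘(ℝ, EG).prod 𝓘(ℝ, EH)) 𝓘(ℝ, EK) ∞ (fun p : G × H => F p.1 p.2))
    {b : H} {c : K} (hc : ∀ a, F a b = c) :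
    ContMDiff 𝓘(ℝ, EG) 𝓘(ℝ, EH →L[ℝ] EK) ∞ (fun a => (tangentDeriv (F a) b : EH →L[ℝ] EK)) := by
  intro a
  have : IsManifold 𝓘(ℝ, EG) 1 G := .of_le (n := ∞) (by simp)
  have : IsManifold 𝓘(ℝ, EH) 1 H := .of_le (n := ∞) (by simp)
  have : IsManifold 𝓘(ℝ, EK) 1 K := .of_le (n := ∞) (by simp)
  have h : ContMDiffAt 𝓘(ℝ, EG) 𝓘(ℝ, EH →L[ℝ] EK) ∞ (inTangentCoordinates 𝓘(ℝ, EH) 𝓘(ℝ, EK)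
      (fun _ => b) (fun x => F x b) (fun x => (tangentDeriv (F x) b : EH →L[ℝ] EK)) a) a :=
    ContMDiffAt.mfderiv F (fun _ => b) (n := ∞) (hF (a, b)) contMDiffAt_const (by simp)
  refine h.congr_of_eventuallyEq (.of_forall fun x => Eq.symm ?_)
  exact inTangentCoordinates_of_eq (p := fun _ : G => b) (q := fun x => F x b) rfl
    ((hc x).trans (hc a).symm) _

/-- Meant for `F p q = g(q) g(p)⁻¹`, which is `1` on the diagonal and whose differential there is
`dg g⁻¹`. The source point moves, but in a vector space this costs no coordinate change. -/
theorem contMDiff_tangentDeriv_diag {V : Type*} [NormedAddCommGroup V] [NormedSpace ℝ V]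
    [IsManifold 𝓘(ℝ, EK) ∞ K]
    {F : V → V → K} (hF : ContMDiff (𝓘(ℝ, V).prod 𝓘(ℝ, V)) 𝓘(ℝ, EK) ∞ (fun p : V × V => F p.1 p.2))
    {c : K} (hc : ∀ a, F a a = c) :
    ContMDiff 𝓘(ℝ, V) 𝓘(ℝ, V →L[ℝ] EK) ∞ (fun a => (tangentDeriv (F a) a : V →L[ℝ] EK)) := by
  intro a
  have : IsManifold 𝓘(ℝ, EK) 1 K := .of_le (n := ∞) (by simp)
  have h : ContMDiffAt 𝓘(ℝ, V) 𝓘(ℝ, V →L[ℝ] EK) ∞ (inTangentCoordinates 𝓘(ℝ, V) 𝓘(ℝ, EK)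
      (fun x => x) (fun x => F x x) (fun x => (tangentDeriv (F x) x : V →L[ℝ] EK)) a) a :=
    ContMDiffAt.mfderiv F (fun x => x) (n := ∞) (hF (a, a)) contMDiffAt_id (by simp)
  refine h.congr_of_eventuallyEq (.of_forall fun x => Eq.symm ?_)
  exact inTangentCoordinates_of_eq_right (by rw [hc, hc]) _

end

/-- The crossed module of a Lie group acting on itself by conjugation. -/
def conjModule (EG G : Type*) [NormedAddCommGroup EG] [NormedSpace ℝ EG] [TopologicalSpace G]
    [ChartedSpace EG G] [Group G] [LieGroup 𝓘(ℝ, EG) ∞ G] : LieCrossedModule EG EG G G where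
  t := MonoidHom.id G
  m := MulAut.conj
  contMDiff_t := contMDiff_id
  contMDiff_m := (contMDiff_fst.mul contMDiff_snd).mul contMDiff_fst.inv
  t_m _ _ := rfl
  m_t _ _ := rfl

namespace LieCrossedModule

set_option linter.unusedSectionVars false

variable {EG EH G H : Type*}
  [NormedAddCommGroup EG] [NormedSpace ℝ EG] [NormedAddCommGroup EH] [NormedSpace ℝ EH]
  [TopologicalSpace G] [ChartedSpace EG G] [Group G] [LieGroup 𝓘(ℝ, EG) ∞ G]
  [TopologicalSpace H] [ChartedSpace EH H] [Group H] [LieGroup 𝓘(ℝ, EH) ∞ H]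
  (X : LieCrossedModule EG EH G H)

theorem mDot_eq (a : G) : X.mDot a = tangentDeriv (X.m a) 1 := rfl

theorem mHat_eq : X.mHat = tangentDeriv (fun a => X.mDot a) 1 := rfl

theorem tDot_eq : X.tDot = tangentDeriv X.t 1 := rfl

/-- Through this identity every fact about `ṁ` and `m̂` is also a fact about `Ad` and its
differential. -/
theorem conjModule_mDot (a : G) : (conjModule EG G).mDot a = Ad a := rfl

theorem mdifferentiable_m (a : G) : MDifferentiable 𝓘(ℝ, EH) 𝓘(ℝ, EH) (X.m a) :=
  (X.contMDiff_m.comp (contMDiff_const.prodMk contMDiff_id)).mdifferentiable (by simp)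

theorem mdifferentiable_t : MDifferentiable 𝓘(ℝ, EH) 𝓘(ℝ, EG) X.t :=
  X.contMDiff_t.mdifferentiable (by simp)

theorem contMDiff_mDot : ContMDiff 𝓘(ℝ, EG) 𝓘(ℝ, EH →L[ℝ] EH) ∞ X.mDot :=
  contMDiff_tangentDeriv_of_const (F := fun a b => X.m a b) X.contMDiff_m (fun a => map_one (X.m a))

theorem continuous_mDot : Continuous X.mDot := X.contMDiff_mDot.continuous

theorem mDot_mul (a b : G) : X.mDot (a * b) = (X.mDot a).comp (X.mDot b) := by
  have h := tangentDeriv_comp (f := X.m b) (a := 1) (F := X.m a) (X.mdifferentiable_m _ _)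
    (X.mdifferentiable_m _ _)
  rw [map_one] at h
  rw [mDot_eq, mDot_eq, mDot_eq, ← h, map_mul]
  rfl

theorem mDot_one : X.mDot 1 = ContinuousLinearMap.id ℝ EH := by
  rw [mDot_eq, map_one]
  exact tangentDeriv_id 1

theorem mDot_mul_apply (a b : G) (Y : EH) : X.mDot (a * b) Y = X.mDot a (X.mDot b Y) := by
  rw [mDot_mul]; rfl

@[simp] theorem mDot_inv_mDot (a : G) (Y : EH) : X.mDot a⁻¹ (X.mDot a Y) = Y := by
  rw [← mDot_mul_apply, inv_mul_cancel, mDot_one]; rfl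

@[simp] theorem mDot_mDot_inv (a : G) (Y : EH) : X.mDot a (X.mDot a⁻¹ Y) = Y := by
  rw [← mDot_mul_apply, mul_inv_cancel, mDot_one]; rfl

/-- Differentiate `t(m(a)(A)) = a t(A) a⁻¹` in `A` at the identity. -/
theorem tDot_mDot (a : G) (Y : EH) : X.tDot (X.mDot a Y) = Ad a (X.tDot Y) := by
  have h := tangentDeriv_comp (f := X.m a) (a := 1) (F := X.t) (X.mdifferentiable_t _)
    (X.mdifferentiable_m _ _)
  have h' := tangentDeriv_comp (f := X.t) (a := 1) (F := fun b => a * b * a⁻¹)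
    (mdifferentiable_mul_mul _ _ _) (X.mdifferentiable_t _)
  simp only [map_one, X.t_m] at h h'
  rw [h] at h'
  exact DFunLike.congr_fun h' Y

theorem mDot_t (A : H) : X.mDot (X.t A) = Ad A := by
  have : ⇑(X.m (X.t A)) = fun B => A * B * A⁻¹ := funext (X.m_t A)
  rw [mDot_eq, this]; rfl

/-- Since `ṁ` is multiplicative, `ṁ(u_r) = ṁ(u_r u_s⁻¹) ∘ ṁ(u_s)`, and only the first factor, a
curve through the identity, varies. The inverse below is handled in the same way with the fixed
factor on the left. -/
theorem hasDerivAt_mDot {u : ℝ → G} {Z : EG} {s : ℝ} (h : HasRightLogDerivAt u Z s) :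
    HasDerivAt (fun r => X.mDot (u r)) ((X.mHat Z).comp (X.mDot (u s))) s := by
  rw [hasRightLogDerivAt_iff] at h
  have h1 := h.comp (by simp) (X.contMDiff_mDot.mdifferentiable (by simp) 1)
  rw [hasVelocityAt_iff_hasDerivAt] at h1
  have h2 := h1.clm_comp (hasDerivAt_const s (X.mDot (u s)))
  simp only [← X.mDot_mul, inv_mul_cancel_right] at h2
  simpa [mHat_eq] using h2

theorem hasDerivAt_mDot_inv {u : ℝ → G} {Z : EG} {s : ℝ} (h : HasRightLogDerivAt u Z s) :
    HasDerivAt (fun r => X.mDot (u r)⁻¹) (-((X.mDot (u s)⁻¹).comp (X.mHat Z))) s := by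
  have h1 := (hasRightLogDerivAt_iff.1 h).inv (by simp)
  have h1 := h1.comp (by simp) (X.contMDiff_mDot.mdifferentiable (by simp) 1)
  rw [hasVelocityAt_iff_hasDerivAt] at h1
  have h2 := (hasDerivAt_const s (X.mDot (u s)⁻¹)).clm_comp h1
  simp only [← X.mDot_mul, mul_inv_rev, inv_inv, inv_mul_cancel_left] at h2
  simpa [mHat_eq] using h2

/-- The infinitesimal Peiffer identity: differentiate `ṁ(t(A)) = Ad A` at the identity. -/
theorem mHat_tDot (A : EH) : X.mHat (X.tDot A) = (conjModule EH H).mHat A := by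
  have h := tangentDeriv_comp (f := X.t) (a := 1) (F := X.mDot)
    (X.contMDiff_mDot.mdifferentiable (by simp) _) (X.mdifferentiable_t _)
  simp only [map_one, X.mDot_t] at h
  exact (DFunLike.congr_fun h A).symm

theorem mHat_Ad (a : G) (Z : EG) (Y : EH) : X.mHat (Ad a Z) (X.mDot a Y) = X.mDot a (X.mHat Z Y) := by
  have hm := X.contMDiff_mDot.mdifferentiable (by simp)
  have h := tangentDeriv_comp (f := fun b => a * b * a⁻¹) (a := 1) (F := X.mDot) (hm _)
    (mdifferentiable_mul_mul _ _ _)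
  -- `Φ` is conjugation by `ṁ(a)`. It is linear, hence its own differential, and `ṁ(a b a⁻¹) =
  -- Φ(ṁ(b))` can be differentiated in `b` at the identity.
  let Φ : (EH →L[ℝ] EH) →L[ℝ] (EH →L[ℝ] EH) :=
    ((ContinuousLinearMap.compL ℝ EH EH EH) (X.mDot a)).comp
    (((ContinuousLinearMap.compL ℝ EH EH EH).flip) (X.mDot a⁻¹))
  have h' := tangentDeriv_comp (f := X.mDot) (a := 1) (F := Φ) Φ.mdifferentiableAt (hm _)
  have e : (fun x => X.mDot (a * x * a⁻¹)) = fun x => Φ (X.mDot x) := by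
    ext x v
    simp [Φ, X.mDot_mul]
  have e' : (tangentDeriv Φ (X.mDot 1) : (EH →L[ℝ] EH) →L[ℝ] (EH →L[ℝ] EH)) = Φ := by
    unfold tangentDeriv
    rw [mfderiv_eq_fderiv]; exact Φ.fderiv
  rw [e, h', e'] at h
  simp only [mul_one, mul_inv_cancel] at h
  have := DFunLike.congr_fun (DFunLike.congr_fun h Z) (X.mDot a Y)
  change (Φ (X.mHat Z)) _ = X.mHat (Ad a Z) _ at this
  rw [← this]
  simp [Φ]

end LieCrossedModule

end HigherGauge

/-! ### The group law in the chart at the identity -/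

namespace HigherGauge

set_option linter.unusedSectionVars false

section

variable {EG : Type*} [NormedAddCommGroup EG] [NormedSpace ℝ EG]
  {G : Type*} [TopologicalSpace G] [ChartedSpace EG G]

/-- The tangent space at `a` is identified with the model space through the chart at `a` itself, so
no transition map appears. -/
theorem hasVelocityAt_iff_chart {u : ℝ → G} {X : EG} {s : ℝ} {a : G} (ha : u s = a) :
    HasVelocityAt u X s ↔ ContinuousAt u s ∧ HasDerivAt (fun r => chartAt EG a (u r)) X s := by
  subst ha
  rw [hasDerivAt_iff_hasFDerivAt]
  unfold HasVelocityAt HasMFDerivAt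
  simp only [writtenInExtChartAt, extChartAt, Function.comp_def, mfld_simps]
  exact and_congr_right fun _ => hasFDerivWithinAt_univ

variable [Group G] [LieGroup 𝓘(ℝ, EG) ∞ G]

variable (EG G) in
/-- The multiplication of a Lie group, read in the chart at the identity. -/
noncomputable def chartMul (p : EG × EG) : EG :=
  chartAt EG (1 : G) ((chartAt EG (1 : G)).symm p.1 * (chartAt EG (1 : G)).symm p.2)

variable (EG G) in
/-- The coordinate of the identity of a Lie group, in the chart at the identity. -/
noncomputable def chartOne : EG := chartAt EG (1 : G) 1

theorem chartOne_mem_target : chartOne EG G ∈ (chartAt EG (1 : G)).target :=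
  mem_chart_target EG (1 : G)

theorem chart_symm_chartOne : (chartAt EG (1 : G)).symm (chartOne EG G) = 1 :=
  (chartAt EG (1 : G)).left_inv (mem_chart_source EG (1 : G))

theorem chart_target_mem_nhds : (chartAt EG (1 : G)).target ∈ 𝓝 (chartOne EG G) :=
  _root_.chart_target_mem_nhds EG (1 : G)

theorem contDiffAt_chartMul_of_mem {p : EG × EG} (h1 : p.1 ∈ (chartAt EG (1 : G)).target)
    (h2 : p.2 ∈ (chartAt EG (1 : G)).target)
    (h : (chartAt EG (1 : G)).symm p.1 * (chartAt EG (1 : G)).symm p.2 ∈ (chartAt EG (1 : G)).source) :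
    ContDiffAt ℝ ∞ (chartMul EG G) p := by
  rw [← contMDiffAt_iff_contDiffAt]
  have hs : ∀ z ∈ (chartAt EG (1 : G)).target,
      ContMDiffAt 𝓘(ℝ, EG) 𝓘(ℝ, EG) ∞ (chartAt EG (1 : G)).symm z := fun z hz =>
    (contMDiffOn_chart_symm z hz).contMDiffAt ((chartAt EG (1 : G)).open_target.mem_nhds hz)
  have hc : ContMDiffAt 𝓘(ℝ, EG) 𝓘(ℝ, EG) ∞ (chartAt EG (1 : G))
      ((chartAt EG (1 : G)).symm p.1 * (chartAt EG (1 : G)).symm p.2) :=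
    (contMDiffOn_chart _ h).contMDiffAt ((chartAt EG (1 : G)).open_source.mem_nhds h)
  have hf : ContMDiffAt 𝓘(ℝ, EG × EG) 𝓘(ℝ, EG) ∞ (fun q : EG × EG => q.1) p :=
    contDiff_fst.contMDiff _
  have hg : ContMDiffAt 𝓘(ℝ, EG × EG) 𝓘(ℝ, EG) ∞ (fun q : EG × EG => q.2) p :=
    contDiff_snd.contMDiff _
  exact hc.comp p (((hs _ h1).comp p hf).mul ((hs _ h2).comp p hg))

theorem contDiffAt_chartMul : ContDiffAt ℝ ∞ (chartMul EG G) (chartOne EG G, chartOne EG G) := by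
  refine contDiffAt_chartMul_of_mem chartOne_mem_target chartOne_mem_target ?_
  simp [chart_symm_chartOne]

theorem chartMul_chartOne_right {z : EG} (hz : z ∈ (chartAt EG (1 : G)).target) :
    chartMul EG G (z, chartOne EG G) = z := by
  simp [chartMul, chart_symm_chartOne, (chartAt EG (1 : G)).right_inv hz]

theorem fderiv_chartMul_inl (X : EG) :
    fderiv ℝ (chartMul EG G) (chartOne EG G, chartOne EG G) (X, 0) = X := by
  have h := (contDiffAt_chartMul (G := G) (EG := EG)).differentiableAt (by simp)
  have h1 : HasFDerivAt (fun z => chartMul EG G (z, chartOne EG G))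
    ((fderiv ℝ (chartMul EG G) (chartOne EG G, chartOne EG G)).comp (ContinuousLinearMap.inl ℝ EG EG)) (chartOne EG G) := by
    refine h.hasFDerivAt.comp (chartOne EG G) (f := fun z => (z, chartOne EG G)) ?_
    exact (hasFDerivAt_id _).prodMk (hasFDerivAt_const _ _)
  have h2 : HasFDerivAt (fun z => chartMul EG G (z, chartOne EG G))
      (ContinuousLinearMap.id ℝ EG) (chartOne EG G) := by
    refine (hasFDerivAt_id _).congr_of_eventuallyEq ?_
    filter_upwards [chart_target_mem_nhds (G := G)] with z hz using chartMul_chartOne_right hz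
  simpa using DFunLike.congr_fun (h1.unique h2) X

theorem chartMul_chart {a b : G} (ha : a ∈ (chartAt EG (1 : G)).source)
    (hb : b ∈ (chartAt EG (1 : G)).source) :
    chartMul EG G (chartAt EG (1 : G) a, chartAt EG (1 : G) b) = chartAt EG (1 : G) (a * b) := by
  simp [chartMul, (chartAt EG (1 : G)).left_inv ha, (chartAt EG (1 : G)).left_inv hb]

theorem exists_hasVelocityAt_one (X : EG) : ∃ c : ℝ → G, c 0 = 1 ∧ HasVelocityAt c X 0 := by
  have hd : HasDerivAt (fun r : ℝ => chartOne EG G + r • X) X 0 := by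
    simpa using ((hasDerivAt_id (0 : ℝ)).smul_const X).const_add (chartOne EG G)
  have h0 : (chartAt EG (1 : G)).symm (chartOne EG G + (0 : ℝ) • X) = 1 := by
    simp [chart_symm_chartOne]
  refine ⟨fun r => (chartAt EG (1 : G)).symm (chartOne EG G + r • X), h0,
    (hasVelocityAt_iff_chart h0).2 ⟨?_, hd.congr_of_eventuallyEq ?_⟩⟩
  · refine ContinuousAt.comp (g := (chartAt EG (1 : G)).symm) ?_ hd.continuousAt
    exact (chartAt EG (1 : G)).continuousAt_symm (by simpa using chartOne_mem_target)
  · have := hd.continuousAt.preimage_mem_nhds (by simpa using chart_target_mem_nhds (G := G))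
    filter_upwards [this] with r hr using (chartAt EG (1 : G)).right_inv hr

/-- A curve near the identity satisfies, in the chart at the identity, the differential equation
defined by its right logarithmic derivative. -/
theorem HasRightLogDerivAt.hasDerivAt_chart {u : ℝ → G} {X : EG} {s : ℝ}
    (h : HasRightLogDerivAt u X s) (hs : u s ∈ (chartAt EG (1 : G)).source) :
    HasDerivAt (fun r => chartAt EG (1 : G) (u r))
      (fderiv ℝ (chartMul EG G) (chartOne EG G, chartAt EG (1 : G) (u s)) (X, 0)) s := by
  obtain ⟨hc, hd⟩ := (hasVelocityAt_iff_chart (a := 1) (by simp)).1 (hasRightLogDerivAt_iff.1 h)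
  have hμ : DifferentiableAt ℝ (chartMul EG G) (chartOne EG G, chartAt EG (1 : G) (u s)) := by
    refine (contDiffAt_chartMul_of_mem chartOne_mem_target ((chartAt EG (1 : G)).map_source hs) ?_).differentiableAt (by simp)
    simpa [chart_symm_chartOne, (chartAt EG (1 : G)).left_inv hs] using hs
  have h1 := (show HasFDerivAt (chartMul EG G) _
    (chartAt EG (1 : G) (u s * (u s)⁻¹), chartAt EG (1 : G) (u s)) by
      rw [mul_inv_cancel]; exact hμ.hasFDerivAt).comp_hasDerivAt s (hd.prodMk (hasDerivAt_const s (chartAt EG (1 : G) (u s))))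
  refine h1.congr_of_eventuallyEq ?_
  have : (chartAt EG (1 : G)).source ∈ 𝓝 (u s * (u s)⁻¹) := by
    simpa using chart_source_mem_nhds EG (1 : G)
  filter_upwards [hc.preimage_mem_nhds this] with r hr
  simp [chartMul_chart hr hs]

/-- The converse of `HasRightLogDerivAt.hasDerivAt_chart`. -/
theorem hasRightLogDerivAt_of_hasDerivAt {ζ : ℝ → EG} {X : EG} {s : ℝ}
    (hs : ζ s ∈ (chartAt EG (1 : G)).target)
    (h : HasDerivAt ζ (fderiv ℝ (chartMul EG G) (chartOne EG G, ζ s) (X, 0)) s) :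
    HasRightLogDerivAt (fun r => (chartAt EG (1 : G)).symm (ζ r)) X s := by
  have hc : MDifferentiableAt 𝓘(ℝ, EG) 𝓘(ℝ, EG) (chartAt EG (1 : G)).symm (ζ s) :=
    ((contMDiffOn_chart_symm (n := ∞) _ hs).contMDiffAt
      ((chartAt EG (1 : G)).open_target.mem_nhds hs)).mdifferentiableAt (by simp)
  set a := (chartAt EG (1 : G)).symm (ζ s) with ha
  let F : EG → G := fun z => (chartAt EG (1 : G)).symm z * a⁻¹
  have hF : MDifferentiableAt 𝓘(ℝ, EG) 𝓘(ℝ, EG) F (ζ s) := by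
    have := (mdifferentiable_mul_mul (EG := EG) 1 a⁻¹ ((chartAt EG (1 : G)).symm (ζ s))).comp (ζ s) hc
    simpa [Function.comp_def] using this
  rw [hasRightLogDerivAt_iff]
  have h1 := HasVelocityAt.comp (hasVelocityAt_iff_hasDerivAt.2 h) rfl hF
  have key : (tangentDeriv F (ζ s) : EG →L[ℝ] EG)
      (fderiv ℝ (chartMul EG G) (chartOne EG G, ζ s) (X, 0)) = X := by
    -- The differential of `F` is tested on the curve `c r * a`: in the chart its velocity is the
    -- given vector, by the direct statement already proved, while `F` maps it back to `c`, whose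
    -- velocity is `X`.
    obtain ⟨c, hc0, hc1⟩ := exists_hasVelocityAt_one (G := G) X
    have e : chartAt EG (1 : G) (1 * a) = ζ s := by
      rw [one_mul, ha, (chartAt EG (1 : G)).right_inv hs]
    have hsrc : 1 * a ∈ (chartAt EG (1 : G)).source := by
      rw [one_mul]; exact (chartAt EG (1 : G)).map_target hs
    have h2 : HasRightLogDerivAt (fun r => c r * a) X 0 := by
      rw [hasRightLogDerivAt_iff]
      simpa [hc0] using hc1
    have h3 := h2.hasDerivAt_chart (by simpa only [hc0] using hsrc)
    simp only [hc0, e] at h3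
    refine ((hasVelocityAt_iff_hasDerivAt.2 h3).comp (by simp only [hc0, e]) hF).unique
      (hc1.congr_of_eventuallyEq ?_)
    have : (chartAt EG (1 : G)).source ∈ 𝓝 (c 0 * a) := by
      rw [hc0]; exact (chartAt EG (1 : G)).open_source.mem_nhds hsrc
    filter_upwards [h2.continuousAt.preimage_mem_nhds this] with r hr
    simp [F, (chartAt EG (1 : G)).left_inv hr]
  rw [key] at h1
  exact h1

end

end HigherGauge

/-! ### The Lie bracket as the differential of `Ad` -/

namespace HigherGauge

set_option linter.unusedSectionVars false

section

variable {EG : Type*} [NormedAddCommGroup EG] [NormedSpace ℝ EG]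
  {G : Type*} [TopologicalSpace G] [ChartedSpace EG G]
  [Group G] [LieGroup 𝓘(ℝ, EG) ∞ G]

theorem HasVelocityAt.hasDerivAt_chart_one {u : ℝ → G} {X : EG} {s : ℝ} (h : HasVelocityAt u X s)
    (hs : u s = 1) : HasDerivAt (fun r => chartAt EG (1 : G) (u r)) X s :=
  ((hasVelocityAt_iff_chart hs).1 h).2

theorem differentiableAt_chartMul_left {x : EG} (hx : x ∈ (chartAt EG (1 : G)).target) :
    DifferentiableAt ℝ (chartMul EG G) (x, chartOne EG G) := by
  refine (contDiffAt_chartMul_of_mem hx chartOne_mem_target ?_).differentiableAt (by simp)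
  simpa [chart_symm_chartOne] using (chartAt EG (1 : G)).map_target hx

/-- The derivative of left translation, in the chart at the identity. -/
theorem hasDerivAt_chart_mul_left {x : EG} (hx : x ∈ (chartAt EG (1 : G)).target) {c : ℝ → G}
    {X : EG} (hc0 : c 0 = 1) (hc : HasVelocityAt c X 0) :
    HasDerivAt (fun r => chartAt EG (1 : G) ((chartAt EG (1 : G)).symm x * c r))
      (fderiv ℝ (chartMul EG G) (x, chartOne EG G) (0, X)) 0 := by
  have h1 := (show HasFDerivAt (chartMul EG G) _ (x, chartAt EG (1 : G) (c 0)) by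
      rw [hc0]; exact (differentiableAt_chartMul_left hx).hasFDerivAt).comp_hasDerivAt (0 : ℝ)
    ((hasDerivAt_const (0 : ℝ) x).prodMk (hc.hasDerivAt_chart_one hc0))
  refine h1.congr_of_eventuallyEq ?_
  filter_upwards [hc.continuousAt.preimage_mem_nhds
    (by rw [hc0]; exact chart_source_mem_nhds EG (1 : G))] with r hr
  simp [chartMul, (chartAt EG (1 : G)).left_inv hr]

/-- The pull-back by the inverse chart is the push-forward by the chart, so the value is the chart
velocity of `a * c r`, with `c` a curve of velocity `X` through the identity. -/
theorem mpullbackWithin_mulInvariantVectorField {x : EG} (hx : x ∈ (chartAt EG (1 : G)).target)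
    (X : EG) :
    (VectorField.mpullbackWithin 𝓘(ℝ, EG) 𝓘(ℝ, EG) (extChartAt 𝓘(ℝ, EG) (1 : G)).symm
      (mulInvariantVectorField (I := 𝓘(ℝ, EG)) (G := G) X) (range 𝓘(ℝ, EG)) x : EG)
      = fderiv ℝ (chartMul EG G) (x, chartOne EG G) (0, X) := by
  have : IsManifold 𝓘(ℝ, EG) 1 G := .of_le (n := ∞) (by simp)
  have hx' : x ∈ (extChartAt 𝓘(ℝ, EG) (1 : G)).target := by simpa using hx
  set a : G := (chartAt EG (1 : G)).symm x with ha
  have hinv := ContinuousLinearMap.inverse_eq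
    (mfderivWithin_extChartAt_symm_comp_mfderiv_extChartAt hx')
    (mfderiv_extChartAt_comp_mfderivWithin_extChartAt_symm hx')
  rw [VectorField.mpullbackWithin_apply, hinv]
  obtain ⟨c, hc0, hc⟩ := exists_hasVelocityAt_one (G := G) X
  have hl : MDifferentiableAt 𝓘(ℝ, EG) 𝓘(ℝ, EG) (fun y : G => a * y) 1 := by
    simpa using mdifferentiable_mul_mul (EG := EG) a 1 1
  have hs : a ∈ (chartAt EG (1 : G)).source := (chartAt EG (1 : G)).map_target hx
  have h1 := (hc.comp hc0 hl).comp (a := a) (by simp [hc0])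
    (mdifferentiableAt_extChartAt (I := 𝓘(ℝ, EG)) hs)
  rw [hasVelocityAt_iff_hasDerivAt] at h1
  exact h1.unique (hasDerivAt_chart_mul_left hx hc0 hc)

/-- The left and right translations in the chart at the identity are intertwined by the adjoint
action. -/
theorem fderiv_chartMul_Ad {x : EG} (hx : x ∈ (chartAt EG (1 : G)).target) (Y : EG) :
    fderiv ℝ (chartMul EG G) (x, chartOne EG G) (0, Y)
      = fderiv ℝ (chartMul EG G) (chartOne EG G, x) (Ad ((chartAt EG (1 : G)).symm x) Y, 0) := by
  set a : G := (chartAt EG (1 : G)).symm x with ha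
  obtain ⟨c, hc0, hc⟩ := exists_hasVelocityAt_one (G := G) Y
  have hs : a ∈ (chartAt EG (1 : G)).source := (chartAt EG (1 : G)).map_target hx
  have hr : HasRightLogDerivAt (fun r => a * c r) (Ad a Y) 0 := by
    have : HasRightLogDerivAt c Y 0 := by
      rw [hasRightLogDerivAt_iff]; simpa [hc0] using hc
    simpa using (hasRightLogDerivAt_const (EG := EG) a 0).mul this
  have h1 := hr.hasDerivAt_chart (by simpa [hc0] using hs)
  have h2 := (hasDerivAt_chart_mul_left hx hc0 hc).unique h1
  simpa [hc0, ha, (chartAt EG (1 : G)).right_inv hx] using h2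

variable [FiniteDimensional ℝ EG]

/-- In the chart the left-invariant field of `X` is `x ↦ D₂μ(x, e) X`, with `μ` the multiplication.
Its derivative at `e` is a mixed second derivative of `μ`, and the formula is the coordinate
expression of the bracket of two such fields. -/
theorem lieBracketCLM_eq_second_deriv (X Y : EG) :
    lieBracketCLM G X Y =
      fderiv ℝ (fderiv ℝ (chartMul EG G)) (chartOne EG G, chartOne EG G) (X, 0) (0, Y)
      - fderiv ℝ (fderiv ℝ (chartMul EG G)) (chartOne EG G, chartOne EG G) (Y, 0) (0, X) := by
  have hd : DifferentiableAt ℝ (fderiv ℝ (chartMul EG G)) (chartOne EG G, chartOne EG G) :=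
    (contDiffAt_chartMul.fderiv_right (m := ∞) (by simp)).differentiableAt (by simp)
  let V : EG → EG → EG := fun X => VectorField.mpullbackWithin 𝓘(ℝ, EG) 𝓘(ℝ, EG)
    (extChartAt 𝓘(ℝ, EG) (1 : G)).symm
      (mulInvariantVectorField (I := 𝓘(ℝ, EG)) (G := G) X) (range 𝓘(ℝ, EG))
  have hV : ∀ X : EG, V X =ᶠ[𝓝 (chartOne EG G)]
      fun x => fderiv ℝ (chartMul EG G) (x, chartOne EG G) (0, X) := fun X => by
    filter_upwards [chart_target_mem_nhds (G := G)] with x hx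
      using mpullbackWithin_mulInvariantVectorField hx X
  have hV1 : ∀ X : EG, V X (chartOne EG G) = X := fun X => by
    rw [(hV X).eq_of_nhds, fderiv_chartMul_Ad chartOne_mem_target, fderiv_chartMul_inl,
      chart_symm_chartOne, ← LieCrossedModule.conjModule_mDot, LieCrossedModule.mDot_one]
    rfl
  have hV2 : ∀ X Z : EG, fderiv ℝ (V X) (chartOne EG G) Z =
      fderiv ℝ (fderiv ℝ (chartMul EG G)) (chartOne EG G, chartOne EG G) (Z, 0) (0, X) :=
    fun X Z => by
    have h1 : HasFDerivAt (fun x => (x, chartOne EG G)) (ContinuousLinearMap.inl ℝ EG EG)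
      (chartOne EG G) := (hasFDerivAt_id _).prodMk (hasFDerivAt_const _ _)
    have h2 := (HasFDerivAt.comp (chartOne EG G) (f := fun x => (x, chartOne EG G)) hd.hasFDerivAt h1).clm_apply
      (hasFDerivAt_const ((0, X) : EG × EG) (chartOne EG G))
    rw [(h2.congr_of_eventuallyEq (hV X)).fderiv]
    simp
  have h0 : lieBracketCLM G X Y = fderiv ℝ (V Y) (chartOne EG G) (V X (chartOne EG G)) -
      fderiv ℝ (V X) (chartOne EG G) (V Y (chartOne EG G)) := by
    have : IsManifold 𝓘(ℝ, EG) 1 G := .of_le (n := ∞) (by simp)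
    have h1 : lieBracketCLM G X Y
        = (tangentDeriv (extChartAt 𝓘(ℝ, EG) (1 : G)) 1 : EG →L[ℝ] EG).inverse
      (VectorField.lieBracketWithin (E := EG) ℝ (V X) (V Y)
        ((extChartAt 𝓘(ℝ, EG) (1 : G)).symm ⁻¹' univ ∩ range 𝓘(ℝ, EG))
        (extChartAt 𝓘(ℝ, EG) (1 : G) 1)) := by
      rw [lieBracketCLM_apply]; rfl
    have h2 : (tangentDeriv (extChartAt 𝓘(ℝ, EG) (1 : G)) 1 : EG →L[ℝ] EG)
        = ContinuousLinearMap.id ℝ EG := mfderiv_extChartAt_self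
    rw [h1, h2, ContinuousLinearMap.inverse_id]
    simp only [preimage_univ, univ_inter, modelWithCornersSelf_coe, range_id,
      VectorField.lieBracketWithin, fderivWithin_univ]
    rfl
  rw [h0, hV1, hV1, hV2, hV2]

/-- The bracket of the Lie algebra of a Lie group is the differential of the adjoint action. -/
theorem lieBracketCLM_eq_mHat : lieBracketCLM G = (conjModule EG G).mHat := by
  ext X Y
  rw [lieBracketCLM_eq_second_deriv]
  have hd : DifferentiableAt ℝ (fderiv ℝ (chartMul EG G)) (chartOne EG G, chartOne EG G) :=
    (contDiffAt_chartMul.fderiv_right (m := ∞) (by simp)).differentiableAt (by simp)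
  have hsymm : IsSymmSndFDerivAt ℝ (chartMul EG G) (chartOne EG G, chartOne EG G) :=
    contDiffAt_chartMul.isSymmSndFDerivAt (by simpa using (ENat.LEInfty.out : (2 : WithTop ℕ∞) ≤ ∞))
  obtain ⟨c, hc0, hc⟩ := exists_hasVelocityAt_one (G := G) X
  have hcd := hc.hasDerivAt_chart_one hc0
  have hr : HasRightLogDerivAt c X 0 := by
    rw [hasRightLogDerivAt_iff]; simpa [hc0] using hc
  have hA := (conjModule EG G).hasDerivAt_mDot hr
  have hAY := hA.clm_apply (hasDerivAt_const (0:ℝ) Y)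
  -- The intertwining relation `fderiv_chartMul_Ad` is differentiated along `c`. Its left side gives
  -- one mixed second derivative; its right side gives the other plus `m̂ X Y`. Symmetry of the
  -- second derivative then puts the difference in the form found for the bracket.
  have hL : HasDerivAt (fun r => fderiv ℝ (chartMul EG G) (chartAt EG (1 : G) (c r), chartOne EG G) (0, Y))
    (fderiv ℝ (fderiv ℝ (chartMul EG G)) (chartOne EG G, chartOne EG G) (X, 0) (0, Y)) 0 := by
    have h1 := hd.hasFDerivAt.comp_hasDerivAt_of_eq (0 : ℝ)
      (hcd.prodMk (hasDerivAt_const (0 : ℝ) (chartOne EG G))) (by simp only [hc0, chartOne])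
    simpa using h1.clm_apply (hasDerivAt_const (0:ℝ) ((0, Y) : EG × EG))
  have hR : HasDerivAt (fun r => fderiv ℝ (chartMul EG G) (chartOne EG G, chartAt EG (1 : G) (c r))
       ((conjModule EG G).mDot (c r) Y, 0))
    (fderiv ℝ (fderiv ℝ (chartMul EG G)) (chartOne EG G, chartOne EG G) (0, X) (Y, 0)
      + (conjModule EG G).mHat X Y) 0 := by
    have h1 := hd.hasFDerivAt.comp_hasDerivAt_of_eq (0 : ℝ)
      ((hasDerivAt_const (0 : ℝ) (chartOne EG G)).prodMk hcd) (by simp only [hc0, chartOne])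
    have h2 := h1.clm_apply (hAY.prodMk (hasDerivAt_const (0:ℝ) (0 : EG)))
    have e : (chartAt EG (1 : G)) 1 = chartOne EG G := rfl
    simpa [hc0, LieCrossedModule.mDot_one, e, fderiv_chartMul_inl] using h2
  have hLR : (fun r => fderiv ℝ (chartMul EG G) (chartAt EG (1 : G) (c r), chartOne EG G) (0, Y))
      =ᶠ[𝓝 0] fun r => fderiv ℝ (chartMul EG G) (chartOne EG G, chartAt EG (1 : G) (c r))
       ((conjModule EG G).mDot (c r) Y, 0) := by
    filter_upwards [hc.continuousAt.preimage_mem_nhds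
      (by rw [hc0]; exact chart_source_mem_nhds EG (1 : G))] with r hr
    rw [fderiv_chartMul_Ad ((chartAt EG (1 : G)).map_source hr), (chartAt EG (1 : G)).left_inv hr]
    rfl
  have := hL.unique (hR.congr_of_eventuallyEq hLR)
  rw [this, hsymm (0, X) (Y, 0)]
  abel

end

end HigherGauge

/-! ### Local existence and uniqueness for `u' u⁻¹ = A` -/

namespace HigherGauge

set_option linter.unusedSectionVars false

section

open scoped NNReal

variable {EG : Type*} [NormedAddCommGroup EG] [NormedSpace ℝ EG]
  {G : Type*} [TopologicalSpace G] [ChartedSpace EG G]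
  [Group G] [LieGroup 𝓘(ℝ, EG) ∞ G]

/-- Picard–Lindelöf, with the information that the solution stays in the ball. -/
theorem _root_.IsPicardLindelof.exists_hasDerivWithinAt_mem_closedBall {E : Type*}
    [NormedAddCommGroup E] [NormedSpace ℝ E] [CompleteSpace E] {f : ℝ → E → E} {tmin tmax : ℝ}
    {t₀ : Icc tmin tmax} {x₀ : E} {a L K : ℝ≥0} (hf : IsPicardLindelof f t₀ x₀ a 0 L K) :
    ∃ α : ℝ → E, α t₀ = x₀ ∧ ∀ t ∈ Icc tmin tmax, α t ∈ Metric.closedBall x₀ a ∧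
      HasDerivWithinAt α (f t (α t)) (Icc tmin tmax) t := by
  have hx : x₀ ∈ Metric.closedBall x₀ ((0 : ℝ≥0) : ℝ) := Metric.mem_closedBall_self le_rfl
  obtain ⟨α, hα⟩ := ODE.FunSpace.exists_isFixedPt_next hf hx
  refine ⟨α.compProj, by rw [ODE.FunSpace.compProj_val, ← hα, ODE.FunSpace.next_apply₀],
    fun t ht => ⟨α.compProj_mem_closedBall hf.mul_max_le, ?_⟩⟩
  apply ODE.hasDerivWithinAt_picard_Icc t₀.2 hf.continuousOn_uncurry
    α.continuous_compProj.continuousOn (fun _ ht' ↦ α.compProj_mem_closedBall hf.mul_max_le)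
    x₀ ht |>.congr_of_mem _ ht
  intro t' ht'
  nth_rw 1 [← hα]
  rw [ODE.FunSpace.compProj_of_mem ht', ODE.FunSpace.next_apply]

variable (EG G) in
/-- The derivative at the identity of right translations, in the chart at the identity. -/
noncomputable def chartRightDeriv (z : EG) : EG →L[ℝ] EG :=
  (fderiv ℝ (chartMul EG G) (chartOne EG G, z)).comp (ContinuousLinearMap.inl ℝ EG EG)

theorem chartRightDeriv_chartOne : chartRightDeriv EG G (chartOne EG G) = ContinuousLinearMap.id ℝ EG := by
  ext X
  simp [chartRightDeriv, fderiv_chartMul_inl]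

theorem contDiffAt_chartRightDeriv : ContDiffAt ℝ 1 (chartRightDeriv EG G) (chartOne EG G) := by
  have h : ContDiffAt ℝ 1 (fderiv ℝ (chartMul EG G)) (chartOne EG G, chartOne EG G) :=
    contDiffAt_chartMul.fderiv_right ((by norm_num : (1 + 1 : WithTop ℕ∞) = 2).trans_le ENat.LEInfty.out)
  have h1 : ContDiffAt ℝ 1 (fun z : EG => (chartOne EG G, z)) (chartOne EG G) :=
    contDiffAt_const.prodMk contDiffAt_id
  exact (h.comp (chartOne EG G) h1).clm_comp contDiffAt_const

/-- In the chart the equation reads `ζ' = R(ζ) A`. The Lipschitz and norm bounds on `R` feed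
Picard–Lindelöf; closeness of `R` to the identity later compares `ζ` with the integral of `A`. -/
theorem chartRightDeriv_estimates [FiniteDimensional ℝ EG] {ε : ℝ} (hε : 0 < ε) (hε1 : ε ≤ 1) :
    ∃ ρ > 0, ∃ K : ℝ≥0, Metric.closedBall (chartOne EG G) ρ ⊆ (chartAt EG (1 : G)).target ∧
      LipschitzOnWith K (chartRightDeriv EG G) (Metric.closedBall (chartOne EG G) ρ) ∧
      ∀ z ∈ Metric.closedBall (chartOne EG G) ρ,
        ‖chartRightDeriv EG G z - ContinuousLinearMap.id ℝ EG‖ ≤ ε ∧ ‖chartRightDeriv EG G z‖ ≤ 2 := by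
  have hR := contDiffAt_chartRightDeriv (EG := EG) (G := G)
  obtain ⟨K, s, hs, hK⟩ := hR.exists_lipschitzOnWith
  have h1 : ∀ᶠ z in 𝓝 (chartOne EG G),
      ‖chartRightDeriv EG G z - ContinuousLinearMap.id ℝ EG‖ < ε := by
    have : Filter.Tendsto (fun z => ‖chartRightDeriv EG G z - ContinuousLinearMap.id ℝ EG‖)
      (𝓝 (chartOne EG G)) (𝓝 ‖chartRightDeriv EG G (chartOne EG G) - ContinuousLinearMap.id ℝ EG‖) :=
      (hR.continuousAt.sub continuousAt_const).norm
    rw [chartRightDeriv_chartOne, sub_self, norm_zero] at this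
    exact this.eventually_lt_const hε
  obtain ⟨ρ, hρ, h⟩ := Metric.nhds_basis_closedBall.mem_iff.1
    (Filter.inter_mem (chart_target_mem_nhds (G := G)) (Filter.inter_mem hs h1))
  refine ⟨ρ, hρ, K, fun z hz => (h hz).1, hK.mono fun z hz => (h hz).2.1, fun z hz => ?_⟩
  have h2 : ‖chartRightDeriv EG G z - ContinuousLinearMap.id ℝ EG‖ < ε := (h hz).2.2
  refine ⟨h2.le, ?_⟩
  calc ‖chartRightDeriv EG G z‖ = ‖(chartRightDeriv EG G z - ContinuousLinearMap.id ℝ EG)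
        + ContinuousLinearMap.id ℝ EG‖ := by rw [sub_add_cancel]
    _ ≤ ε + 1 := (norm_add_le _ _).trans (add_le_add h2.le ContinuousLinearMap.norm_id_le)
    _ ≤ 2 := by linarith

/-- Solutions of `u' u⁻¹ = A` with small `A`: existence, and comparison with the integral of `A`. -/
theorem exists_small_solution [FiniteDimensional ℝ EG] {ε : ℝ} (hε : 0 < ε) (hε1 : ε ≤ 1) :
    ∃ ρ > 0, ∀ (A : ℝ → EG) (s₀ T b : ℝ), Continuous A → 0 < T → 0 ≤ b →
      (∀ s ∈ Icc (s₀ - T) (s₀ + T), ‖A s‖ ≤ b) → 2 * b * T ≤ ρ →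
      ∃ z : ℝ → G, z s₀ = 1 ∧ ∀ s ∈ Ioo (s₀ - T) (s₀ + T),
        HasRightLogDerivAt z (A s) s ∧ z s ∈ (chartAt EG (1 : G)).source ∧
        ‖chartAt EG (1 : G) (z s) - chartOne EG G‖ ≤ 2 * b * T ∧
        ‖chartAt EG (1 : G) (z s) - chartOne EG G - ∫ r in s₀..s, A r‖ ≤ ε * b * T := by
  have : CompleteSpace EG := FiniteDimensional.complete ℝ EG
  obtain ⟨ρ, hρ, K, hT, hK, hR⟩ := chartRightDeriv_estimates (EG := EG) (G := G) hε hε1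
  refine ⟨ρ, hρ, fun A s₀ T b hA hT0 hb hAb hρ' => ?_⟩
  lift b to ℝ≥0 using hb
  lift T to ℝ≥0 using hT0.le
  have hsub : Metric.closedBall (chartOne EG G) (2 * b * T) ⊆ Metric.closedBall (chartOne EG G) ρ :=
    Metric.closedBall_subset_closedBall hρ'
  -- The speed is at most `2 * b`, so in time `T` the solution cannot leave the ball of radius `2 *
  -- b * T`, which lies where the estimates on `R` hold.
  have hpl : IsPicardLindelof (fun t z => chartRightDeriv EG G z (A t)) (tmin := s₀ - T)
      (tmax := s₀ + T) ⟨s₀, by constructor <;> linarith⟩ (chartOne EG G)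
      (2 * b * T) 0 (2 * b) (K * b) := by
    refine ⟨fun t ht => ?_, fun x hx => ?_, fun t ht x hx => ?_, ?_⟩
    · refine LipschitzOnWith.of_dist_le_mul fun x hx y hy => ?_
      rw [dist_eq_norm, ← sub_apply]
      have h1 := hK.dist_le_mul x (hsub hx) y (hsub hy)
      rw [dist_eq_norm] at h1
      calc _ ≤ ‖chartRightDeriv EG G x - chartRightDeriv EG G y‖ * ‖A t‖ :=
            ContinuousLinearMap.le_opNorm _ _
        _ ≤ (K * dist x y) * b := by gcongr; exact hAb t ht
        _ = _ := by push_cast; ring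
    · exact ((chartRightDeriv EG G x).continuous.comp hA).continuousOn
    · calc _ ≤ ‖chartRightDeriv EG G x‖ * ‖A t‖ := ContinuousLinearMap.le_opNorm _ _
        _ ≤ 2 * b := by gcongr; exacts [(hR x (hsub hx)).2, hAb t ht]
    · simp
  obtain ⟨ζ, hζ0, hζ⟩ := hpl.exists_hasDerivWithinAt_mem_closedBall
  push_cast at hζ hζ0
  have hmem : ∀ s ∈ Ioo (s₀ - T) (s₀ + T), ζ s ∈ (chartAt EG (1 : G)).target := fun s hs =>
    hT (hsub (hζ s (Ioo_subset_Icc_self hs)).1)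
  have hder : ∀ s ∈ Ioo (s₀ - T) (s₀ + T), HasDerivAt ζ (chartRightDeriv EG G (ζ s) (A s)) s :=
    fun s hs => (hζ s (Ioo_subset_Icc_self hs)).2.hasDerivAt (Icc_mem_nhds hs.1 hs.2)
  have hs₀ : s₀ ∈ Ioo (s₀ - T) (s₀ + T) := by constructor <;> linarith
  refine ⟨fun s => (chartAt EG (1 : G)).symm (ζ s), by simp only [hζ0, chart_symm_chartOne],
    fun s hs => ⟨hasRightLogDerivAt_of_hasDerivAt (hmem s hs) ?_,
      (chartAt EG (1 : G)).map_target (hmem s hs), ?_, ?_⟩⟩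
  · simpa [chartRightDeriv] using hder s hs
  · rw [(chartAt EG (1 : G)).right_inv (hmem s hs), ← dist_eq_norm]
    exact (hζ s (Ioo_subset_Icc_self hs)).1
  · rw [(chartAt EG (1 : G)).right_inv (hmem s hs)]
    -- The difference between `ζ` and the integral of `A` has derivative `(R(ζ) - id) A`, of norm at
    -- most `ε * b`; the mean value inequality concludes.
    have hD : ∀ r ∈ Ioo (s₀ - T) (s₀ + T), HasDerivWithinAt (fun r => ζ r - ∫ q in s₀..r, A q)
        (chartRightDeriv EG G (ζ r) (A r) - A r) (Ioo (s₀ - T) (s₀ + T)) r := fun r hr =>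
      ((hder r hr).sub (hA.integral_hasStrictDerivAt s₀ r).hasDerivAt).hasDerivWithinAt
    have hbd : ∀ r ∈ Ioo (s₀ - T) (s₀ + T), ‖chartRightDeriv EG G (ζ r) (A r) - A r‖ ≤ ε * b :=
      fun r hr => by
      have h1 : chartRightDeriv EG G (ζ r) (A r) - A r
        = (chartRightDeriv EG G (ζ r) - ContinuousLinearMap.id ℝ EG) (A r) := by simp
      rw [h1]
      refine (ContinuousLinearMap.le_opNorm _ _).trans ?_
      gcongr
      · exact (hR _ (hsub (hζ r (Ioo_subset_Icc_self hr)).1)).1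
      · exact hAb r (Ioo_subset_Icc_self hr)
    have h2 := (convex_Ioo (s₀ - T) (s₀ + T)).norm_image_sub_le_of_norm_hasDerivWithin_le hD hbd hs₀ hs
    simp only [hζ0, intervalIntegral.integral_same, sub_zero] at h2
    rw [sub_right_comm]
    refine h2.trans ?_
    gcongr
    rw [Real.norm_eq_abs, abs_le]
    constructor <;> linarith [hs.1, hs.2]

/-- A curve with vanishing logarithmic derivative is constant. -/
theorem eqOn_of_hasRightLogDerivAt_zero {z : ℝ → G} {U : Set ℝ} (hU : IsOpen U)
    (hU' : IsPreconnected U) (h : ∀ s ∈ U, HasRightLogDerivAt z (0 : EG) s) {s₀ s : ℝ}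
    (h₀ : s₀ ∈ U) (hs : s ∈ U) : z s = z s₀ := by
  have hloc : IsLocallyConstant (fun s : U => z s) := by
    rw [IsLocallyConstant.iff_eventually_eq]
    rintro ⟨s, hs⟩
    -- Right translation by `(z s)⁻¹` keeps the equation and brings the curve near `1`, where its
    -- chart expression has zero derivative.
    have hc : ContinuousAt (fun r => z r * (z s)⁻¹) s := ((h s hs).mul_const _).continuousAt
    have h1 : ∀ᶠ r in 𝓝 s, z r * (z s)⁻¹ ∈ (chartAt EG (1 : G)).source ∧ r ∈ U :=
      Filter.Eventually.and (hc.preimage_mem_nhds (by simpa using chart_source_mem_nhds EG (1 : G)))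
        (hU.mem_nhds hs)
    obtain ⟨δ, hδ, hball⟩ := Metric.eventually_nhds_iff_ball.1 h1
    suffices ∀ r ∈ Metric.ball s δ, z r = z s from
      (continuous_subtype_val.tendsto (⟨s, hs⟩ : U)).eventually
        (Filter.mem_of_superset (Metric.ball_mem_nhds s hδ) this)
    intro r hr
    have hd : ∀ r ∈ Metric.ball s δ, HasDerivWithinAt
        (fun r => chartAt EG (1 : G) (z r * (z s)⁻¹)) 0 (Metric.ball s δ) r := fun r hr => by
      have := ((h r (hball r hr).2).mul_const (z s)⁻¹).hasDerivAt_chart (hball r hr).1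
      rw [Prod.mk_zero_zero, map_zero] at this
      exact this.hasDerivWithinAt
    have h3 := (convex_ball s δ).norm_image_sub_le_of_norm_hasDerivWithin_le (C := 0) hd (by simp)
      (Metric.mem_ball_self hδ) hr
    rw [zero_mul, norm_le_zero_iff, sub_eq_zero] at h3
    have h4 := (chartAt EG (1 : G)).injOn (hball r hr).1 (hball s (Metric.mem_ball_self hδ)).1 h3
    simpa [mul_inv_eq_one] using h4
  have := Subtype.preconnectedSpace hU'
  exact hloc.apply_eq_of_preconnectedSpace (⟨s, hs⟩ : U) ⟨s₀, h₀⟩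

/-- The quotient `u⁻¹ v` has logarithmic derivative `-Ad u⁻¹ A + Ad u⁻¹ A = 0`. -/
theorem eqOn_of_hasRightLogDerivAt {u v : ℝ → G} {A : ℝ → EG} {U : Set ℝ} (hU : IsOpen U)
    (hU' : IsPreconnected U) (hu : ∀ s ∈ U, HasRightLogDerivAt u (A s) s)
    (hv : ∀ s ∈ U, HasRightLogDerivAt v (A s) s) {s₀ s : ℝ}
    (h₀ : s₀ ∈ U) (hs : s ∈ U) (huv : u s₀ = v s₀) : u s = v s := by
  have h := eqOn_of_hasRightLogDerivAt_zero (EG := EG) (z := fun s => (u s)⁻¹ * v s) hU hU'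
    (fun s hs => by simpa using (hu s hs).inv.mul (hv s hs)) h₀ hs
  simp only [huv, inv_mul_cancel] at h
  exact (inv_mul_eq_one.1 h)

end

end HigherGauge

/-! ### Global solutions on the line -/

namespace HigherGauge

set_option linter.unusedSectionVars false

section

variable {EG : Type*} [NormedAddCommGroup EG] [NormedSpace ℝ EG]
  {G : Type*} [TopologicalSpace G] [ChartedSpace EG G]
  [Group G] [LieGroup 𝓘(ℝ, EG) ∞ G]

/-- The equation is invariant under right translation, so `v` can be translated to agree with `u` at
a point of the overlap, hence on the whole overlap by uniqueness. -/
theorem exists_solution_Ioo_union {A : ℝ → EG} {a b c d : ℝ} (hac : a ≤ c) (hcb : c < b)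
    (hbd : b ≤ d) {u v : ℝ → G} (hu : ∀ s ∈ Ioo a b, HasRightLogDerivAt u (A s) s)
    (hv : ∀ s ∈ Ioo c d, HasRightLogDerivAt v (A s) s) :
    ∃ w : ℝ → G, ∀ s ∈ Ioo a d, HasRightLogDerivAt w (A s) s := by
  obtain ⟨m, hcm, hmb⟩ := exists_between hcb
  let v' : ℝ → G := fun s => v s * ((v m)⁻¹ * u m)
  have hv' : ∀ s ∈ Ioo c d, HasRightLogDerivAt v' (A s) s := fun s hs => (hv s hs).mul_const _
  have huv : ∀ s ∈ Ioo c b, v' s = u s := fun s hs =>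
    eqOn_of_hasRightLogDerivAt isOpen_Ioo isPreconnected_Ioo
      (fun r hr => hv' r ⟨hr.1, hr.2.trans_le hbd⟩) (fun r hr => hu r ⟨hac.trans_lt hr.1, hr.2⟩)
      (s₀ := m) ⟨hcm, hmb⟩ hs (by simp [v'])
  refine ⟨fun s => if s < m then u s else v' s, fun s hs => ?_⟩
  rcases lt_or_ge s b with hsb | hsb
  · refine (hu s ⟨hs.1, hsb⟩).congr_of_eventuallyEq ?_
    filter_upwards [Iio_mem_nhds hsb] with r hr
    split_ifs with h
    · rfl
    · exact huv r ⟨hcm.trans_le (not_lt.1 h), hr⟩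
  · refine (hv' s ⟨hcb.trans_le hsb, hs.2⟩).congr_of_eventuallyEq ?_
    filter_upwards [Ioi_mem_nhds (hmb.trans_le hsb)] with r hr
    rw [if_neg (not_lt.2 (le_of_lt hr))]

variable [FiniteDimensional ℝ EG]

theorem exists_solution_Ioo {A : ℝ → EG} (hA : Continuous A) (x₀ : ℝ) {N : ℝ} (hN : 0 < N) :
    ∃ u : ℝ → G, ∀ s ∈ Ioo (x₀ - N) (x₀ + N), HasRightLogDerivAt u (A s) s := by
  obtain ⟨ρ, hρ, H⟩ := exists_small_solution (EG := EG) (G := G) one_pos le_rfl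
  -- The margin `1` leaves room for local solutions of radius `δ ≤ 1` centred anywhere in the
  -- interval; the single bound `b` makes `δ` uniform.
  obtain ⟨b, hb⟩ := (isCompact_Icc (a := x₀ - N - 1) (b := x₀ + N + 1)).exists_bound_of_continuousOn
    hA.continuousOn
  have hb0 : 0 ≤ b := (norm_nonneg _).trans (hb x₀ (by constructor <;> linarith))
  obtain ⟨δ, hδ, hδ1, hδρ⟩ : ∃ δ > 0, δ ≤ 1 ∧ 2 * b * δ ≤ ρ := by
    refine ⟨min 1 (ρ / (2 * b + 1)), by positivity, min_le_left _ _, ?_⟩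
    calc 2 * b * min 1 (ρ / (2 * b + 1)) ≤ (2 * b + 1) * (ρ / (2 * b + 1)) := by
          gcongr
          · linarith
          · exact min_le_right _ _
      _ = ρ := by field_simp
  have hloc : ∀ s₀ ∈ Icc (x₀ - N) (x₀ + N), ∃ u : ℝ → G,
      ∀ s ∈ Ioo (s₀ - δ) (s₀ + δ), HasRightLogDerivAt u (A s) s := fun s₀ hs₀ => by
    obtain ⟨z, -, hz⟩ := H A s₀ δ b hA hδ hb0
      (fun s hs => hb s ⟨by linarith [hs.1, hs₀.1], by linarith [hs.2, hs₀.2]⟩) hδρ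
    exact ⟨z, fun s hs => (hz s hs).1⟩
  -- Centres advance by `δ / 2`, so consecutive intervals of radius `δ` overlap.
  have hind : ∀ k : ℕ, k * (δ / 2) ≤ 2 * N → ∃ u : ℝ → G,
      ∀ s ∈ Ioo (x₀ - N - δ) (x₀ - N + k * (δ / 2) + δ), HasRightLogDerivAt u (A s) s := by
    intro k
    induction k with
    | zero =>
      intro _
      simpa using hloc (x₀ - N) ⟨le_rfl, by linarith⟩
    | succ k ih =>
      intro hk
      push_cast at hk
      obtain ⟨u, hu⟩ := ih (by linarith)
      have hk0 : 0 ≤ k * (δ / 2) := by positivity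
      obtain ⟨v, hv⟩ := hloc (x₀ - N + (k + 1) * (δ / 2)) ⟨by linarith, by linarith⟩
      push_cast
      exact exists_solution_Ioo_union (by linarith) (by linarith) (by linarith) hu hv
  have hfl := Nat.floor_le (show 0 ≤ 4 * N / δ by positivity)
  have hfl' := Nat.lt_floor_add_one (4 * N / δ)
  rw [le_div_iff₀ hδ] at hfl
  rw [div_lt_iff₀ hδ] at hfl'
  obtain ⟨u, hu⟩ := hind ⌊4 * N / δ⌋₊ (by linarith)
  exact ⟨u, fun s hs => hu s ⟨by linarith [hs.1], by linarith [hs.2]⟩⟩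

theorem exists_solution {A : ℝ → EG} (hA : Continuous A) (x₀ : ℝ) :
    ∃ u : ℝ → G, u x₀ = 1 ∧ ∀ s, HasRightLogDerivAt u (A s) s := by
  have h : ∀ n : ℕ, ∃ u : ℝ → G, u x₀ = 1 ∧
      ∀ s ∈ Ioo (x₀ - (n + 1)) (x₀ + (n + 1)), HasRightLogDerivAt u (A s) s := fun n => by
    obtain ⟨u, hu⟩ := exists_solution_Ioo (G := G) hA x₀ (N := n + 1) (by positivity)
    exact ⟨fun s => u s * (u x₀)⁻¹, by simp, fun s hs => (hu s hs).mul_const _⟩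
  choose u hu0 hu using h
  have hmono : ∀ m n : ℕ, m ≤ n → ∀ s ∈ Ioo (x₀ - (m + 1)) (x₀ + (m + 1)), u m s = u n s := by
    intro m n hmn s hs
    have hmn' : (m : ℝ) ≤ n := by exact_mod_cast hmn
    have hm0 : (0 : ℝ) ≤ m := m.cast_nonneg
    exact eqOn_of_hasRightLogDerivAt isOpen_Ioo isPreconnected_Ioo (hu m)
      (fun r hr => hu n r ⟨by linarith [hr.1], by linarith [hr.2]⟩) (s₀ := x₀)
      ⟨by linarith, by linarith⟩ hs (by rw [hu0, hu0])
  have hmem : ∀ (r : ℝ) (n : ℕ), |r - x₀| < n + 1 → r ∈ Ioo (x₀ - (n + 1)) (x₀ + (n + 1)) :=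
    fun r n hr => by
      rw [abs_lt] at hr
      exact ⟨by linarith [hr.1], by linarith [hr.2]⟩
  have hall : ∀ (r : ℝ) (n : ℕ), |r - x₀| < n + 1 → u ⌈|r - x₀|⌉₊ r = u n r := fun r n hr => by
    have hr' : |r - x₀| < ⌈|r - x₀|⌉₊ + 1 := (Nat.le_ceil _).trans_lt (lt_add_one _)
    rcases le_total ⌈|r - x₀|⌉₊ n with h | h
    · exact hmono _ _ h r (hmem _ _ hr')
    · exact (hmono _ _ h r (hmem _ _ hr)).symm
  -- The radius `n + 1` rather than `n` puts `r` strictly inside the interval indexed by `⌈|r -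
  -- x₀|⌉₊`; near `s` a single index serves, by `hall`.
  refine ⟨fun r => u ⌈|r - x₀|⌉₊ r, hu0 _, fun s => ?_⟩
  have hs : |s - x₀| < ⌈|s - x₀|⌉₊ + 1 := (Nat.le_ceil _).trans_lt (lt_add_one _)
  refine (hu ⌈|s - x₀|⌉₊ s (hmem _ _ hs)).congr_of_eventuallyEq ?_
  have : ContinuousAt (fun r : ℝ => |r - x₀|) s := by fun_prop
  filter_upwards [this.eventually_lt_const hs] with r hr using hall r _ hr

theorem rightSolution_spec {A : ℝ → EG} (hA : Continuous A) (x₀ : ℝ) :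
    (rightSolution A x₀ : ℝ → G) x₀ = 1 ∧
      ∀ s, HasRightLogDerivAt (rightSolution A x₀ : ℝ → G) (A s) s :=
  Classical.epsilon_spec (p := fun u : ℝ → G => u x₀ = 1 ∧ ∀ s, HasRightLogDerivAt u (A s) s)
    (exists_solution hA x₀)

omit [FiniteDimensional ℝ EG] in
theorem rightSolution_eq {A : ℝ → EG} {x₀ : ℝ} {u : ℝ → G} (h0 : u x₀ = 1)
    (hu : ∀ s, HasRightLogDerivAt u (A s) s) : rightSolution A x₀ = u := by
  have h := Classical.epsilon_spec
    (p := fun u : ℝ → G => u x₀ = 1 ∧ ∀ s, HasRightLogDerivAt u (A s) s) ⟨u, h0, hu⟩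
  funext s
  exact eqOn_of_hasRightLogDerivAt isOpen_univ isPreconnected_univ (fun s _ => h.2 s)
    (fun s _ => hu s) (mem_univ x₀) (mem_univ s) (h.1.trans h0.symm)

/-- Inversion exchanges the left problem for `A` and the right problem for `-A`, so the theory is
needed only on one side. -/
theorem leftSolution_eq {A : ℝ → EG} (hA : Continuous A) (x₀ : ℝ) :
    (leftSolution A x₀ : ℝ → G) = fun s => ((rightSolution (fun s => -A s) x₀ : ℝ → G) s)⁻¹ := by
  have hR : (rightSolution (fun s => -A s) x₀ : ℝ → G) x₀ = 1 ∧
      ∀ s, HasRightLogDerivAt (rightSolution (fun s => -A s) x₀ : ℝ → G) (-A s) s :=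
    rightSolution_spec hA.neg x₀
  have h := Classical.epsilon_spec
    (p := fun u : ℝ → G => u x₀ = 1 ∧ ∀ s, HasLeftLogDerivAt u (A s) s)
    ⟨fun s => ((rightSolution (fun s => -A s) x₀ : ℝ → G) s)⁻¹, inv_eq_one.2 hR.1, fun s => by
      have := hR.2 s
      rw [← neg_neg (A s), ← hasRightLogDerivAt_inv_iff]
      simpa only [inv_inv] using this⟩
  have h2 : rightSolution (fun s => -A s) x₀ = fun s => ((leftSolution A x₀ : ℝ → G) s)⁻¹ :=
    rightSolution_eq (inv_eq_one.2 h.1) fun s => by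
      rw [hasRightLogDerivAt_inv_iff, neg_neg]; exact h.2 s
  rw [h2]
  simp

end

end HigherGauge

/-! ### Dependence of solutions on a parameter -/

namespace HigherGauge

set_option linter.unusedSectionVars false

section

open Filter

variable {EG : Type*} [NormedAddCommGroup EG] [NormedSpace ℝ EG]
  {G : Type*} [TopologicalSpace G] [ChartedSpace EG G]
  [Group G] [LieGroup 𝓘(ℝ, EG) ∞ G]

theorem continuous_Ad : Continuous (fun a : G => (Ad a : EG →L[ℝ] EG)) :=
  (conjModule EG G).continuous_mDot

variable [FiniteDimensional ℝ EG]
  {A : ℝ → ℝ → EG} {u : ℝ → ℝ → G} {x₀ : ℝ}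

/-- The quotient of two nearby solutions solves a differential problem of the same kind. -/
theorem hasRightLogDerivAt_inv_mul (hu : ∀ s y, HasRightLogDerivAt (fun s => u s y) (A s y) s)
    (s y y' : ℝ) :
    HasRightLogDerivAt (fun r => (u r y)⁻¹ * u r y') (Ad (u s y)⁻¹ (A s y' - A s y)) s := by
  have h := (hu s y).inv.mul (hu s y')
  rwa [← map_neg, ← map_add, neg_add_eq_sub] at h

/-- Factor `u(r, y') = u(r, y) · (u(r, y)⁻¹ u(r, y'))`. The second factor solves a problem whose
coefficient is uniformly small on a compact interval for `y'` near `y`, so it stays close to `1`. -/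
theorem continuous_solution (hA : Continuous (Function.uncurry A)) (h0 : ∀ y, u x₀ y = 1)
    (hu : ∀ s y, HasRightLogDerivAt (fun s => u s y) (A s y) s) :
    Continuous (Function.uncurry u) := by
  have := topologicalGroup_of_lieGroup 𝓘(ℝ, EG) ∞ (G := G)
  have hcu : ∀ y, Continuous fun s => u s y := fun y =>
    continuous_iff_continuousAt.2 fun s => (hu s y).continuousAt
  refine continuous_iff_continuousAt.2 fun ⟨s, y⟩ => ?_
  obtain ⟨ρ, hρ, H⟩ := exists_small_solution (EG := EG) (G := G) one_pos le_rfl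
  set T := |s - x₀| + 1 with hT
  have hT0 : 0 < T := by positivity
  have hsT : s ∈ Ioo (x₀ - T) (x₀ + T) := by
    have := abs_lt.1 (show |s - x₀| < T by linarith)
    exact ⟨by linarith [this.1], by linarith [this.2]⟩
  have hx₀ : x₀ ∈ Ioo (x₀ - T) (x₀ + T) := by constructor <;> linarith
  have hz : Tendsto (fun p : ℝ × ℝ => (u p.1 y)⁻¹ * u p.1 p.2) (𝓝 (s, y)) (𝓝 1) := by
    refine fun W hW => ?_
    have hW' : (chartAt EG (1 : G)).symm ⁻¹' W ∈ 𝓝 (chartOne EG G) := by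
      refine ((chartAt EG (1 : G)).continuousAt_symm chartOne_mem_target).preimage_mem_nhds ?_
      rwa [chart_symm_chartOne]
    obtain ⟨η, hη, hηW⟩ := Metric.nhds_basis_closedBall.mem_iff.1 hW'
    -- `ρ` makes the small-coefficient result applicable, `η` forces its solution into `W`.
    obtain ⟨b, hb, hbρ⟩ : ∃ b > 0, 2 * b * T ≤ min ρ η :=
      ⟨min ρ η / (2 * T), by positivity, by apply le_of_eq; field_simp⟩
    have hB : Continuous fun p : ℝ × ℝ => Ad (u p.2 y)⁻¹ (A p.2 p.1 - A p.2 y) := by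
      refine (continuous_Ad.comp ((hcu y).comp continuous_snd).inv).clm_apply
        ((hA.comp (continuous_snd.prodMk continuous_fst)).sub
          (hA.comp (continuous_snd.prodMk continuous_const)))
    have hsmall : ∀ᶠ y' in 𝓝 y, ∀ r ∈ Icc (x₀ - T) (x₀ + T),
        ‖Ad (u r y)⁻¹ (A r y' - A r y)‖ < b := by
      refine isCompact_Icc.eventually_forall_of_forall_eventually fun r _ => ?_
      refine hB.norm.continuousAt.eventually_lt_const ?_
      simpa using hb
    have hev : ∀ᶠ p : ℝ × ℝ in 𝓝 (s, y), p.1 ∈ Ioo (x₀ - T) (x₀ + T) ∧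
        ∀ r ∈ Icc (x₀ - T) (x₀ + T), ‖Ad (u r y)⁻¹ (A r p.2 - A r y)‖ < b :=
      ((continuous_fst.tendsto (s, y)).eventually (isOpen_Ioo.mem_nhds hsT)).and
        ((continuous_snd.tendsto (s, y)).eventually hsmall)
    rw [mem_map]
    filter_upwards [hev] with ⟨r, y'⟩ ⟨hr, hy'⟩
    obtain ⟨z, hz0, hz⟩ := H (fun r => Ad (u r y)⁻¹ (A r y' - A r y)) x₀ T b
      (hB.comp (continuous_const.prodMk continuous_id)) hT0 hb.le (fun r hr => (hy' r hr).le)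
      (hbρ.trans (min_le_left _ _))
    have huz : (u r y)⁻¹ * u r y' = z r :=
      eqOn_of_hasRightLogDerivAt isOpen_Ioo isPreconnected_Ioo
        (fun r _ => hasRightLogDerivAt_inv_mul hu r y y') (fun r hr => (hz r hr).1) hx₀ hr
        (by simp [h0, hz0])
    obtain ⟨-, hsrc, hbd, -⟩ := hz r hr
    have := hηW (show chartAt EG (1 : G) (z r) ∈ Metric.closedBall (chartOne EG G) η by
      rw [mem_closedBall_iff_norm]; exact hbd.trans (hbρ.trans (min_le_right _ _)))
    change (u r y)⁻¹ * u r y' ∈ W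
    rw [huz]
    simpa [(chartAt EG (1 : G)).left_inv hsrc] using this
  have h1 : Tendsto (fun p : ℝ × ℝ => u p.1 y) (𝓝 (s, y)) (𝓝 (u s y)) :=
    ((hcu y).comp continuous_fst).continuousAt
  have h2 := h1.mul hz
  simp only [mul_inv_cancel_left, mul_one] at h2
  exact h2

/-- Variation of constants. The quotient `u(·, y)⁻¹ u(·, y')` has a coefficient of size `C |y' -
y|`; in the chart it equals the integral of that coefficient up to `ε C T |y' - y|` with `ε`
arbitrary. Only the integral contributes to first order, and it is differentiated under the integral
sign. -/
theorem hasLeftLogDerivAt_solution {A' : ℝ → ℝ → EG} (hA : Continuous (Function.uncurry A))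
    (hA' : Continuous (Function.uncurry A')) (hd : ∀ s y, HasDerivAt (fun y => A s y) (A' s y) y)
    (h0 : ∀ y, u x₀ y = 1) (hu : ∀ s y, HasRightLogDerivAt (fun s => u s y) (A s y) s) (s y : ℝ) :
    HasLeftLogDerivAt (fun y => u s y) (∫ r in x₀..s, Ad (u r y)⁻¹ (A' r y)) y := by
  have := topologicalGroup_of_lieGroup 𝓘(ℝ, EG) ∞ (G := G)
  have hcu := continuous_solution hA h0 hu
  set T := |s - x₀| + 1 with hT
  have hT0 : 0 < T := by positivity
  have hsT : s ∈ Ioo (x₀ - T) (x₀ + T) := by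
    have := abs_lt.1 (show |s - x₀| < T by linarith)
    exact ⟨by linarith [this.1], by linarith [this.2]⟩
  have hx₀ : x₀ ∈ Ioo (x₀ - T) (x₀ + T) := by constructor <;> linarith
  have hadj : Continuous fun r => (Ad (u r y)⁻¹ : EG →L[ℝ] EG) :=
    continuous_Ad.comp (hcu.comp (continuous_id.prodMk continuous_const)).inv
  have hB : ∀ y', Continuous fun r => Ad (u r y)⁻¹ (A r y' - A r y) := fun y' =>
    hadj.clm_apply ((hA.comp (continuous_id.prodMk continuous_const)).sub
      (hA.comp (continuous_id.prodMk continuous_const)))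
  have hB' : Continuous fun p : ℝ × ℝ => Ad (u p.1 y)⁻¹ (A' p.1 p.2) :=
    (hadj.comp continuous_fst).clm_apply hA'
  obtain ⟨C, hC⟩ := ((isCompact_Icc (a := x₀ - T) (b := x₀ + T)).prod
    (isCompact_closedBall y 1)).exists_bound_of_continuousOn hB'.continuousOn
  have hC0 : 0 ≤ C := (norm_nonneg _).trans
    (hC (x₀, y) ⟨Ioo_subset_Icc_self hx₀, Metric.mem_closedBall_self zero_le_one⟩)
  have hdB : ∀ r y', HasDerivAt (fun y' => Ad (u r y)⁻¹ (A r y' - A r y))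
      (Ad (u r y)⁻¹ (A' r y')) y' := fun r y' =>
    (Ad (u r y)⁻¹ : EG →L[ℝ] EG).hasFDerivAt.comp_hasDerivAt y' ((hd r y').sub_const _)
  have hbound : ∀ r ∈ Icc (x₀ - T) (x₀ + T), ∀ y' ∈ Metric.closedBall y 1,
      ‖Ad (u r y)⁻¹ (A r y' - A r y)‖ ≤ C * |y' - y| := fun r hr y' hy' => by
    have h := (convex_closedBall y 1).norm_image_sub_le_of_norm_hasDerivWithin_le
      (fun q _ => (hdB r q).hasDerivWithinAt) (fun q hq => hC (r, q) ⟨hr, hq⟩)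
      (Metric.mem_closedBall_self zero_le_one) hy'
    simpa using h
  have hI : HasDerivAt (fun y' => ∫ r in x₀..s, Ad (u r y)⁻¹ (A r y' - A r y))
      (∫ r in x₀..s, Ad (u r y)⁻¹ (A' r y)) y := by
    refine (intervalIntegral.hasDerivAt_integral_of_dominated_loc_of_deriv_le
      (F' := fun y' r => Ad (u r y)⁻¹ (A' r y')) (bound := fun _ => C)
      (Metric.closedBall_mem_nhds y one_pos) (.of_forall fun y' => (hB y').aestronglyMeasurable)
      ((hB y).intervalIntegrable _ _)
      (hB'.comp (continuous_id.prodMk continuous_const)).aestronglyMeasurable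
      (.of_forall fun r hr y' hy' => hC (r, y') ⟨?_, hy'⟩) (by simp)
      (.of_forall fun r _ y' _ => hdB r y')).2
    exact uIcc_subset_Icc (Ioo_subset_Icc_self hx₀) (Ioo_subset_Icc_self hsT) (uIoc_subset_uIcc hr)
  rw [hasLeftLogDerivAt_iff, hasVelocityAt_iff_chart (a := 1) (by simp)]
  refine ⟨continuousAt_const.mul (hcu.comp (continuous_const.prodMk continuous_id)).continuousAt, ?_⟩
  have hrem : HasDerivAt (fun y' => chartAt EG (1 : G) ((u s y)⁻¹ * u s y') - chartOne EG G
      - ∫ r in x₀..s, Ad (u r y)⁻¹ (A r y' - A r y)) 0 y := by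
    rw [hasDerivAt_iff_isLittleO]
    refine Asymptotics.isLittleO_iff.2 fun ε' hε' => ?_
    -- The `+ 1` in the denominator covers the case `C = 0`.
    obtain ⟨ε, hε, hε1, hεε'⟩ : ∃ ε > 0, ε ≤ 1 ∧ ε * C * T ≤ ε' := by
      refine ⟨min 1 (ε' / (C * T + 1)), by positivity, min_le_left _ _, ?_⟩
      calc min 1 (ε' / (C * T + 1)) * C * T = min 1 (ε' / (C * T + 1)) * (C * T) := by ring
        _ ≤ (ε' / (C * T + 1)) * (C * T + 1) := by
            gcongr
            · exact min_le_right _ _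
            · linarith
        _ = ε' := by field_simp
    obtain ⟨ρ, hρ, H⟩ := exists_small_solution (EG := EG) (G := G) hε hε1
    have hsm : ∀ᶠ y' in 𝓝 y, 2 * (C * |y' - y|) * T < ρ := by
      have : ContinuousAt (fun y' => 2 * (C * |y' - y|) * T) y := by fun_prop
      exact this.eventually_lt_const (by simpa using hρ)
    filter_upwards [hsm, Metric.closedBall_mem_nhds y one_pos] with y' hy' hy1
    obtain ⟨z, hz0, hz⟩ := H _ x₀ T (C * |y' - y|) (hB y') hT0 (by positivity)
      (fun r hr => hbound r hr y' hy1) hy'.le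
    have huz : (u s y)⁻¹ * u s y' = z s :=
      eqOn_of_hasRightLogDerivAt isOpen_Ioo isPreconnected_Ioo
        (fun r _ => hasRightLogDerivAt_inv_mul hu r y y') (fun r hr => (hz r hr).1) hx₀ hsT
        (by simp [h0, hz0])
    have h1 := (hz s hsT).2.2.2
    simp only [inv_mul_cancel, sub_self, map_zero, intervalIntegral.integral_zero, smul_zero,
      sub_zero, huz]
    rw [show chartAt EG (1 : G) 1 = chartOne EG G from rfl, sub_self, sub_zero]
    refine h1.trans ?_
    rw [Real.norm_eq_abs]
    calc ε * (C * |y' - y|) * T = (ε * C * T) * |y' - y| := by ring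
      _ ≤ ε' * |y' - y| := by gcongr
  have := (hrem.add hI).add_const (chartOne EG G)
  simpa using this

end

end HigherGauge

/-! ### The surface problem and the gauge computation on the plane -/

namespace HigherGauge

set_option linter.unusedSectionVars false

section

open Function

theorem eq_of_hasDerivAt_eq {F : Type*} [NormedAddCommGroup F] [NormedSpace ℝ F] {f g f' : ℝ → F}
    (hf : ∀ x, HasDerivAt f (f' x) x) (hg : ∀ x, HasDerivAt g (f' x) x) {x₀ : ℝ}
    (h : f x₀ = g x₀) : f = g := by
  have h0 : ∀ x, HasDerivAt (f - g) 0 x := fun x => by simpa using (hf x).sub (hg x)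
  funext x
  have := is_const_of_deriv_eq_zero (fun x => (h0 x).differentiableAt) (fun x => (h0 x).deriv) x x₀
  simpa [h, sub_eq_zero] using this

theorem hasDerivAt_integral {F : Type*} [NormedAddCommGroup F] [NormedSpace ℝ F] [CompleteSpace F]
    {f : ℝ → ℝ → F} (hf : Continuous (uncurry f)) (x₀ x y : ℝ) :
    HasDerivAt (fun s => ∫ r in x₀..s, f r y) (f x y) x := by
  have hc : Continuous fun r => f r y := hf.comp (continuous_id.prodMk continuous_const)
  exact intervalIntegral.integral_hasDerivAt_right (hc.intervalIntegrable _ _)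
    hc.aestronglyMeasurable.stronglyMeasurableAtFilter hc.continuousAt

theorem continuous_integral {F : Type*} [NormedAddCommGroup F] [NormedSpace ℝ F]
    {f : ℝ → ℝ → F} (hf : Continuous (uncurry f)) (x₀ : ℝ) :
    Continuous (uncurry fun x y => ∫ r in x₀..x, f r y) := by
  have h : Continuous (uncurry fun (p : ℝ × ℝ) r => f r p.2) :=
    hf.comp (continuous_snd.prodMk (continuous_snd.comp continuous_fst))
  exact intervalIntegral.continuous_parametric_intervalIntegral_of_continuous h continuous_fst

theorem lieBracketCLM_skew {EG G : Type*} [NormedAddCommGroup EG] [NormedSpace ℝ EG]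
    [FiniteDimensional ℝ EG] [TopologicalSpace G] [ChartedSpace EG G] [Group G]
    [LieGroup 𝓘(ℝ, EG) ∞ G] (Y Z : EG) :
    lieBracketCLM G Y Z = -lieBracketCLM G Z Y := by
  have : CompleteSpace EG := FiniteDimensional.complete ℝ EG
  have : LieGroup 𝓘(ℝ, EG) (minSmoothness ℝ 3) G := by
    rw [minSmoothness_of_isRCLikeNormedField]
    exact inferInstance
  rw [lieBracketCLM_apply, lieBracketCLM_apply]
  exact (lie_skew (L := GroupLieAlgebra 𝓘(ℝ, EG) G) Y Z).symm

theorem HasRightLogDerivAt.congr_logDeriv {EG G : Type*} [NormedAddCommGroup EG] [NormedSpace ℝ EG]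
    [TopologicalSpace G] [ChartedSpace EG G] [Group G] {u : ℝ → G} {X Y : EG} {s : ℝ}
    (h : HasRightLogDerivAt u X s) (e : X = Y) : HasRightLogDerivAt u Y s := e ▸ h

namespace LieCrossedModule

variable {EG EH G H : Type*}
  [NormedAddCommGroup EG] [NormedSpace ℝ EG] [FiniteDimensional ℝ EG]
  [NormedAddCommGroup EH] [NormedSpace ℝ EH] [FiniteDimensional ℝ EH]
  [TopologicalSpace G] [ChartedSpace EG G] [Group G] [LieGroup 𝓘(ℝ, EG) ∞ G]
  [TopologicalSpace H] [ChartedSpace EH H] [Group H] [LieGroup 𝓘(ℝ, EH) ∞ H]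
  (X : LieCrossedModule EG EH G H)

theorem mHat_tDot_eq_lieBracketCLM (A : EH) : X.mHat (X.tDot A) = lieBracketCLM H A := by
  rw [mHat_tDot, lieBracketCLM_eq_mHat (EG := EH) (G := H)]

/-- The bracket of `𝔥` is `m̂(ṫ(·), ·)`, so this is the equivariance of `ṫ` and of `m̂`. -/
theorem lieBracketCLM_mDot (a : G) (Y Z : EH) :
    lieBracketCLM H (X.mDot a Y) (X.mDot a Z) = X.mDot a (lieBracketCLM H Y Z) := by
  rw [← X.mHat_tDot_eq_lieBracketCLM, ← X.mHat_tDot_eq_lieBracketCLM, tDot_mDot, mHat_Ad]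

/-- `∂_y E E⁻¹` for the solution `E` of the surface problem with `v = 1`. -/
noncomputable def surfaceDensity (u : ℝ → ℝ → G) (b : ℝ → ℝ → EH) (x₀ : ℝ) (x y : ℝ) : EH :=
  ∫ r in x₀..x, -(X.mDot (u r y)⁻¹ (b r y))

section SurfaceProblem

variable {u : ℝ → ℝ → G} {b : ℝ → ℝ → EH}

theorem continuous_surfaceIntegrand (hu : Continuous (uncurry u)) (hb : Continuous (uncurry b)) :
    Continuous (uncurry fun r y => -(X.mDot (u r y)⁻¹ (b r y))) := by
  have := topologicalGroup_of_lieGroup 𝓘(ℝ, EG) ∞ (G := G)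
  exact ((X.continuous_mDot.comp hu.inv).clm_apply hb).neg

theorem hasDerivAt_surfaceDensity (hu : Continuous (uncurry u)) (hb : Continuous (uncurry b))
    (x₀ x y : ℝ) : HasDerivAt (fun r => X.surfaceDensity u b x₀ r y)
      (-(X.mDot (u x y)⁻¹ (b x y))) x :=
  hasDerivAt_integral (X.continuous_surfaceIntegrand hu hb) x₀ x y

theorem continuous_surfaceDensity (hu : Continuous (uncurry u)) (hb : Continuous (uncurry b))
    (x₀ : ℝ) : Continuous (uncurry (X.surfaceDensity u b x₀)) :=
  continuous_integral (X.continuous_surfaceIntegrand hu hb) x₀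

/-- The condition `S(x₀, ·) = 1` forces `K(x₀, ·) = 0`, so `K` is the integral of its
`x`-derivative; then `S x` solves an ordinary problem in `y`. -/
theorem surfaceSolution_eq (hu : Continuous (uncurry u)) (hb : Continuous (uncurry b))
    {x₀ y₀ : ℝ} {S : ℝ → ℝ → H}
    (hS : X.IsSurfaceSolution (fun y x => u x y) (fun _ => 1) b x₀ y₀ S) (x : ℝ) :
    S x = rightSolution (fun y => X.surfaceDensity u b x₀ x y) y₀ := by
  obtain ⟨h0, h1, K, hK, hK'⟩ := hS
  have hKe : ∀ y, (fun r => K r y) = fun r => X.surfaceDensity u b x₀ r y := fun y => by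
    refine eq_of_hasDerivAt_eq (x₀ := x₀) (fun r => ?_)
      (fun r => X.hasDerivAt_surfaceDensity hu hb x₀ r y) ?_
    · simpa using hK' r y
    · have h := hK x₀ y
      simp only [h0] at h
      simpa [surfaceDensity] using h.unique (hasRightLogDerivAt_const 1 y)
  refine (rightSolution_eq (h1 x) fun y => ?_).symm
  rw [← congrFun (hKe y) x]
  exact hK x y

theorem exists_isSurfaceSolution (hu : Continuous (uncurry u)) (hb : Continuous (uncurry b))
    (x₀ y₀ : ℝ) : ∃ S : ℝ → ℝ → H,
      X.IsSurfaceSolution (fun y x => u x y) (fun _ => 1) b x₀ y₀ S := by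
  have hc : ∀ x, Continuous fun y => X.surfaceDensity u b x₀ x y := fun x =>
    (X.continuous_surfaceDensity hu hb x₀).comp (continuous_const.prodMk continuous_id)
  refine ⟨fun x => rightSolution (fun y => X.surfaceDensity u b x₀ x y) y₀, fun y => ?_,
    fun x => (rightSolution_spec (hc x) y₀).1, X.surfaceDensity u b x₀,
    fun x y => (rightSolution_spec (hc x) y₀).2 y, fun x y => ?_⟩
  · refine congrFun (rightSolution_eq (u := fun _ => (1 : H)) rfl fun s => ?_) y
    simpa [surfaceDensity] using hasRightLogDerivAt_const (EG := EH) (1 : H) s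
  · simpa using X.hasDerivAt_surfaceDensity hu hb x₀ x y

theorem epsilon_surfaceSolution (hu : Continuous (uncurry u)) (hb : Continuous (uncurry b))
    (x₀ y₀ x : ℝ) :
    Classical.epsilon (X.IsSurfaceSolution (fun y x => u x y) (fun _ => 1) b x₀ y₀) x
      = rightSolution (fun y => X.surfaceDensity u b x₀ x y) y₀ :=
  X.surfaceSolution_eq hu hb (Classical.epsilon_spec (X.exists_isSurfaceSolution hu hb x₀ y₀)) x

end SurfaceProblem

/-- The coordinate data on the plane of a connection doublet and a 1-gauge transformation. Here
`axy` is `∂_y a_x`, `ayx` is `∂_x a_y`, and so on, and `σx`, `σy` are the components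
of `dκ κ⁻¹`. -/
structure PlaneGauge where
  (ax ay axy ayx σx σy : ℝ → ℝ → EG)
  (b Γx Γy Γxy Γyx : ℝ → ℝ → EH)
  κ : ℝ → ℝ → G
  continuous_ax : Continuous (uncurry ax)
  continuous_ay : Continuous (uncurry ay)
  continuous_axy : Continuous (uncurry axy)
  continuous_σx : Continuous (uncurry σx)
  continuous_σy : Continuous (uncurry σy)
  continuous_b : Continuous (uncurry b)
  continuous_Γx : Continuous (uncurry Γx)
  continuous_Γy : Continuous (uncurry Γy)
  continuous_Γxy : Continuous (uncurry Γxy)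
  continuous_Γyx : Continuous (uncurry Γyx)
  continuous_κ : Continuous (uncurry κ)
  hasDerivAt_ax : ∀ x y, HasDerivAt (fun r => ax x r) (axy x y) y
  hasDerivAt_ay : ∀ x y, HasDerivAt (fun r => ay r y) (ayx x y) x
  hasDerivAt_Γx : ∀ x y, HasDerivAt (fun r => Γx x r) (Γxy x y) y
  hasDerivAt_Γy : ∀ x y, HasDerivAt (fun r => Γy r y) (Γyx x y) x
  hasRightLogDerivAt_x : ∀ x y, HasRightLogDerivAt (fun r => κ r y) (σx x y) x
  hasRightLogDerivAt_y : ∀ x y, HasRightLogDerivAt (fun r => κ x r) (σy x y) y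
  fakeFlat : ∀ x y, ayx x y - axy x y + lieBracketCLM G (ax x y) (ay x y) = X.tDot (b x y)
  -- These boundary conditions are all that is kept of the sitting instants: the edges `x = 0` and
  -- `x = 1` are mapped to points.
  ay_one : ∀ y, ay 1 y = 0
  κ_one : ∀ y y', κ 1 y = κ 1 y'
  Γy_one : ∀ y, Γy 1 y = 0
  Γy_zero : ∀ y, Γy 0 y = 0

/-! ### Transformed solutions and densities -/

namespace PlaneGauge

variable {X}
variable (d : X.PlaneGauge)

/-- The gauge transform of `a_x`. -/
noncomputable def ax' (x y : ℝ) : EG := Ad (d.κ x y) (d.ax x y) - d.σx x y - X.tDot (d.Γx x y)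

/-- The gauge transform of `a_y`. -/
noncomputable def ay' (x y : ℝ) : EG := Ad (d.κ x y) (d.ay x y) - d.σy x y - X.tDot (d.Γy x y)

/-- The gauge transform of `B_{xy}`. -/
noncomputable def b' (x y : ℝ) : EH := X.mDot (d.κ x y) (d.b x y) - (d.Γyx x y - d.Γxy x y)
  - lieBracketCLM H (d.Γx x y) (d.Γy x y)
  - (X.mHat (d.ax' x y) (d.Γy x y) - X.mHat (d.ay' x y) (d.Γx x y))

/-- The solution `f(x, 1; y)` of `∂_x u u⁻¹ = -a_x`, with `u = 1` at `x = 1`. -/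
noncomputable def u (x y : ℝ) : G := rightSolution (fun r => -d.ax r y) 1 x

/-- The product `κ u`. -/
noncomputable def w (x y : ℝ) : G := d.κ x y * d.u x y

/-- The logarithmic derivative `Λ⁻¹ ∂_x Λ`. -/
noncomputable def c (x y : ℝ) : EH := -(X.mDot (d.w x y)⁻¹ (d.Γx x y))

/-- The inverse of the solution `Λ`. -/
noncomputable def μ (x y : ℝ) : H := rightSolution (fun r => -d.c r y) 1 x

/-- The solution for the gauge transformed doublet. -/
noncomputable def u' (x y : ℝ) : G := d.w x y * X.t (d.μ x y) * (d.κ 1 0)⁻¹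

/-- `∂_y E E⁻¹` for the surface transport `E`. -/
noncomputable def K (x y : ℝ) : EH := X.surfaceDensity d.u d.b 1 x y

theorem continuous_slice {F : Type*} [TopologicalSpace F] {f : ℝ → ℝ → F}
    (hf : Continuous (uncurry f)) (y : ℝ) : Continuous fun x => f x y :=
  hf.comp (continuous_id.prodMk continuous_const)

theorem u_one (y : ℝ) : d.u 1 y = 1 :=
  (rightSolution_spec (G := G) (continuous_slice d.continuous_ax y).neg 1).1

theorem hasRightLogDerivAt_u (x y : ℝ) :
    HasRightLogDerivAt (fun r => d.u r y) (-d.ax x y) x :=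
  (rightSolution_spec (G := G) (continuous_slice d.continuous_ax y).neg 1).2 x

theorem continuous_u : Continuous (uncurry d.u) :=
  continuous_solution (A := fun x y => -d.ax x y) d.continuous_ax.neg d.u_one
    d.hasRightLogDerivAt_u

theorem continuous_w : Continuous (uncurry d.w) := by
  have := topologicalGroup_of_lieGroup 𝓘(ℝ, EG) ∞ (G := G)
  exact d.continuous_κ.mul d.continuous_u

theorem continuous_c : Continuous (uncurry d.c) :=
  X.continuous_surfaceIntegrand d.continuous_w d.continuous_Γx

theorem μ_one (y : ℝ) : d.μ 1 y = 1 :=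
  (rightSolution_spec (G := H) (continuous_slice d.continuous_c y).neg 1).1

theorem hasRightLogDerivAt_μ (x y : ℝ) :
    HasRightLogDerivAt (fun r => d.μ r y) (-d.c x y) x :=
  (rightSolution_spec (G := H) (continuous_slice d.continuous_c y).neg 1).2 x

theorem continuous_μ : Continuous (uncurry d.μ) :=
  continuous_solution (A := fun x y => -d.c x y) d.continuous_c.neg d.μ_one
    d.hasRightLogDerivAt_μ

theorem continuous_u' : Continuous (uncurry d.u') := by
  have := topologicalGroup_of_lieGroup 𝓘(ℝ, EG) ∞ (G := G)
  exact (d.continuous_w.mul (X.contMDiff_t.continuous.comp d.continuous_μ)).mul continuous_const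

theorem continuous_K : Continuous (uncurry d.K) :=
  X.continuous_surfaceDensity d.continuous_u d.continuous_b 1

theorem continuous_ax' : Continuous (uncurry d.ax') :=
  (((continuous_Ad.comp d.continuous_κ).clm_apply d.continuous_ax).sub d.continuous_σx).sub
    (X.tDot.continuous.comp d.continuous_Γx)

theorem continuous_ay' : Continuous (uncurry d.ay') :=
  (((continuous_Ad.comp d.continuous_κ).clm_apply d.continuous_ay).sub d.continuous_σy).sub
    (X.tDot.continuous.comp d.continuous_Γy)

theorem continuous_b' : Continuous (uncurry d.b') := by
  have h1 := (X.continuous_mDot.comp d.continuous_κ).clm_apply d.continuous_b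
  have h2 := ((lieBracketCLM H).continuous.comp d.continuous_Γx).clm_apply d.continuous_Γy
  have h3 := (X.mHat.continuous.comp d.continuous_ax').clm_apply d.continuous_Γy
  have h4 := (X.mHat.continuous.comp d.continuous_ay').clm_apply d.continuous_Γx
  exact ((h1.sub (d.continuous_Γyx.sub d.continuous_Γxy)).sub h2).sub (h3.sub h4)

theorem hasRightLogDerivAt_w (x y : ℝ) : HasRightLogDerivAt (fun r => d.w r y)
    (d.σx x y - Ad (d.κ x y) (d.ax x y)) x := by
  refine ((d.hasRightLogDerivAt_x x y).mul (d.hasRightLogDerivAt_u x y)).congr_logDeriv ?_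
  rw [map_neg, sub_eq_add_neg]

/-- The factor `t(μ)` contributes `Ad w (ṫ(-c))`. As `-c = ṁ(w⁻¹)(Γₓ)`, equivariance of `ṫ` makes
this `ṫ(Γₓ)`, and the factor `w` supplies the rest of `-aₓ'`. -/
theorem hasRightLogDerivAt_u' (x y : ℝ) :
    HasRightLogDerivAt (fun r => d.u' r y) (-d.ax' x y) x := by
  refine (((d.hasRightLogDerivAt_w x y).mul ((d.hasRightLogDerivAt_μ x y).map X.t
    (X.mdifferentiable_t 1))).mul_const (d.κ 1 0)⁻¹).congr_logDeriv ?_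
  rw [← X.tDot_eq, ← tDot_mDot, c, neg_neg, mDot_mDot_inv, ax']
  abel

theorem u'_one (y : ℝ) : d.u' 1 y = 1 := by
  simp [u', w, u_one, μ_one, d.κ_one y 0]

/-- The gauge transformed holonomy along horizontal lines. -/
theorem rightSolution_ax' (y : ℝ) :
    (rightSolution (fun r => -d.ax' r y) 1 : ℝ → G) = fun x => d.u' x y :=
  rightSolution_eq (d.u'_one y) fun x => d.hasRightLogDerivAt_u' x y

/-- The left logarithmic derivative of `u` in the direction `y`, computed by fake flatness. -/
theorem hasLeftLogDerivAt_u_y (x y : ℝ) : HasLeftLogDerivAt (fun r => d.u x r)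
    (-(X.tDot (d.K x y)) - Ad (d.u x y)⁻¹ (d.ay x y)) y := by
  have hA' : Continuous (uncurry fun x y => -d.axy x y) := d.continuous_axy.neg
  have h := hasLeftLogDerivAt_solution (A := fun x y => -d.ax x y) d.continuous_ax.neg hA'
    (fun x y => (d.hasDerivAt_ax x y).neg) d.u_one d.hasRightLogDerivAt_u x y
  suffices e : -(X.tDot (d.K x y)) - Ad (d.u x y)⁻¹ (d.ay x y)
      = ∫ r in (1 : ℝ)..x, Ad (d.u r y)⁻¹ (-d.axy r y) from e ▸ h
  have hq : Continuous (uncurry fun r y => Ad (d.u r y)⁻¹ (-d.axy r y)) := by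
    have := topologicalGroup_of_lieGroup 𝓘(ℝ, EG) ∞ (G := G)
    exact (continuous_Ad.comp d.continuous_u.inv).clm_apply hA'
  -- Both sides vanish at `x = 1`, where `a_y = 0`. Their `x`-derivatives agree because fake
  -- flatness rewrites `ṫ(b) - ∂ₓa_y - [aₓ, a_y]` as `-∂_yaₓ`.
  refine congrFun (eq_of_hasDerivAt_eq (x₀ := 1)
    (f := fun x => -(X.tDot (d.K x y)) - Ad (d.u x y)⁻¹ (d.ay x y)) (fun x => ?_)
    (fun x => hasDerivAt_integral hq 1 x y) ?_) x
  · have h1 : HasDerivAt (fun r => X.tDot (d.K r y)) _ x :=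
      X.tDot.hasFDerivAt.comp_hasDerivAt x
        (X.hasDerivAt_surfaceDensity d.continuous_u d.continuous_b 1 x y)
    have h2 : HasDerivAt (fun r => Ad (d.u r y)⁻¹ (d.ay r y)) _ x :=
      ((conjModule EG G).hasDerivAt_mDot_inv (d.hasRightLogDerivAt_u x y)).clm_apply
        (d.hasDerivAt_ay x y)
    refine (h1.neg.sub h2).congr_deriv ?_
    simp only [conjModule_mDot, ← lieBracketCLM_eq_mHat, map_neg, neg_neg, tDot_mDot,
      ← d.fakeFlat, map_add, map_sub, neg_apply, ContinuousLinearMap.comp_apply]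
    abel
  · simp [K, surfaceDensity, d.ay_one]

/-- The terms are grouped into `a_y'` and an image of `ṫ`, so that under `m̂` the latter becomes a
bracket in `𝔥`. -/
theorem hasRightLogDerivAt_w_y (x y : ℝ) : HasRightLogDerivAt (fun r => d.w x r)
    (-(d.ay' x y + X.tDot (d.Γy x y + X.mDot (d.w x y) (d.K x y)))) y := by
  refine ((d.hasRightLogDerivAt_y x y).mul
    (d.hasLeftLogDerivAt_u_y x y).hasRightLogDerivAt).congr_logDeriv ?_
  have e : ∀ Z : EG, Ad (d.u x y) (Ad (d.u x y)⁻¹ Z) = Z := (conjModule EG G).mDot_mDot_inv _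
  simp only [map_sub, map_neg, e, ← tDot_mDot, w, mDot_mul_apply, ay', map_add]
  abel

/-- The derivative `∂_y c`. -/
noncomputable def cy (x y : ℝ) : EH :=
  -(X.mDot (d.w x y)⁻¹ (X.mHat (d.ay' x y) (d.Γx x y) + lieBracketCLM H (d.Γy x y) (d.Γx x y)
    + d.Γxy x y)) + lieBracketCLM H (d.K x y) (d.c x y)

theorem continuous_cy : Continuous (uncurry d.cy) := by
  have := topologicalGroup_of_lieGroup 𝓘(ℝ, EG) ∞ (G := G)
  have h1 := (X.mHat.continuous.comp d.continuous_ay').clm_apply d.continuous_Γx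
  have h2 := ((lieBracketCLM H).continuous.comp d.continuous_Γy).clm_apply d.continuous_Γx
  have h3 := ((lieBracketCLM H).continuous.comp d.continuous_K).clm_apply d.continuous_c
  exact ((X.continuous_mDot.comp d.continuous_w.inv).clm_apply
    ((h1.add h2).add d.continuous_Γxy)).neg.add h3

/-- The term `ṁ(w)(K)` in the logarithmic derivative of `w` acts by bracket; moving `ṁ(w⁻¹)` inside
the bracket turns its contribution into `[K, c]`. -/
theorem hasDerivAt_c (x y : ℝ) : HasDerivAt (fun r => d.c x r) (d.cy x y) y := by
  have h : HasDerivAt (fun r => d.c x r) _ y :=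
    ((X.hasDerivAt_mDot_inv (d.hasRightLogDerivAt_w_y x y)).clm_apply (d.hasDerivAt_Γx x y)).neg
  refine h.congr_deriv ?_
  have e : lieBracketCLM H (d.K x y) (X.mDot (d.w x y)⁻¹ (d.Γx x y))
      = X.mDot (d.w x y)⁻¹ (lieBracketCLM H (X.mDot (d.w x y) (d.K x y)) (d.Γx x y)) := by
    rw [← lieBracketCLM_mDot, mDot_inv_mDot]
  simp only [cy, c, neg_apply, ContinuousLinearMap.comp_apply, map_neg, map_add,
    add_apply, mHat_tDot_eq_lieBracketCLM, e]
  abel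

/-- `∂_y Λ Λ⁻¹`. -/
noncomputable def N (x y : ℝ) : EH := ∫ r in (1 : ℝ)..x, Ad (d.μ r y)⁻¹ (d.cy r y)

theorem continuous_Ad_cy : Continuous (uncurry fun r y => Ad (d.μ r y)⁻¹ (d.cy r y)) := by
  have := topologicalGroup_of_lieGroup 𝓘(ℝ, EH) ∞ (G := H)
  exact (continuous_Ad.comp d.continuous_μ.inv).clm_apply d.continuous_cy

theorem hasRightLogDerivAt_Λ_y (x y : ℝ) :
    HasRightLogDerivAt (fun r => (d.μ x r)⁻¹) (d.N x y) y := by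
  rw [hasRightLogDerivAt_inv_iff]
  have h := hasLeftLogDerivAt_solution (A := fun x y => -d.c x y) (A' := fun x y => -d.cy x y)
    d.continuous_c.neg d.continuous_cy.neg (fun x y => (d.hasDerivAt_c x y).neg) d.μ_one
    d.hasRightLogDerivAt_μ x y
  simpa [N] using h

/-- `∂_y E E⁻¹` for the gauge transformed surface transport. -/
noncomputable def K' (x y : ℝ) : EH :=
  X.mDot (d.κ 1 0) (d.N x y + Ad (d.μ x y)⁻¹ (d.K x y)) + X.mDot (d.u' x y)⁻¹ (d.Γy x y)

/-- Brings every term of `∂ₓK'` under the common prefix `ṁ(κ(1, 0)) ∘ Ad μ⁻¹`, so that they can be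
compared. -/
theorem mDot_u'_inv (x y : ℝ) (Y : EH) : X.mDot (d.u' x y)⁻¹ Y =
    X.mDot (d.κ 1 0) (Ad (d.μ x y)⁻¹ (X.mDot (d.w x y)⁻¹ Y)) := by
  rw [← X.mDot_t, ← mDot_mul_apply, ← mDot_mul_apply]
  congr 2
  simp [u', mul_assoc]

/-- The heart of the surface formula. Differentiating `Ad μ⁻¹ (K)` yields `[c, K]`, which cancels
the `[K, c]` in `∂_yc`. What is left is `-ṁ(κ)(b)`, the two derivatives of `Γ`, one bracket `[Γₓ,
Γ_y]` and the two `m̂` terms: precisely `-b'`. -/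
theorem hasDerivAt_K' (x y : ℝ) :
    HasDerivAt (fun r => d.K' r y) (-(X.mDot (d.u' x y)⁻¹ (d.b' x y))) x := by
  have h1 := hasDerivAt_integral d.continuous_Ad_cy 1 x y
  have h2 := ((conjModule EH H).hasDerivAt_mDot_inv (d.hasRightLogDerivAt_μ x y)).clm_apply
    (X.hasDerivAt_surfaceDensity d.continuous_u d.continuous_b 1 x y)
  have h3 := (X.hasDerivAt_mDot_inv (d.hasRightLogDerivAt_u' x y)).clm_apply (d.hasDerivAt_Γy x y)
  have h : HasDerivAt (fun r => d.K' r y) _ x :=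
    ((X.mDot (d.κ 1 0)).hasFDerivAt.comp_hasDerivAt x (h1.add h2)).add h3
  refine h.congr_deriv ?_
  have e1 : X.mDot (d.u x y)⁻¹ (d.b x y) = X.mDot (d.w x y)⁻¹ (X.mDot (d.κ x y) (d.b x y)) := by
    rw [← mDot_mul_apply]; simp [w]
  have e2 : lieBracketCLM H (d.c x y) (X.surfaceDensity d.u d.b 1 x y)
    = -lieBracketCLM H (d.K x y) (d.c x y) := lieBracketCLM_skew _ _
  rw [b', lieBracketCLM_skew (d.Γx x y)]
  simp only [conjModule_mDot, ← lieBracketCLM_eq_mHat, map_neg, neg_neg, e1, e2, map_add, map_sub,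
    neg_apply, ContinuousLinearMap.comp_apply, cy, mDot_u'_inv]
  abel

theorem K'_one (y : ℝ) : d.K' 1 y = 0 := by
  simp [K', N, K, surfaceDensity, d.Γy_one]

theorem K'_eq (x y : ℝ) : d.K' x y = X.surfaceDensity d.u' d.b' 1 x y :=
  congrFun (eq_of_hasDerivAt_eq (x₀ := 1) (fun x => d.hasDerivAt_K' x y)
    (fun x => X.hasDerivAt_surfaceDensity d.continuous_u' d.continuous_b' 1 x y)
    (by simp [K'_one, surfaceDensity])) x

/-- The gauge transformed surface transport. -/
theorem rightSolution_K' :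
    (rightSolution (fun y => X.surfaceDensity d.u' d.b' 1 0 y) 0 : ℝ → H) = fun y =>
      X.m (d.κ 1 0) ((d.μ 0 y)⁻¹ * rightSolution (fun y => X.surfaceDensity d.u d.b 1 0 y) 0 y
        * d.μ 0 0) := by
  have hc : Continuous fun y => X.surfaceDensity d.u d.b 1 0 y :=
    d.continuous_K.comp (continuous_const.prodMk continuous_id)
  have hs := rightSolution_spec (G := H) hc 0
  refine rightSolution_eq (by simp [hs.1]) fun y => ?_
  have h := (((d.hasRightLogDerivAt_Λ_y 0 y).mul (hs.2 y)).mul_const (d.μ 0 0)).map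
    (X.m (d.κ 1 0)).toMonoidHom (X.mdifferentiable_m _ 1)
  refine h.congr_logDeriv ?_
  -- On the edge `x = 0` the term of `K'` containing `Γ_y` disappears, leaving the logarithmic
  -- derivative of the proposed solution.
  rw [← K'_eq, K', d.Γy_zero, map_zero, add_zero]
  rfl

end PlaneGauge

end LieCrossedModule

end

end HigherGauge

/-! ### Pull-backs of forms: smoothness and naturality of `d` -/

namespace HigherGauge

set_option linter.unusedSectionVars false

section

open Function Filter

variable {E : Type*} [NormedAddCommGroup E] [NormedSpace ℝ E]
  {M : Type*} [TopologicalSpace M] [ChartedSpace E M]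
  {V : Type*} [NormedAddCommGroup V] [NormedSpace ℝ V]
  {F : Type*} [NormedAddCommGroup F] [NormedSpace ℝ F] {k : ℕ}

/-- The value of a form, as an alternating map on the model space. -/
def modelValue (η : DForm E M F k) (p : M) : E [⋀^Fin k]→L[ℝ] F := η p

/-- The pull-back of a form to a normed space. -/
noncomputable def pullbackForm (f : V → M) (η : DForm E M F k) : V → V [⋀^Fin k]→L[ℝ] F :=
  (pullback f η : DForm V V F k)

theorem pullbackForm_apply (f : V → M) (η : DForm E M F k) (q : V) (v : Fin k → V) :
    pullbackForm f η q v
      = modelValue η (f q) (fun i => (tangentDeriv f q : V →L[ℝ] E) (v i)) := rfl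

theorem tangentDeriv_congr {f f' : V → M} {q : V} (h : f =ᶠ[𝓝 q] f') :
    (tangentDeriv f q : V →L[ℝ] E) = tangentDeriv f' q := by
  unfold tangentDeriv
  exact h.mfderiv_eq

theorem pullbackForm_congr {f f' : V → M} {q : V} (h : f =ᶠ[𝓝 q] f') (η : DForm E M F k) :
    pullbackForm f η q = pullbackForm f' η q := by
  ext v
  rw [pullbackForm_apply, pullbackForm_apply, h.eq_of_nhds, tangentDeriv_congr h]

variable [IsManifold 𝓘(ℝ, E) ∞ M]

theorem contDiffAt_chart_comp {f : V → M} (hf : ContMDiff 𝓘(ℝ, V) 𝓘(ℝ, E) ∞ f) {q₀ q : V}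
    (hq : f q ∈ (chartAt E (f q₀)).source) :
    ContDiffAt ℝ ∞ (fun q => chartAt E (f q₀) (f q)) q := by
  rw [← contMDiffAt_iff_contDiffAt]
  exact (contMDiffOn_chart.contMDiffAt ((chartAt E (f q₀)).open_source.mem_nhds hq)).comp q (hf q)

theorem eventually_mem_chart_source {f : V → M} (hf : ContMDiff 𝓘(ℝ, V) 𝓘(ℝ, E) ∞ f) (q₀ : V) :
    ∀ᶠ q in 𝓝 q₀, f q ∈ (chartAt E (f q₀)).source :=
  hf.continuous.continuousAt.eventually_mem
    ((chartAt E (f q₀)).open_source.mem_nhds (mem_chart_source E (f q₀)))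

/-- The chart is fixed at `f q₀` while `q` varies nearby; the chain rule for `f = φ⁻¹ ∘ (φ ∘ f)`
then expresses the pull-back by smooth maps of normed spaces. -/
theorem pullback_eq_chartRep {f : V → M} (hf : ContMDiff 𝓘(ℝ, V) 𝓘(ℝ, E) ∞ f)
    (η : DForm E M F k) {q₀ q : V} (hq : f q ∈ (chartAt E (f q₀)).source) :
    pullbackForm f η q
      = (chartRep η (f q₀) (chartAt E (f q₀) (f q))).compContinuousLinearMap
          (fderiv ℝ (fun q => chartAt E (f q₀) (f q)) q) := by
  set φ := chartAt E (f q₀) with hφ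
  have h : f =ᶠ[𝓝 q] fun q => φ.symm (φ (f q)) := by
    filter_upwards [hf.continuous.continuousAt.eventually_mem (φ.open_source.mem_nhds hq)] with r hr
    exact (φ.left_inv hr).symm
  rw [pullbackForm_congr h]
  have hd : (tangentDeriv (fun q => φ.symm (φ (f q))) q : V →L[ℝ] E)
      = (tangentDeriv φ.symm (φ (f q)) : E →L[ℝ] E).comp (fderiv ℝ (fun q => φ (f q)) q) := by
    rw [tangentDeriv_comp (EG := E) (EH := V) (EK := E) (F := φ.symm) (f := fun q => φ (f q))]
    · congr 1
      exact mfderiv_eq_fderiv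
    · exact (contMDiffOn_chart_symm.contMDiffAt (n := ∞) (I := 𝓘(ℝ, E))
        (φ.open_target.mem_nhds (φ.map_source hq))).mdifferentiableAt (by simp)
    · exact ((contDiffAt_chart_comp hf hq).differentiableAt (by simp)).mdifferentiableAt
  ext v
  rw [pullbackForm_apply, hd]
  rfl

theorem IsSmoothForm.contDiffAt {η : DForm E M F k} (hη : IsSmoothForm η) {p₀ p : M}
    (hp : p ∈ (chartAt E p₀).source) : ContDiffAt ℝ ∞ (chartRep η p₀) (chartAt E p₀ p) :=
  (hη p₀).contDiffAt ((chartAt E p₀).open_target.mem_nhds ((chartAt E p₀).map_source hp))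

theorem contDiff_pullback_apply [CompleteSpace F] {f : V → M} (hf : ContMDiff 𝓘(ℝ, V) 𝓘(ℝ, E) ∞ f)
    {η : DForm E M F k} (hη : IsSmoothForm η) (v : Fin k → V) :
    ContDiff ℝ ∞ fun q => pullbackForm f η q v := by
  refine contDiff_iff_contDiffAt.2 fun q₀ => ?_
  set φ := chartAt E (f q₀) with hφ
  have hφf := contDiffAt_chart_comp hf (mem_chart_source E (f q₀))
  have h : (fun q => pullbackForm f η q v) =ᶠ[𝓝 q₀] fun q =>
      chartRep η (f q₀) (φ (f q)) (fun i => fderiv ℝ (fun q => φ (f q)) q (v i)) := by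
    filter_upwards [eventually_mem_chart_source hf q₀] with q hq
    rw [pullback_eq_chartRep hf η hq]; rfl
  refine ContDiffAt.congr_of_eventuallyEq ?_ h
  have h1 : ContDiffAt ℝ ∞ (fun q => chartRep η (f q₀) (φ (f q))) q₀ :=
    (hη.contDiffAt (mem_chart_source E (f q₀))).comp q₀ hφf
  have h2 : ContDiffAt ℝ ∞ (fun q => fun i => fderiv ℝ (fun q => φ (f q)) q (v i)) q₀ :=
    contDiffAt_pi.2 fun i => (hφf.fderiv_right (m := ∞) (by simp)).clm_apply contDiffAt_const
  -- Evaluation of a form on vectors is linear in the form and multilinear in the vectors, hence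
  -- jointly analytic.
  let T : E [⋀^Fin k]→L[ℝ] F →L[ℝ] ContinuousMultilinearMap ℝ (fun _ : Fin k => E) F :=
    ContinuousAlternatingMap.toContinuousMultilinearMapCLM ℝ
  have h3 := (T.analyticAt_uncurry_of_multilinear
    (x := (chartRep η (f q₀) (φ (f q₀)), fun i => fderiv ℝ (fun q => φ (f q)) q₀ (v i)))).contDiffAt
    (n := ∞)
  exact h3.comp q₀ (h1.prodMk h2)

theorem differentiable_pullback {f : V → M} (hf : ContMDiff 𝓘(ℝ, V) 𝓘(ℝ, E) ∞ f)
    {η : DForm E M F k} (hη : IsSmoothForm η) : Differentiable ℝ (pullbackForm f η) := by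
  intro q₀
  have h : pullbackForm f η =ᶠ[𝓝 q₀] _ :=
    (eventually_mem_chart_source hf q₀).mono fun q hq => pullback_eq_chartRep hf η hq
  have hφf := contDiffAt_chart_comp hf (mem_chart_source E (f q₀))
  refine DifferentiableAt.congr_of_eventuallyEq ?_ h
  refine DifferentiableAt.continuousAlternatingMapCompContinuousLinearMap ?_ ?_
  · exact ((hη.contDiffAt (mem_chart_source E (f q₀))).comp q₀ hφf).differentiableAt (by simp)
  · exact (hφf.fderiv_right (m := ∞) (by simp)).differentiableAt (by simp)

theorem tangentDeriv_eq_fderiv {f : V → M} (hf : ContMDiff 𝓘(ℝ, V) 𝓘(ℝ, E) ∞ f) (q : V) :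
    (tangentDeriv f q : V →L[ℝ] E) = fderiv ℝ (fun r => chartAt E (f q) (f r)) q := by
  have h : HasFDerivWithinAt (writtenInExtChartAt 𝓘(ℝ, V) 𝓘(ℝ, E) q f)
      (tangentDeriv f q : V →L[ℝ] E) (range 𝓘(ℝ, V)) (extChartAt 𝓘(ℝ, V) q q) :=
    ((hf q).mdifferentiableAt (by simp)).hasMFDerivAt.2
  simp only [modelWithCornersSelf_coe, range_id, hasFDerivWithinAt_univ] at h
  exact h.fderiv.symm

/-- At `f q₀` the derivative `dForm` is computed in the chart there, in which the pull-back has the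
form just found; naturality of `extDeriv` on normed spaces applies. -/
theorem pullback_dForm {f : V → M} (hf : ContMDiff 𝓘(ℝ, V) 𝓘(ℝ, E) ∞ f)
    {η : DForm E M F k} (hη : IsSmoothForm η) (q₀ : V) :
    pullbackForm f (dForm η) q₀ = extDeriv (pullbackForm f η) q₀ := by
  have h : pullbackForm f η =ᶠ[𝓝 q₀] _ :=
    (eventually_mem_chart_source hf q₀).mono fun q hq => pullback_eq_chartRep hf η hq
  rw [h.extDeriv_eq, extDeriv_pullback (r := ∞)]
  · rw [← tangentDeriv_eq_fderiv hf]; rfl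
  · exact (hη.contDiffAt (mem_chart_source E (f q₀))).differentiableAt (by simp)
  · exact contDiffAt_chart_comp hf (mem_chart_source E (f q₀))
  · simpa using (ENat.LEInfty.out : (2 : WithTop ℕ∞) ≤ ∞)

end

end HigherGauge

/-! ### Components on the plane of the pulled-back data -/

namespace HigherGauge

set_option linter.unusedSectionVars false

section

open Function Filter

variable {E : Type*} [NormedAddCommGroup E] [NormedSpace ℝ E]
  {M : Type*} [TopologicalSpace M] [ChartedSpace E M]
  {F : Type*} [NormedAddCommGroup F] [NormedSpace ℝ F]

section Components

variable {S : ℝ × ℝ → M}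

theorem compX_pullback_eq (η : DForm E M F 1) (x y : ℝ) :
    compX (pullback S η) x y
      = modelValue η (S (x, y)) ![(tangentDeriv S (x, y) : ℝ × ℝ →L[ℝ] E) (1, 0)] := by
  refine congrArg (modelValue η (S (x, y))) (funext fun i => ?_)
  fin_cases i; rfl

theorem compY_pullback_eq (η : DForm E M F 1) (x y : ℝ) :
    compY (pullback S η) x y
      = modelValue η (S (x, y)) ![(tangentDeriv S (x, y) : ℝ × ℝ →L[ℝ] E) (0, 1)] := by
  refine congrArg (modelValue η (S (x, y))) (funext fun i => ?_)
  fin_cases i; rfl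

theorem compXY_pullback_eq (η : DForm E M F 2) (x y : ℝ) :
    compXY (pullback S η) x y
      = modelValue η (S (x, y)) ![(tangentDeriv S (x, y) : ℝ × ℝ →L[ℝ] E) (1, 0),
        (tangentDeriv S (x, y) : ℝ × ℝ →L[ℝ] E) (0, 1)] := by
  refine congrArg (modelValue η (S (x, y))) (funext fun i => ?_)
  fin_cases i <;> rfl

theorem hasVelocityAt_horizontal (x y : ℝ) :
    HasVelocityAt (fun r : ℝ => (r, y)) ((1, 0) : ℝ × ℝ) x :=
  hasVelocityAt_iff_hasDerivAt.2 ((hasDerivAt_id x).prodMk (hasDerivAt_const x y))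

theorem hasVelocityAt_vertical (x y : ℝ) :
    HasVelocityAt (fun r : ℝ => (x, r)) ((0, 1) : ℝ × ℝ) y :=
  hasVelocityAt_iff_hasDerivAt.2 ((hasDerivAt_const y x).prodMk (hasDerivAt_id y))

theorem hasVelocityAt_x (hS : ContMDiff 𝓘(ℝ, ℝ × ℝ) 𝓘(ℝ, E) ∞ S) (x y : ℝ) :
    HasVelocityAt (fun r => S (r, y)) ((tangentDeriv S (x, y) : ℝ × ℝ →L[ℝ] E) (1, 0)) x :=
  (hasVelocityAt_horizontal x y).comp rfl (hS.mdifferentiable (by simp) (x, y))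

theorem hasVelocityAt_y (hS : ContMDiff 𝓘(ℝ, ℝ × ℝ) 𝓘(ℝ, E) ∞ S) (x y : ℝ) :
    HasVelocityAt (fun r => S (x, r)) ((tangentDeriv S (x, y) : ℝ × ℝ →L[ℝ] E) (0, 1)) y :=
  (hasVelocityAt_vertical x y).comp rfl (hS.mdifferentiable (by simp) (x, y))

/-- The component `α_x` of a pull-back depends only on the restriction of the map to a horizontal
line. -/
theorem compX_pullback_congr {S' : ℝ × ℝ → M} (hS : ContMDiff 𝓘(ℝ, ℝ × ℝ) 𝓘(ℝ, E) ∞ S)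
    (hS' : ContMDiff 𝓘(ℝ, ℝ × ℝ) 𝓘(ℝ, E) ∞ S') {y y' : ℝ} (h : ∀ x, S (x, y) = S' (x, y'))
    (η : DForm E M F 1) (x : ℝ) : compX (pullback S η) x y = compX (pullback S' η) x y' := by
  have hv := (hasVelocityAt_x hS' x y').congr_of_eventuallyEq (.of_forall h)
  rw [compX_pullback_eq, compX_pullback_eq, (hasVelocityAt_x hS x y).unique hv, h]

theorem compY_pullback_eq_zero (hS : ContMDiff 𝓘(ℝ, ℝ × ℝ) 𝓘(ℝ, E) ∞ S) {x : ℝ} {p : M}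
    (h : ∀ y, S (x, y) = p) (η : DForm E M F 1) (y : ℝ) : compY (pullback S η) x y = 0 := by
  have hv := (hasVelocityAt_y hS x y).unique
    ((hasVelocityAt_const p y).congr_of_eventuallyEq (.of_forall h))
  rw [compY_pullback_eq, hv]
  exact (modelValue η _).map_coord_zero 0 rfl

variable [IsManifold 𝓘(ℝ, E) ∞ M] [CompleteSpace F]

theorem contDiff_compX (hS : ContMDiff 𝓘(ℝ, ℝ × ℝ) 𝓘(ℝ, E) ∞ S) {η : DForm E M F 1}
    (hη : IsSmoothForm η) : ContDiff ℝ ∞ (uncurry (compX (pullback S η))) :=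
  contDiff_pullback_apply hS hη ![(1, 0)]

theorem contDiff_compY (hS : ContMDiff 𝓘(ℝ, ℝ × ℝ) 𝓘(ℝ, E) ∞ S) {η : DForm E M F 1}
    (hη : IsSmoothForm η) : ContDiff ℝ ∞ (uncurry (compY (pullback S η))) :=
  contDiff_pullback_apply hS hη ![(0, 1)]

theorem contDiff_compXY (hS : ContMDiff 𝓘(ℝ, ℝ × ℝ) 𝓘(ℝ, E) ∞ S) {η : DForm E M F 2}
    (hη : IsSmoothForm η) : ContDiff ℝ ∞ (uncurry (compXY (pullback S η))) :=
  contDiff_pullback_apply hS hη ![(1, 0), (0, 1)]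

/-- `∂_x φ`. -/
noncomputable def partialX (φ : ℝ → ℝ → F) (x y : ℝ) : F := fderiv ℝ (uncurry φ) (x, y) (1, 0)

/-- `∂_y φ`. -/
noncomputable def partialY (φ : ℝ → ℝ → F) (x y : ℝ) : F := fderiv ℝ (uncurry φ) (x, y) (0, 1)

theorem continuous_partialX {φ : ℝ → ℝ → F} (hφ : ContDiff ℝ ∞ (uncurry φ)) :
    Continuous (uncurry (partialX φ)) :=
  (hφ.continuous_fderiv (by simp)).clm_apply continuous_const

theorem continuous_partialY {φ : ℝ → ℝ → F} (hφ : ContDiff ℝ ∞ (uncurry φ)) :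
    Continuous (uncurry (partialY φ)) :=
  (hφ.continuous_fderiv (by simp)).clm_apply continuous_const

theorem hasDerivAt_partialX {φ : ℝ → ℝ → F} (hφ : ContDiff ℝ ∞ (uncurry φ)) (x y : ℝ) :
    HasDerivAt (fun r => φ r y) (partialX φ x y) x :=
  ((hφ.differentiable (by simp) (x, y)).hasFDerivAt.comp_hasDerivAt x
    ((hasDerivAt_id x).prodMk (hasDerivAt_const x y)) :)

theorem hasDerivAt_partialY {φ : ℝ → ℝ → F} (hφ : ContDiff ℝ ∞ (uncurry φ)) (x y : ℝ) :
    HasDerivAt (fun r => φ x r) (partialY φ x y) y :=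
  ((hφ.differentiable (by simp) (x, y)).hasFDerivAt.comp_hasDerivAt y
    ((hasDerivAt_const y x).prodMk (hasDerivAt_id y)) :)

theorem compXY_pullback_dForm (hS : ContMDiff 𝓘(ℝ, ℝ × ℝ) 𝓘(ℝ, E) ∞ S) {η : DForm E M F 1}
    (hη : IsSmoothForm η) (x y : ℝ) : compXY (pullback S (dForm η)) x y
      = partialX (compY (pullback S η)) x y - partialY (compX (pullback S η)) x y := by
  have h : compXY (pullback S (dForm η)) x y = pullbackForm S (dForm η) (x, y) ![(1, 0), (0, 1)] :=
    rfl
  rw [h, pullback_dForm hS hη, extDeriv_apply (differentiable_pullback hS hη _)]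
  have e0 : (0 : Fin 2).removeNth ![((1, 0) : ℝ × ℝ), (0, 1)] = ![(0, 1)] := by
    ext i <;> fin_cases i <;> rfl
  have e1 : (1 : Fin 2).removeNth ![((1, 0) : ℝ × ℝ), (0, 1)] = ![(1, 0)] := by
    ext i <;> fin_cases i <;> rfl
  refine (Fin.sum_univ_two _).trans ?_
  rw [e0, e1, Fin.val_zero, Fin.val_one, pow_zero, pow_one, one_smul, neg_smul, ← sub_eq_add_neg, one_smul]
  rfl

end Components

section Wedge

variable {S : ℝ × ℝ → M} {F₁ F₂ F₃ : Type*} [NormedAddCommGroup F₁] [NormedSpace ℝ F₁]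
  [NormedAddCommGroup F₂] [NormedSpace ℝ F₂] [NormedAddCommGroup F₃] [NormedSpace ℝ F₃]

theorem compXY_pullback_wedge (b : F₁ →L[ℝ] F₂ →L[ℝ] F₃) (α : DForm E M F₁ 1)
    (β : DForm E M F₂ 1) (x y : ℝ) :
    compXY (pullback S fun p => wedge b (α p) (β p)) x y
      = b (compX (pullback S α) x y) (compY (pullback S β) x y)
        - b (compY (pullback S α) x y) (compX (pullback S β) x y) := by
  rw [compXY_pullback_eq, compX_pullback_eq, compX_pullback_eq, compY_pullback_eq,
    compY_pullback_eq]
  rfl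

end Wedge

section Gauge

variable {EG EH G H : Type*}
  [NormedAddCommGroup EG] [NormedSpace ℝ EG] [FiniteDimensional ℝ EG]
  [NormedAddCommGroup EH] [NormedSpace ℝ EH] [FiniteDimensional ℝ EH]
  [TopologicalSpace G] [ChartedSpace EG G] [Group G] [LieGroup 𝓘(ℝ, EG) ∞ G]
  [TopologicalSpace H] [ChartedSpace EH H] [Group H] [LieGroup 𝓘(ℝ, EH) ∞ H]
  (X : LieCrossedModule EG EH G H)
  {S : ℝ × ℝ → M} {g : M → G}

theorem mdifferentiableAt_quotient (hg : ContMDiff 𝓘(ℝ, E) 𝓘(ℝ, EG) ∞ g) (p : M) :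
    MDifferentiableAt 𝓘(ℝ, E) 𝓘(ℝ, EG) (fun q => g q * (g p)⁻¹) p :=
  (hg.mul contMDiff_const).mdifferentiable (by simp) p

theorem compX_rightMaurerCartan (x y : ℝ) : compX (pullback S (rightMaurerCartan g : DForm E M EG 1)) x y
    = (tangentDeriv (fun q => g q * (g (S (x, y)))⁻¹) (S (x, y)) : E →L[ℝ] EG)
      ((tangentDeriv S (x, y) : ℝ × ℝ →L[ℝ] E) (1, 0)) := by
  rw [compX_pullback_eq]; rfl

theorem compY_rightMaurerCartan (x y : ℝ) : compY (pullback S (rightMaurerCartan g : DForm E M EG 1)) x y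
    = (tangentDeriv (fun q => g q * (g (S (x, y)))⁻¹) (S (x, y)) : E →L[ℝ] EG)
      ((tangentDeriv S (x, y) : ℝ × ℝ →L[ℝ] E) (0, 1)) := by
  rw [compY_pullback_eq]; rfl

theorem hasRightLogDerivAt_comp_x (hS : ContMDiff 𝓘(ℝ, ℝ × ℝ) 𝓘(ℝ, E) ∞ S)
    (hg : ContMDiff 𝓘(ℝ, E) 𝓘(ℝ, EG) ∞ g) (x y : ℝ) :
    HasRightLogDerivAt (fun r => g (S (r, y))) (compX (pullback S (rightMaurerCartan g : DForm E M EG 1)) x y) x := by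
  rw [hasRightLogDerivAt_iff, compX_rightMaurerCartan]
  exact (hasVelocityAt_x hS x y).comp (F := fun q => g q * (g (S (x, y)))⁻¹) rfl
    (mdifferentiableAt_quotient hg _)

theorem hasRightLogDerivAt_comp_y (hS : ContMDiff 𝓘(ℝ, ℝ × ℝ) 𝓘(ℝ, E) ∞ S)
    (hg : ContMDiff 𝓘(ℝ, E) 𝓘(ℝ, EG) ∞ g) (x y : ℝ) :
    HasRightLogDerivAt (fun r => g (S (x, r))) (compY (pullback S (rightMaurerCartan g : DForm E M EG 1)) x y) y := by
  rw [hasRightLogDerivAt_iff, compY_rightMaurerCartan]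
  exact (hasVelocityAt_y hS x y).comp (F := fun q => g q * (g (S (x, y)))⁻¹) rfl
    (mdifferentiableAt_quotient hg _)

/-- Gives continuity of the components of `dκ κ⁻¹`: the map `(p, q) ↦ κ(q) κ(p)⁻¹` is smooth and
equals `1` on the diagonal. -/
theorem continuous_tangentDeriv_quotient (hS : ContMDiff 𝓘(ℝ, ℝ × ℝ) 𝓘(ℝ, E) ∞ S)
    (hg : ContMDiff 𝓘(ℝ, E) 𝓘(ℝ, EG) ∞ g) :
    Continuous fun p : ℝ × ℝ =>
      (tangentDeriv (fun q => g (S q) * (g (S p))⁻¹) p : ℝ × ℝ →L[ℝ] EG) := by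
  have hgS := hg.comp hS
  refine (contMDiff_tangentDeriv_diag (K := G) (F := fun p q => g (S q) * (g (S p))⁻¹) ?_
    (c := 1) (fun p => mul_inv_cancel _)).continuous
  exact (hgS.comp contMDiff_snd).mul (hgS.comp contMDiff_fst).inv

theorem tangentDeriv_quotient_comp (hS : ContMDiff 𝓘(ℝ, ℝ × ℝ) 𝓘(ℝ, E) ∞ S)
    (hg : ContMDiff 𝓘(ℝ, E) 𝓘(ℝ, EG) ∞ g) (p : ℝ × ℝ) :
    (tangentDeriv (fun q => g (S q) * (g (S p))⁻¹) p : ℝ × ℝ →L[ℝ] EG)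
      = (tangentDeriv (fun q => g q * (g (S p))⁻¹) (S p) : E →L[ℝ] EG).comp
        (tangentDeriv S p : ℝ × ℝ →L[ℝ] E) :=
  tangentDeriv_comp (F := fun q => g q * (g (S p))⁻¹) (mdifferentiableAt_quotient hg _)
    (hS.mdifferentiable (by simp) p)

theorem continuous_compX_rightMaurerCartan (hS : ContMDiff 𝓘(ℝ, ℝ × ℝ) 𝓘(ℝ, E) ∞ S)
    (hg : ContMDiff 𝓘(ℝ, E) 𝓘(ℝ, EG) ∞ g) :
    Continuous (uncurry (compX (pullback S (rightMaurerCartan g : DForm E M EG 1)))) := by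
  refine ((continuous_tangentDeriv_quotient hS hg).clm_apply
    (continuous_const (y := ((1, 0) : ℝ × ℝ)))).congr fun p => ?_
  rw [tangentDeriv_quotient_comp hS hg]
  exact (compX_rightMaurerCartan p.1 p.2).symm

theorem continuous_compY_rightMaurerCartan (hS : ContMDiff 𝓘(ℝ, ℝ × ℝ) 𝓘(ℝ, E) ∞ S)
    (hg : ContMDiff 𝓘(ℝ, E) 𝓘(ℝ, EG) ∞ g) :
    Continuous (uncurry (compY (pullback S (rightMaurerCartan g : DForm E M EG 1)))) := by
  refine ((continuous_tangentDeriv_quotient hS hg).clm_apply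
    (continuous_const (y := ((0, 1) : ℝ × ℝ)))).congr fun p => ?_
  rw [tangentDeriv_quotient_comp hS hg]
  exact (compY_rightMaurerCartan p.1 p.2).symm

theorem half_smul_wedge_bracket (α : DForm E M EG 1) (x y : ℝ) :
    (1 / 2 : ℝ) • compXY (pullback S fun p => wedge (lieBracketCLM G) (α p) (α p)) x y
      = lieBracketCLM G (compX (pullback S α) x y) (compY (pullback S α) x y) := by
  rw [compXY_pullback_wedge, lieBracketCLM_skew (compY (pullback S α) x y), sub_neg_eq_add,
    ← two_smul ℝ, smul_smul]
  norm_num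

variable [IsManifold 𝓘(ℝ, E) ∞ M]

theorem compXY_gaugeTwo (hS : ContMDiff 𝓘(ℝ, ℝ × ℝ) 𝓘(ℝ, E) ∞ S) {J : DForm E M EH 1}
    (hJ : IsSmoothForm J) (θ : DForm E M EG 1) (Υ : DForm E M EH 2) (x y : ℝ) :
    compXY (pullback S (X.gaugeTwo g J θ Υ)) x y
      = X.mDot (g (S (x, y))) (compXY (pullback S Υ) x y)
        - (partialX (compY (pullback S J)) x y - partialY (compX (pullback S J)) x y)
        - lieBracketCLM H (compX (pullback S J) x y) (compY (pullback S J) x y)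
        - (X.mHat (compX (pullback S (X.gaugeOne g J θ)) x y) (compY (pullback S J) x y)
          - X.mHat (compY (pullback S (X.gaugeOne g J θ)) x y) (compX (pullback S J) x y)) := by
  have : CompleteSpace EH := FiniteDimensional.complete ℝ EH
  rw [← compXY_pullback_dForm hS hJ, ← half_smul_wedge_bracket (G := H), ← compXY_pullback_wedge]
  rfl

theorem compXY_fakeCurvature (hS : ContMDiff 𝓘(ℝ, ℝ × ℝ) 𝓘(ℝ, E) ∞ S) {θ : DForm E M EG 1}
    {Υ : DForm E M EH 2} (hD : X.IsConnectionDoublet θ Υ) (x y : ℝ) :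
    partialX (compY (pullback S θ)) x y - partialY (compX (pullback S θ)) x y
      + lieBracketCLM G (compX (pullback S θ) x y) (compY (pullback S θ) x y)
      = X.tDot (compXY (pullback S Υ) x y) := by
  have : CompleteSpace EG := FiniteDimensional.complete ℝ EG
  rw [← compXY_pullback_dForm hS hD.smooth_one, ← half_smul_wedge_bracket, ← sub_eq_zero]
  let R : DForm E M EG 2 := fun p => dForm θ p + (1 / 2 : ℝ) • wedge (lieBracketCLM G) (θ p) (θ p)
    - X.tDot.compContinuousAlternatingMap (Υ p)
  have h : compXY (pullback S R) x y = 0 := by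
    rw [compXY_pullback_eq, show modelValue R (S (x, y)) = 0 from hD.fakeCurvature (S (x, y))]
    rfl
  exact h

end Gauge

end

end HigherGauge

/-! ### From the plane back to parallel transport -/

namespace HigherGauge

set_option linter.unusedSectionVars false

section

open Function

variable {EG EH E G H M : Type*}
  [NormedAddCommGroup EG] [NormedSpace ℝ EG] [FiniteDimensional ℝ EG]
  [NormedAddCommGroup EH] [NormedSpace ℝ EH] [FiniteDimensional ℝ EH]
  [NormedAddCommGroup E] [NormedSpace ℝ E]
  [TopologicalSpace G] [ChartedSpace EG G] [Group G] [LieGroup 𝓘(ℝ, EG) ∞ G]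
  [TopologicalSpace H] [ChartedSpace EH H] [Group H] [LieGroup 𝓘(ℝ, EH) ∞ H]
  [TopologicalSpace M] [ChartedSpace E M]

/-- Exchanging the end points inverts a holonomy. -/
theorem rightSolution_swap {A : ℝ → EG} (hA : Continuous A) (x₀ x₁ : ℝ) :
    (rightSolution A x₀ x₁ : G) = (rightSolution A x₁ x₀)⁻¹ := by
  have h := rightSolution_spec (G := G) hA x₁
  rw [rightSolution_eq (u := fun s => (rightSolution A x₁ s : G) * (rightSolution A x₁ x₀)⁻¹)
    (mul_inv_cancel _) fun s => (h.2 s).mul_const _]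
  simp [h.1]

variable [IsManifold 𝓘(ℝ, E) ∞ M] (X : LieCrossedModule EG EH G H)
  {θ : DForm E M EG 1} {Υ : DForm E M EH 2} {g : M → G} {J : DForm E M EH 1}
  {p₀ p₁ : M} {γ₀ γ₁ : Curve E p₀ p₁}

namespace Surface

variable (S : Surface γ₀ γ₁)

theorem apply_zero_left (y : ℝ) : S.toFun (0, y) = p₀ := by
  obtain ⟨ε, h0, -, h, -⟩ := S.sitting
  exact h 0 y h0

theorem apply_one_left (y : ℝ) : S.toFun (1, y) = p₁ := by
  obtain ⟨ε, h0, -, -, h, -⟩ := S.sitting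
  exact h 1 y (by linarith)

theorem apply_zero_right (x : ℝ) : S.toFun (x, 0) = γ₀.toFun x := by
  obtain ⟨ε, h0, -, -, -, h, -⟩ := S.sitting
  exact h x 0 h0

theorem apply_one_right (x : ℝ) : S.toFun (x, 1) = γ₁.toFun x := by
  obtain ⟨ε, h0, -, -, -, -, h⟩ := S.sitting
  exact h x 1 (by linarith)

end Surface

namespace LieCrossedModule

/-- The coordinate data of the pull-back of a connection doublet and a 1-gauge transformation along a
surface. -/
noncomputable def planeGauge (hD : X.IsConnectionDoublet θ Υ) (hg : ContMDiff 𝓘(ℝ, E) 𝓘(ℝ, EG) ∞ g)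
    (hJ : IsSmoothForm J) (S : Surface γ₀ γ₁) : X.PlaneGauge :=
  have : CompleteSpace EG := FiniteDimensional.complete ℝ EG
  have : CompleteSpace EH := FiniteDimensional.complete ℝ EH
  { ax := compX (pullback S.toFun θ)
    ay := compY (pullback S.toFun θ)
    axy := partialY (compX (pullback S.toFun θ))
    ayx := partialX (compY (pullback S.toFun θ))
    σx := compX (pullback S.toFun (rightMaurerCartan g : DForm E M EG 1))
    σy := compY (pullback S.toFun (rightMaurerCartan g : DForm E M EG 1))
    b := compXY (pullback S.toFun Υ)
    Γx := compX (pullback S.toFun J)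
    Γy := compY (pullback S.toFun J)
    Γxy := partialY (compX (pullback S.toFun J))
    Γyx := partialX (compY (pullback S.toFun J))
    κ := fun x y => g (S.toFun (x, y))
    continuous_ax := (contDiff_compX S.smooth hD.smooth_one).continuous
    continuous_ay := (contDiff_compY S.smooth hD.smooth_one).continuous
    continuous_axy := continuous_partialY (contDiff_compX S.smooth hD.smooth_one)
    continuous_σx := continuous_compX_rightMaurerCartan S.smooth hg
    continuous_σy := continuous_compY_rightMaurerCartan S.smooth hg
    continuous_b := (contDiff_compXY S.smooth hD.smooth_two).continuous
    continuous_Γx := (contDiff_compX S.smooth hJ).continuous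
    continuous_Γy := (contDiff_compY S.smooth hJ).continuous
    continuous_Γxy := continuous_partialY (contDiff_compX S.smooth hJ)
    continuous_Γyx := continuous_partialX (contDiff_compY S.smooth hJ)
    continuous_κ := hg.continuous.comp S.smooth.continuous
    hasDerivAt_ax := hasDerivAt_partialY (contDiff_compX S.smooth hD.smooth_one)
    hasDerivAt_ay := hasDerivAt_partialX (contDiff_compY S.smooth hD.smooth_one)
    hasDerivAt_Γx := hasDerivAt_partialY (contDiff_compX S.smooth hJ)
    hasDerivAt_Γy := hasDerivAt_partialX (contDiff_compY S.smooth hJ)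
    hasRightLogDerivAt_x := hasRightLogDerivAt_comp_x S.smooth hg
    hasRightLogDerivAt_y := hasRightLogDerivAt_comp_y S.smooth hg
    fakeFlat := compXY_fakeCurvature X S.smooth hD
    ay_one := compY_pullback_eq_zero S.smooth S.apply_one_left θ
    κ_one := fun y y' => by rw [S.apply_one_left, S.apply_one_left]
    Γy_one := compY_pullback_eq_zero S.smooth S.apply_one_left J
    Γy_zero := compY_pullback_eq_zero S.smooth S.apply_zero_left J }

theorem planeGauge_b' (hD : X.IsConnectionDoublet θ Υ) (hg : ContMDiff 𝓘(ℝ, E) 𝓘(ℝ, EG) ∞ g)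
    (hJ : IsSmoothForm J) (S : Surface γ₀ γ₁)
    (x y : ℝ) : (X.planeGauge hD hg hJ S).b' x y
    = compXY (pullback S.toFun (X.gaugeTwo g J θ Υ)) x y :=
  (compXY_gaugeTwo X S.smooth hJ θ Υ x y).symm

theorem gaugeHolonomy_eq (hD : X.IsConnectionDoublet θ Υ) (hg : ContMDiff 𝓘(ℝ, E) 𝓘(ℝ, EG) ∞ g)
    (hJ : IsSmoothForm J) (S : Surface γ₀ γ₁)
    (y : ℝ) :
    X.gaugeHolonomy g J θ Υ S y = ((X.planeGauge hD hg hJ S).μ 0 y)⁻¹ := by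
  set d := X.planeGauge hD hg hJ S with hd
  have h : X.gaugeHolonomy g J θ Υ S y
      = leftSolution (fun r => -(X.mDot ((d.u r y)⁻¹ * (d.κ r y)⁻¹) (d.Γx r y))) 1 0 := rfl
  have e : (fun r => -(X.mDot ((d.u r y)⁻¹ * (d.κ r y)⁻¹) (d.Γx r y))) = fun r => d.c r y := by
    funext r
    rw [PlaneGauge.c, PlaneGauge.w, mul_inv_rev]
  rw [h, e, leftSolution_eq (PlaneGauge.continuous_slice d.continuous_c y)]
  rfl

/-- The transport along a curve, in terms of a surface which restricts to it. -/
theorem transportCurve_eq (S : Surface γ₀ γ₁) {γ : Curve E p₀ p₁} {y : ℝ} (h : ∀ x, S.toFun (x, y) = γ.toFun x)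
    {θ : DForm E M EG 1} (Υ : DForm E M EH 2)
    (hθ : Continuous (uncurry (compX (pullback S.toFun θ)))) :
    X.transportCurve θ Υ γ
      = (rightSolution (fun r => -compX (pullback S.toFun θ) r y) 1 0)⁻¹ := by
  have e : (fun r => -compX (pullback (unitSurface γ).toFun θ) r 0)
      = fun r => -compX (pullback S.toFun θ) r y :=
    funext fun r => by rw [compX_pullback_congr S.smooth (unitSurface γ).smooth h]
  have h' : X.transportCurve θ Υ γ
    = rightSolution (fun r => -compX (pullback (unitSurface γ).toFun θ) r 0) 0 1 := rfl
  rw [h', e, rightSolution_swap]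
  exact (PlaneGauge.continuous_slice hθ y).neg

/-- Gauge covariance of the transport along curves. -/
theorem transportCurve_gauge (hD : X.IsConnectionDoublet θ Υ) (hg : ContMDiff 𝓘(ℝ, E) 𝓘(ℝ, EG) ∞ g)
    (hJ : IsSmoothForm J) (S : Surface γ₀ γ₁)
    {γ : Curve E p₀ p₁} {y : ℝ} (h : ∀ x, S.toFun (x, y) = γ.toFun x) :
    X.transportCurve (X.gaugeOne g J θ) (X.gaugeTwo g J θ Υ) γ
      = g p₁ * X.t (X.gaugeHolonomy g J θ Υ S y) * X.transportCurve θ Υ γ * (g p₀)⁻¹ := by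
  set d := X.planeGauge hD hg hJ S with hd
  rw [X.transportCurve_eq S h Υ d.continuous_ax, X.transportCurve_eq S h (θ := X.gaugeOne g J θ) _ d.continuous_ax',
    X.gaugeHolonomy_eq hD hg hJ]
  -- The transport along the curve is the inverse of the solution based at `x = 1`, evaluated at `x
  -- = 0`. Inverting `κ u t(μ) κ(1, 0)⁻¹` reverses the factors, and `μ⁻¹` is the gauge holonomy.
  have h1 : (rightSolution (fun r => -compX (pullback S.toFun (X.gaugeOne g J θ)) r y) 1 0 : G)
      = d.κ 0 y * d.u 0 y * X.t (d.μ 0 y) * (d.κ 1 0)⁻¹ := congrFun (d.rightSolution_ax' y) 0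
  have h2 : (rightSolution (fun r => -compX (pullback S.toFun θ) r y) 1 0 : G) = d.u 0 y := rfl
  have h3 : d.κ 0 y = g p₀ := congrArg g (S.apply_zero_left y)
  have h4 : d.κ 1 0 = g p₁ := congrArg g (S.apply_one_left 0)
  rw [h1, h2, h3, h4]
  simp [mul_assoc, ← hd]

/-- The edge `x = 1` is constant, so the vertical solution based there is `1`. Leaving `u` as a
parameter lets the explicit `u'` be used for the transformed doublet. -/
theorem transportSurface_eq (S : Surface γ₀ γ₁) {θ : DForm E M EG 1} {Υ : DForm E M EH 2} {u : ℝ → ℝ → G}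
    (hu : Continuous (uncurry u))
    (hu' : ∀ y, (rightSolution (fun r => -compX (pullback S.toFun θ) r y) 1 : ℝ → G)
      = fun x => u x y) (hΥ : Continuous (uncurry (compXY (pullback S.toFun Υ)))) :
    X.transportSurface θ Υ S = rightSolution
      (fun y => X.surfaceDensity u (compXY (pullback S.toFun Υ)) 1 0 y) 0 1 := by
  have hv : (rightSolution (fun r => -compY (pullback S.toFun θ) 1 r) 0 : ℝ → G) = fun _ => 1 := by
    refine rightSolution_eq rfl fun s => ?_
    rw [compY_pullback_eq_zero S.smooth S.apply_one_left, neg_zero]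
    exact hasRightLogDerivAt_const 1 s
  have e : X.transportSurface θ Υ S = Classical.epsilon (X.IsSurfaceSolution
      (fun s r => rightSolution (fun r' => -compX (pullback S.toFun θ) r' s) 1 r)
      (rightSolution (fun r => -compY (pullback S.toFun θ) 1 r) 0)
      (compXY (pullback S.toFun Υ)) 1 0) 0 1 := rfl
  rw [e, hv]
  simp only [hu']
  rw [X.epsilon_surfaceSolution hu hΥ]

/-- Gauge covariance of the transport along surfaces. -/
theorem transportSurface_gauge (hD : X.IsConnectionDoublet θ Υ) (hg : ContMDiff 𝓘(ℝ, E) 𝓘(ℝ, EG) ∞ g)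
    (hJ : IsSmoothForm J) (S : Surface γ₀ γ₁) :
    X.transportSurface (X.gaugeOne g J θ) (X.gaugeTwo g J θ Υ) S
      = X.m (g p₁) (X.gaugeHolonomy g J θ Υ S 1 * X.transportSurface θ Υ S
          * (X.gaugeHolonomy g J θ Υ S 0)⁻¹) := by
  set d := X.planeGauge hD hg hJ S with hd
  have hb : compXY (pullback S.toFun (X.gaugeTwo g J θ Υ)) = d.b' :=
    funext₂ fun x y => (X.planeGauge_b' hD hg hJ S x y).symm
  rw [X.gaugeHolonomy_eq hD hg hJ, X.gaugeHolonomy_eq hD hg hJ,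
    X.transportSurface_eq S d.continuous_u (fun y => rfl) d.continuous_b,
    X.transportSurface_eq S (θ := X.gaugeOne g J θ) d.continuous_u' d.rightSolution_ax' (hb ▸ d.continuous_b'), hb,
    d.rightSolution_K']
  have h4 : d.κ 1 0 = g p₁ := congrArg g (S.apply_one_left 0)
  rw [h4, inv_inv]
  rfl

end LieCrossedModule

end

end HigherGauge

open HigherGauge in
theorem mainTheorem6
    {EG EH E G H M : Type*}
    [NormedAddCommGroup EG] [NormedSpace ℝ EG] [FiniteDimensional ℝ EG]
    [NormedAddCommGroup EH] [NormedSpace ℝ EH] [FiniteDimensional ℝ EH]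
    [NormedAddCommGroup E] [NormedSpace ℝ E] [FiniteDimensional ℝ E]
    [TopologicalSpace G] [ChartedSpace EG G] [Group G] [LieGroup 𝓘(ℝ, EG) ∞ G]
    [TopologicalSpace H] [ChartedSpace EH H] [Group H] [LieGroup 𝓘(ℝ, EH) ∞ H]
    [TopologicalSpace M] [ChartedSpace E M] [IsManifold 𝓘(ℝ, E) ∞ M]
    (X : LieCrossedModule EG EH G H)
    (θ : DForm E M EG 1) (Υ : DForm E M EH 2) (hD : X.IsConnectionDoublet θ Υ)
    (g : M → G) (hg : ContMDiff 𝓘(ℝ, E) 𝓘(ℝ, EG) ∞ g)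
    (J : DForm E M EH 1) (hJ : IsSmoothForm J)
    {p₀ p₁ : M} {γ₀ γ₁ : Curve E p₀ p₁} (S : Surface γ₀ γ₁) :
    X.transportCurve (X.gaugeOne g J θ) (X.gaugeTwo g J θ Υ) γ₀
      = g p₁ * X.t (X.gaugeHolonomy g J θ Υ S 0) * X.transportCurve θ Υ γ₀ * (g p₀)⁻¹ ∧
    X.transportCurve (X.gaugeOne g J θ) (X.gaugeTwo g J θ Υ) γ₁
      = g p₁ * X.t (X.gaugeHolonomy g J θ Υ S 1) * X.transportCurve θ Υ γ₁ * (g p₀)⁻¹ ∧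
    X.transportSurface (X.gaugeOne g J θ) (X.gaugeTwo g J θ Υ) S
      = X.m (g p₁) (X.gaugeHolonomy g J θ Υ S 1 * X.transportSurface θ Υ S
          * (X.gaugeHolonomy g J θ Υ S 0)⁻¹) := by
  exact ⟨X.transportCurve_gauge hD hg hJ S S.apply_zero_right,
    X.transportCurve_gauge hD hg hJ S S.apply_one_right, X.transportSurface_gauge hD hg hJ S⟩
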